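/- Let $n,m\in\mathbb N$, let $a_1,\dots,a_n\in\mathbb R^n$ be linearly independent and let $Q=\{t_1a_1+\dots+t_na_n : 0\le t_j\le 1\}$, with faces $\partial Q_j^s=\{\sum_i t_ia_i\in Q : t_j=s\}$, $s\in\{0,1\}$. For $u\in H^2(Q;\mathbb R^{2m})$ let $u_j^s$ and $\partial_ju^s$ denote the Dirichlet trace and the Neumann trace (with respect to the outward unit normal) of $u$ on $\partial Q_j^s$. Let $-\Delta_{0,\mathbb R}$ be the periodic Laplacian in the real Hilbert space $L^2(Q;\mathbb R^{2m})$, that is, $-\Delta_{0,\mathbb R}u=-\Delta u$ with domain $$\operatorname{dom}(-\Delta_{0,\mathbb R})=\big\{u\in H^2(Q;\mathbb R^{2m}) : u_j^1(x)=u_j^0(x-a_j),\ \partial_ju^1(x)=-\partial_ju^0(x-a_j)\ \text{for a.e. } x\in\partial Q_j^1,\ 1\le j\le n\big\}.$$ Let $V\in L^\infty(Q;\mathbb R^{m\times m})$ satisfy $V(x)^\top=V(x)$ for a.e. $x\in Q$, and suppose that $V$ is continuous at $0$ (as a function on $Q$) and that the matrix $V(0)$ is invertible. For $\tau\in(0,1]$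 put $V_{\tau,\mathbb R}(x)=\tau^2V(\tau x)\otimes I_2$, acting in $L^2(Q;\mathbb R^{2m})$ by multiplication. For an operator or a real symmetric matrix $T$ let $\operatorname{Mor}(T)$ be the number of its negative eigenvalues counted with multiplicity, $\operatorname{Mor}(T)=\sum_{\lambda<0}\dim_{\mathbb R}\ker(T-\lambda)$. Then there is $\tau_0\in(0,1]$ such that for every $\tau\in(0,\tau_0)$: (i) $0\notin\operatorname{Spec}\big(-\Delta_{0,\mathbb R}+V_{\tau,\mathbb R}\big)$; (ii) $\operatorname{Mor}\big(-\Delta_{0,\mathbb R}+V_{\tau,\mathbb R}\big)=2\operatorname{Mor}\big(V(0)\big)$. -/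

import Mathlib

open MeasureTheory Filter Topology
open scoped ENNReal ContDiff Kronecker Matrix

noncomputable section

namespace PeriodicSchrodinger

/-! ### Spectrum and Morse index of an unbounded operator -/

section Operators

variable {H : Type*} [NormedAddCommGroup H] [NormedSpace ℝ H]

/-- `lam` is a regular point of `T`: the operator `T - lam`, from its domain to `H`, is a bijection
and its inverse `R` is bounded on `H`. -/
def IsRegularPoint (T : H →ₗ.[ℝ] H) (lam : ℝ) : Prop :=
  ∃ R : H →L[ℝ] H,
    (∀ y : H, ∃ h : R y ∈ T.domain, T ⟨R y, h⟩ - lam • R y = y) ∧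
    ∀ x : T.domain, R (T x - lam • (x : H)) = x

/-- The (real) spectrum of an operator with domain, acting in a real space. -/
def Spec (T : H →ₗ.[ℝ] H) : Set ℝ := {lam | ¬ IsRegularPoint T lam}

/-- `ker (T - lam)`. -/
def eigenspace (T : H →ₗ.[ℝ] H) (lam : ℝ) : Submodule ℝ H where
  carrier := {x | ∃ h : x ∈ T.domain, T ⟨x, h⟩ = lam • x}
  zero_mem' := ⟨T.domain.zero_mem, by
    rw [smul_zero]; exact T.map_zero⟩
  add_mem' := by
    rintro x y ⟨hx, ex⟩ ⟨hy, ey⟩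
    refine ⟨T.domain.add_mem hx hy, ?_⟩
    have := T.map_add ⟨x, hx⟩ ⟨y, hy⟩
    rw [ex, ey, ← smul_add] at this
    exact this
  smul_mem' := by
    rintro c x ⟨hx, ex⟩
    refine ⟨T.domain.smul_mem c hx, ?_⟩
    have := T.map_smul c ⟨x, hx⟩
    rw [ex, smul_comm] at this
    exact this

/-- The Morse index: the number of negative eigenvalues counted with multiplicity, i.e.
`∑_{lam < 0} dim ker (T - lam)`, an element of `ℕ ∪ {∞}` (the sum of a family in `ℕ ∪ {∞}` is the
supremum of its finite partial sums). -/
def morseIndex (T : H →ₗ.[ℝ] H) : ℕ∞ :=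
  ⨆ s : Finset {lam : ℝ // lam < 0},
    ∑ lam ∈ s, Cardinal.toENat (Module.rank ℝ (eigenspace T lam))

/-- The Morse index of a square matrix, as an operator (defined everywhere) on Euclidean space. -/
def matrixMorseIndex {m : ℕ} (M : Matrix (Fin m) (Fin m) ℝ) : ℕ∞ :=
  morseIndex ((Matrix.toEuclideanLin M).toPMap ⊤)

end Operators

/-! ### The unit cell and the space `L²(Q; ℝ²ᵐ)` -/

/-- `ℝⁿ`. -/
abbrev Space (n : ℕ) : Type := EuclideanSpace ℝ (Fin n)

/-- `ℝ²ᵐ`; the index `(l, 0)`, resp. `(l, 1)`, stands for the first, resp. second, entry of the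
`l`-th of the `m` blocks of size two, so that Kronecker products `M ⊗ N` with `M` of size `m` and
`N` of size two act on it. -/
abbrev Vec (m : ℕ) : Type := EuclideanSpace ℝ (Fin m × Fin 2)

variable {n : ℕ} (a : Fin n → Space n) {m : ℕ}

/-- Lebesgue measure on the unit cell `Q = {∑ tⱼ aⱼ | 0 ≤ tⱼ ≤ 1}`. -/
def cellMeasure : Measure (Space n) := volume.restrict (parallelepiped a)

/-- The real Hilbert space `L²(Q; ℝ²ᵐ)`. -/
abbrev L2 (m : ℕ) : Type := Lp (Vec m) 2 (cellMeasure a)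

/-! ### Weak derivatives and Sobolev spaces -/

/-- `v = ∂ᵢ u` in the sense of distributions in the interior of `Q`. -/
def HasWeakPartial (i : Fin n) (u v : L2 a m) : Prop :=
  ∀ φ : Space n → ℝ, ContDiff ℝ ∞ φ → HasCompactSupport φ →
    tsupport φ ⊆ interior (parallelepiped a) →
      ∫ x, fderiv ℝ φ x (EuclideanSpace.single i 1) • u x ∂(cellMeasure a) =
        -∫ x, φ x • v x ∂(cellMeasure a)

variable {a}

instance : IsFiniteMeasure (cellMeasure a) := by
  have hc : IsCompact (parallelepiped a) := by
    unfold parallelepiped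
    exact isCompact_Icc.image (by fun_prop)
  exact ⟨by rw [cellMeasure, Measure.restrict_apply_univ]; exact hc.measure_lt_top⟩

lemma integrable_smul_L2 (u : L2 a m) {f : Space n → ℝ} (hf : Continuous f)
    (hs : HasCompactSupport f) : Integrable (fun x => f x • u x) (cellMeasure a) := by
  have hu : Integrable u (cellMeasure a) := (Lp.memLp u).integrable (by norm_num)
  obtain ⟨C, hC⟩ := hs.exists_bound_of_continuous hf
  exact hu.bdd_smul C hf.aestronglyMeasurable (ae_of_all _ hC)

lemma continuous_partial {φ : Space n → ℝ} (h : ContDiff ℝ ∞ φ) (w : Space n) :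
    Continuous (fun x => fderiv ℝ φ x w) :=
  (h.continuous_fderiv (by simp)).clm_apply continuous_const

lemma hasCompactSupport_partial {φ : Space n → ℝ} (h : HasCompactSupport φ) (w : Space n) :
    HasCompactSupport (fun x => fderiv ℝ φ x w) :=
  h.fderiv_apply (𝕜 := ℝ) w

lemma integral_smul_add (u v : L2 a m) {f : Space n → ℝ} (hf : Continuous f)
    (hs : HasCompactSupport f) :
    ∫ x, f x • (u + v : L2 a m) x ∂(cellMeasure a) =
      ∫ x, f x • u x ∂(cellMeasure a) + ∫ x, f x • v x ∂(cellMeasure a) := by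
  rw [← integral_add (integrable_smul_L2 u hf hs) (integrable_smul_L2 v hf hs)]
  refine integral_congr_ae ?_
  filter_upwards [Lp.coeFn_add u v] with x hx
  rw [hx, Pi.add_apply, smul_add]

lemma integral_smul_smul (c : ℝ) (u : L2 a m) (f : Space n → ℝ) :
    ∫ x, f x • (c • u : L2 a m) x ∂(cellMeasure a) =
      c • ∫ x, f x • u x ∂(cellMeasure a) := by
  rw [← integral_smul]
  refine integral_congr_ae ?_
  filter_upwards [Lp.coeFn_smul c u] with x hx
  rw [hx, Pi.smul_apply, smul_comm]

lemma HasWeakPartial.add {i : Fin n} {u v u' v' : L2 a m} (h : HasWeakPartial a i u v)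
    (h' : HasWeakPartial a i u' v') : HasWeakPartial a i (u + u') (v + v') := by
  intro φ h1 h2 h3
  rw [integral_smul_add _ _ (continuous_partial h1 _) (hasCompactSupport_partial h2 _),
    integral_smul_add _ _ h1.continuous h2, h φ h1 h2 h3, h' φ h1 h2 h3, neg_add]

lemma HasWeakPartial.smul {i : Fin n} {u v : L2 a m} (c : ℝ) (h : HasWeakPartial a i u v) :
    HasWeakPartial a i (c • u) (c • v) := by
  intro φ h1 h2 h3
  rw [integral_smul_smul, integral_smul_smul, h φ h1 h2 h3, smul_neg]

lemma HasWeakPartial.unique {i : Fin n} {u v v' : L2 a m} (h : HasWeakPartial a i u v)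
    (h' : HasWeakPartial a i u v') : v = v' := by
  have hQ : Convex ℝ (parallelepiped a) := by
    rw [parallelepiped_eq_convexHull]; exact convex_convexHull ℝ _
  have key : ∀ᵐ x ∂(cellMeasure a), x ∈ interior (parallelepiped a) →
      (v x - v' x : Vec m) = 0 := by
    refine isOpen_interior.ae_eq_zero_of_integral_contDiff_smul_eq_zero ?_ ?_
    · exact (((Lp.memLp v).integrable (by norm_num)).sub
        ((Lp.memLp v').integrable (by norm_num))).locallyIntegrable.locallyIntegrableOn _
    · intro φ h1 h2 h3
      simp only [smul_sub]
      rw [integral_sub (integrable_smul_L2 v h1.continuous h2)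
        (integrable_smul_L2 v' h1.continuous h2), sub_eq_zero]
      exact neg_injective ((h φ h1 h2 h3).symm.trans (h' φ h1 h2 h3))
  have hint : ∀ᵐ x ∂(cellMeasure a), x ∈ interior (parallelepiped a) := by
    have hfr : ∀ᵐ x : Space n, x ∉ frontier (parallelepiped a) :=
      measure_eq_zero_iff_ae_notMem.1 (hQ.addHaar_frontier volume)
    have hm : NullMeasurableSet (parallelepiped a) (volume : Measure (Space n)) :=
      hQ.nullMeasurableSet volume
    rw [cellMeasure]
    filter_upwards [ae_restrict_of_ae hfr, ae_restrict_mem₀ hm] with x hx hxQ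
    by_contra hxi
    exact hx ⟨subset_closure hxQ, hxi⟩
  refine Lp.ext ?_
  filter_upwards [key, hint] with x hx hxi
  exact sub_eq_zero.1 (hx hxi)

open Classical in
/-- The weak partial derivative `∂ᵢ u` in `L²(Q; ℝ²ᵐ)` (unique when it exists; zero by convention
when it does not, a case in which it is never used). -/
def weakPartial (i : Fin n) (u : L2 a m) : L2 a m :=
  if h : ∃ v, HasWeakPartial a i u v then h.choose else 0

lemma weakPartial_eq {i : Fin n} {u v : L2 a m} (h : HasWeakPartial a i u v) :
    weakPartial i u = v := by
  have h' : ∃ v, HasWeakPartial a i u v := ⟨v, h⟩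
  rw [weakPartial, dif_pos h']
  exact h'.choose_spec.unique h

/-- `u ∈ H¹(Q; ℝ²ᵐ)`. -/
def MemH1 (u : L2 a m) : Prop := ∀ i, HasWeakPartial a i u (weakPartial i u)

/-- `u ∈ H²(Q; ℝ²ᵐ)`. -/
def MemH2 (u : L2 a m) : Prop := MemH1 u ∧ ∀ i, MemH1 (weakPartial i u)

/-- The distributional Laplacian `Δ u = ∑ᵢ ∂ᵢ ∂ᵢ u` of `u ∈ H²`. -/
def weakLaplacian (u : L2 a m) : L2 a m := ∑ i, weakPartial i (weakPartial i u)

lemma memH1_zero : MemH1 (0 : L2 a m) := by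
  intro i
  have h : HasWeakPartial a i (0 : L2 a m) 0 := by
    have h0 : ∀ f : Space n → ℝ, ∫ x, f x • (0 : L2 a m) x ∂(cellMeasure a) = 0 := by
      intro f
      have := integral_smul_smul (a := a) (m := m) 0 0 f
      rwa [zero_smul, zero_smul] at this
    intro φ _ _ _
    rw [h0, h0, neg_zero]
  rw [weakPartial_eq h]; exact h

lemma weakPartial_zero (i : Fin n) : weakPartial i (0 : L2 a m) = 0 := by
  have h := (memH1_zero (a := a) (m := m) i).smul 0
  rw [zero_smul, zero_smul] at h
  exact weakPartial_eq h

lemma weakPartial_add {u v : L2 a m} (hu : MemH1 u) (hv : MemH1 v) (i : Fin n) :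
    weakPartial i (u + v) = weakPartial i u + weakPartial i v :=
  weakPartial_eq ((hu i).add (hv i))

lemma weakPartial_smul {u : L2 a m} (c : ℝ) (hu : MemH1 u) (i : Fin n) :
    weakPartial i (c • u) = c • weakPartial i u :=
  weakPartial_eq ((hu i).smul c)

lemma MemH1.add {u v : L2 a m} (hu : MemH1 u) (hv : MemH1 v) : MemH1 (u + v) := by
  intro i
  rw [weakPartial_add hu hv]
  exact (hu i).add (hv i)

lemma MemH1.smul {u : L2 a m} (c : ℝ) (hu : MemH1 u) : MemH1 (c • u) := by
  intro i
  rw [weakPartial_smul c hu]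
  exact (hu i).smul c

lemma memH2_zero : MemH2 (0 : L2 a m) :=
  ⟨memH1_zero, fun i => by rw [weakPartial_zero]; exact memH1_zero⟩

lemma MemH2.add {u v : L2 a m} (hu : MemH2 u) (hv : MemH2 v) : MemH2 (u + v) :=
  ⟨hu.1.add hv.1, fun i => by
    rw [weakPartial_add hu.1 hv.1]; exact (hu.2 i).add (hv.2 i)⟩

lemma MemH2.smul {u : L2 a m} (c : ℝ) (hu : MemH2 u) : MemH2 (c • u) :=
  ⟨hu.1.smul c, fun i => by rw [weakPartial_smul c hu.1]; exact (hu.2 i).smul c⟩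

/-! ### Faces and boundary traces -/

variable (a)

/-- The surface measure on the face `∂Qⱼˢ = {∑ tᵢ aᵢ ∈ Q | tⱼ = s}`, `s ∈ {0, 1}`, up to the
positive constant factor relating the coordinates `(tᵢ)`, `i ≠ j`, to `(n-1)`-dimensional area; null
sets, square integrability and `L²` convergence on the face do not depend on that factor. -/
def faceMeasure (j : Fin n) (s : Fin 2) : Measure (Space n) :=
  (volume.restrict (Set.Icc (0 : {i : Fin n // i ≠ j} → ℝ) 1)).map
    (fun t => ((s : ℕ) : ℝ) • a j + ∑ i : {i : Fin n // i ≠ j}, t i • a i)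

/-- The component of `aⱼ` orthogonal to the hyperplane spanned by the `aᵢ`, `i ≠ j`. -/
def faceHeight (j : Fin n) : Space n :=
  (Submodule.span ℝ (a '' {i | i ≠ j}))ᗮ.starProjection (a j)

/-- The outward unit normal vector on the face `∂Qⱼˢ`. -/
def outwardNormal (j : Fin n) (s : Fin 2) : Space n :=
  (if s = 1 then (1 : ℝ) else -1) • (‖faceHeight a j‖⁻¹ • faceHeight a j)

variable {a}

/-- `g` is the trace on the face `∂Qⱼˢ` of `v ∈ H¹(Q; ℝ²ᵐ)`: the restriction map
`φ ↦ φ|_{∂Qⱼˢ}` on functions smooth up to the boundary, extended by continuity to a map into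
`L²(∂Qⱼˢ; ℝ²ᵐ)`. -/
def IsTrace (j : Fin n) (s : Fin 2) (v : L2 a m) (g : Space n → Vec m) : Prop :=
  MemLp g 2 (faceMeasure a j s) ∧
  ∃ φ : ℕ → Space n → Vec m, (∀ k, ContDiff ℝ ∞ (φ k)) ∧
    Tendsto (fun k => eLpNorm (fun x => φ k x - v x) 2 (cellMeasure a)) atTop (𝓝 0) ∧
    (∀ i, Tendsto (fun k => eLpNorm
      (fun x => fderiv ℝ (φ k) x (EuclideanSpace.single i 1) - weakPartial i v x) 2
        (cellMeasure a)) atTop (𝓝 0)) ∧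
    Tendsto (fun k => eLpNorm (fun x => φ k x - g x) 2 (faceMeasure a j s)) atTop (𝓝 0)

/-- `g` is the Dirichlet trace `uⱼˢ` of `u ∈ H²(Q; ℝ²ᵐ)` on the face `∂Qⱼˢ`. -/
def IsDirichletTrace (j : Fin n) (s : Fin 2) (u : L2 a m) (g : Space n → Vec m) : Prop :=
  IsTrace j s u g

/-- `g` is the Neumann trace `∂ⱼuˢ` of `u ∈ H²(Q; ℝ²ᵐ)` on the face `∂Qⱼˢ`: the trace of the
gradient of `u` applied to the outward unit normal. -/
def IsNeumannTrace (j : Fin n) (s : Fin 2) (u : L2 a m) (g : Space n → Vec m) : Prop :=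
  ∃ h : Fin n → Space n → Vec m, (∀ i, IsTrace j s (weakPartial i u) (h i)) ∧
    g =ᵐ[faceMeasure a j s] fun x => ∑ i, outwardNormal a j s i • h i x

lemma tendsto_eLpNorm_add {μ : Measure (Space n)} {f g : ℕ → Space n → Vec m}
    {h : ℕ → Space n → Vec m}
    (hf : Tendsto (fun k => eLpNorm (f k) 2 μ) atTop (𝓝 0))
    (hg : Tendsto (fun k => eLpNorm (g k) 2 μ) atTop (𝓝 0))
    (hfm : ∀ k, AEStronglyMeasurable (f k) μ) (hgm : ∀ k, AEStronglyMeasurable (g k) μ)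
    (hh : ∀ k, h k =ᵐ[μ] f k + g k) :
    Tendsto (fun k => eLpNorm (h k) 2 μ) atTop (𝓝 0) := by
  refine tendsto_of_tendsto_of_tendsto_of_le_of_le tendsto_const_nhds
    (by simpa using hf.add hg) (fun _ => zero_le) (fun k => ?_)
  simp only
  rw [eLpNorm_congr_ae (hh k)]
  exact eLpNorm_add_le (hfm k) (hgm k) (by norm_num)

lemma tendsto_eLpNorm_smul {μ : Measure (Space n)} {f h : ℕ → Space n → Vec m} (c : ℝ)
    (hf : Tendsto (fun k => eLpNorm (f k) 2 μ) atTop (𝓝 0))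
    (hh : ∀ k, h k =ᵐ[μ] c • f k) :
    Tendsto (fun k => eLpNorm (h k) 2 μ) atTop (𝓝 0) := by
  have : (fun k => eLpNorm (h k) 2 μ) = fun k => ‖c‖ₑ * eLpNorm (f k) 2 μ := by
    funext k
    rw [eLpNorm_congr_ae (hh k), eLpNorm_const_smul]
  rw [this]
  simpa using ENNReal.Tendsto.const_mul hf (Or.inr (by simp))

lemma IsTrace.add {j : Fin n} {s : Fin 2} {u v : L2 a m} {g h : Space n → Vec m}
    (hu : MemH1 u) (hv : MemH1 v) (hg : IsTrace j s u g) (hh : IsTrace j s v h) :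
    IsTrace j s (u + v) (g + h) := by
  obtain ⟨g0, φ, φ1, φ2, φ3, φ4⟩ := hg
  obtain ⟨h0, ψ, ψ1, ψ2, ψ3, ψ4⟩ := hh
  refine ⟨g0.add h0, fun k => φ k + ψ k, fun k => (φ1 k).add (ψ1 k), ?_, fun i => ?_, ?_⟩
  · refine tendsto_eLpNorm_add φ2 ψ2
      (fun k => (φ1 k).continuous.aestronglyMeasurable.sub (Lp.aestronglyMeasurable _))
      (fun k => (ψ1 k).continuous.aestronglyMeasurable.sub (Lp.aestronglyMeasurable _))
      (fun k => ?_)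
    filter_upwards [Lp.coeFn_add u v] with x hx
    simp only [hx, Pi.add_apply]
    abel
  · have hm : ∀ {f : Space n → Vec m}, ContDiff ℝ ∞ f → Continuous
        fun x => fderiv ℝ f x (EuclideanSpace.single i 1) := fun hf =>
      (hf.continuous_fderiv (by simp)).clm_apply continuous_const
    refine tendsto_eLpNorm_add (φ3 i) (ψ3 i)
      (fun k => (hm (φ1 k)).aestronglyMeasurable.sub (Lp.aestronglyMeasurable _))
      (fun k => (hm (ψ1 k)).aestronglyMeasurable.sub (Lp.aestronglyMeasurable _))
      (fun k => ?_)
    rw [weakPartial_add hu hv]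
    filter_upwards [Lp.coeFn_add (weakPartial i u) (weakPartial i v)] with x hx
    rw [fderiv_add ((φ1 k).differentiable (by simp) x) ((ψ1 k).differentiable (by simp) x)]
    simp only [hx, Pi.add_apply, _root_.add_apply]
    abel
  · refine tendsto_eLpNorm_add φ4 ψ4
      (fun k => (φ1 k).continuous.aestronglyMeasurable.sub g0.1)
      (fun k => (ψ1 k).continuous.aestronglyMeasurable.sub h0.1)
      (fun k => ae_of_all _ fun x => ?_)
    simp only [Pi.add_apply]
    abel

lemma IsTrace.smul {j : Fin n} {s : Fin 2} {u : L2 a m} {g : Space n → Vec m} (c : ℝ)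
    (hu : MemH1 u) (hg : IsTrace j s u g) : IsTrace j s (c • u) (c • g) := by
  obtain ⟨g0, φ, φ1, φ2, φ3, φ4⟩ := hg
  refine ⟨g0.const_smul c, fun k => c • φ k, fun k => (φ1 k).const_smul c, ?_, fun i => ?_, ?_⟩
  · refine tendsto_eLpNorm_smul c φ2 (fun k => ?_)
    filter_upwards [Lp.coeFn_smul c u] with x hx
    simp only [hx, Pi.smul_apply, smul_sub]
  · refine tendsto_eLpNorm_smul c (φ3 i) (fun k => ?_)
    rw [weakPartial_smul c hu]
    filter_upwards [Lp.coeFn_smul c (weakPartial i u)] with x hx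
    rw [fderiv_const_smul ((φ1 k).differentiable (by simp) x)]
    simp only [hx, Pi.smul_apply, _root_.smul_apply, smul_sub]
  · refine tendsto_eLpNorm_smul c φ4 (fun k => ae_of_all _ fun x => ?_)
    simp only [Pi.smul_apply, smul_sub]

lemma IsTrace.zero (j : Fin n) (s : Fin 2) : IsTrace j s (0 : L2 a m) 0 := by
  refine ⟨MemLp.zero, fun _ => 0, fun _ => contDiff_const, ?_, fun i => ?_, ?_⟩
  · refine tendsto_const_nhds.congr fun k => ?_
    rw [eLpNorm_congr_ae (g := 0), eLpNorm_zero]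
    filter_upwards [Lp.coeFn_zero (Vec m) 2 (cellMeasure a)] with x hx
    rw [hx]; simp
  · refine tendsto_const_nhds.congr fun k => ?_
    rw [weakPartial_zero, eLpNorm_congr_ae (g := 0), eLpNorm_zero]
    filter_upwards [Lp.coeFn_zero (Vec m) 2 (cellMeasure a)] with x hx
    rw [hx]; simp
  · simp

lemma IsNeumannTrace.add {j : Fin n} {s : Fin 2} {u v : L2 a m} {g g' : Space n → Vec m}
    (hu : MemH2 u) (hv : MemH2 v) (hg : IsNeumannTrace j s u g) (hg' : IsNeumannTrace j s v g') :
    IsNeumannTrace j s (u + v) (g + g') := by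
  obtain ⟨h, h1, h2⟩ := hg
  obtain ⟨h', h1', h2'⟩ := hg'
  refine ⟨fun i => h i + h' i, fun i => ?_, ?_⟩
  · rw [weakPartial_add hu.1 hv.1]
    exact (h1 i).add (hu.2 i) (hv.2 i) (h1' i)
  · filter_upwards [h2, h2'] with x hx hx'
    simp only [Pi.add_apply, hx, hx', smul_add, Finset.sum_add_distrib]

lemma IsNeumannTrace.smul {j : Fin n} {s : Fin 2} {u : L2 a m} {g : Space n → Vec m} (c : ℝ)
    (hu : MemH2 u) (hg : IsNeumannTrace j s u g) : IsNeumannTrace j s (c • u) (c • g) := by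
  obtain ⟨h, h1, h2⟩ := hg
  refine ⟨fun i => c • h i, fun i => ?_, ?_⟩
  · rw [weakPartial_smul c hu.1]
    exact (h1 i).smul c (hu.2 i)
  · filter_upwards [h2] with x hx
    simp only [Pi.smul_apply, hx, Finset.smul_sum]
    exact Finset.sum_congr rfl fun i _ => smul_comm _ _ _

lemma IsNeumannTrace.zero (j : Fin n) (s : Fin 2) : IsNeumannTrace j s (0 : L2 a m) 0 :=
  ⟨fun _ => 0, fun i => by rw [weakPartial_zero]; exact IsTrace.zero j s, by
    filter_upwards with x; simp⟩

/-! ### The real Laplacian with `θ`-periodic boundary conditions -/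

/-- `M = I_m ⊗ (rotation by the angle 2πt)`. -/
def rotationMatrix (m : ℕ) (t : ℝ) : Matrix (Fin m × Fin 2) (Fin m × Fin 2) ℝ :=
  (1 : Matrix (Fin m) (Fin m) ℝ) ⊗ₖ
    !![Real.cos (2 * Real.pi * t), -Real.sin (2 * Real.pi * t);
       Real.sin (2 * Real.pi * t), Real.cos (2 * Real.pi * t)]

/-- The `θ`-periodic boundary conditions: for each `j`, on the face `∂Qⱼ¹`,
`u¹ⱼ(x) = Mⱼ u⁰ⱼ(x - aⱼ)` and `∂ⱼu¹(x) = -Mⱼ ∂ⱼu⁰(x - aⱼ)` a.e.; the minus sign is due to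
`∂ⱼuˢ` being the derivative in the direction of the outward normal of `∂Qⱼˢ`. -/
def PeriodicBC (θ : Fin n → ℝ) (u : L2 a m) : Prop :=
  ∀ j,
    (∃ g₀ g₁, IsDirichletTrace j 0 u g₀ ∧ IsDirichletTrace j 1 u g₁ ∧
      ∀ᵐ x ∂(faceMeasure a j 1),
        g₁ x = Matrix.toEuclideanLin (rotationMatrix m (θ j)) (g₀ (x - a j))) ∧
    (∃ h₀ h₁, IsNeumannTrace j 0 u h₀ ∧ IsNeumannTrace j 1 u h₁ ∧
      ∀ᵐ x ∂(faceMeasure a j 1),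
        h₁ x = -Matrix.toEuclideanLin (rotationMatrix m (θ j)) (h₀ (x - a j)))

variable (a m)

/-- The domain of `-Δ_{θ,ℝ}`: the functions in `H²(Q; ℝ²ᵐ)` that satisfy the `θ`-periodic boundary
conditions. -/
def laplacianDomain (θ : Fin n → ℝ) : Submodule ℝ (L2 a m) where
  carrier := {u | MemH2 u ∧ PeriodicBC θ u}
  zero_mem' := ⟨memH2_zero, fun j =>
    ⟨⟨0, 0, IsTrace.zero j 0, IsTrace.zero j 1, by filter_upwards with x; simp⟩,
      ⟨0, 0, IsNeumannTrace.zero j 0, IsNeumannTrace.zero j 1, by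
        filter_upwards with x; simp⟩⟩⟩
  add_mem' := by
    rintro u v ⟨hu, bu⟩ ⟨hv, bv⟩
    refine ⟨hu.add hv, fun j => ?_⟩
    obtain ⟨⟨g₀, g₁, t₀, t₁, e⟩, ⟨h₀, h₁, k₀, k₁, f⟩⟩ := bu j
    obtain ⟨⟨g₀', g₁', t₀', t₁', e'⟩, ⟨h₀', h₁', k₀', k₁', f'⟩⟩ := bv j
    refine ⟨⟨g₀ + g₀', g₁ + g₁', IsTrace.add hu.1 hv.1 t₀ t₀', IsTrace.add hu.1 hv.1 t₁ t₁', ?_⟩,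
      ⟨h₀ + h₀', h₁ + h₁', k₀.add hu hv k₀', k₁.add hu hv k₁', ?_⟩⟩
    · filter_upwards [e, e'] with x hx hx'
      simp only [Pi.add_apply, hx, hx', map_add]
    · filter_upwards [f, f'] with x hx hx'
      simp only [Pi.add_apply, hx, hx', map_add, neg_add]
  smul_mem' := by
    rintro c u ⟨hu, bu⟩
    refine ⟨hu.smul c, fun j => ?_⟩
    obtain ⟨⟨g₀, g₁, t₀, t₁, e⟩, ⟨h₀, h₁, k₀, k₁, f⟩⟩ := bu j
    refine ⟨⟨c • g₀, c • g₁, IsTrace.smul c hu.1 t₀, IsTrace.smul c hu.1 t₁, ?_⟩,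
      ⟨c • h₀, c • h₁, k₀.smul c hu, k₁.smul c hu, ?_⟩⟩
    · filter_upwards [e] with x hx
      simp only [Pi.smul_apply, hx, map_smul]
    · filter_upwards [f] with x hx
      simp only [Pi.smul_apply, hx, map_smul, smul_neg]

variable {a m} in
lemma weakLaplacian_add {u v : L2 a m} (hu : MemH2 u) (hv : MemH2 v) :
    weakLaplacian (u + v) = weakLaplacian u + weakLaplacian v := by
  simp only [weakLaplacian]
  rw [← Finset.sum_add_distrib]
  refine Finset.sum_congr rfl fun i _ => ?_
  rw [weakPartial_add hu.1 hv.1, weakPartial_add (hu.2 i) (hv.2 i)]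

variable {a m} in
lemma weakLaplacian_smul {u : L2 a m} (c : ℝ) (hu : MemH2 u) :
    weakLaplacian (c • u) = c • weakLaplacian u := by
  simp only [weakLaplacian]
  rw [Finset.smul_sum]
  refine Finset.sum_congr rfl fun i _ => ?_
  rw [weakPartial_smul c hu.1, weakPartial_smul c (hu.2 i)]

/-- The operator `-Δ_{θ,ℝ}` in `L²(Q; ℝ²ᵐ)`. -/
def negLaplacian (θ : Fin n → ℝ) : L2 a m →ₗ.[ℝ] L2 a m where
  domain := laplacianDomain a m θ
  toFun :=
    { toFun := fun u => -weakLaplacian (u : L2 a m)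
      map_add' := fun u v => by
        rw [Submodule.coe_add, weakLaplacian_add u.2.1 v.2.1, neg_add]
      map_smul' := fun c u => by
        rw [Submodule.coe_smul, weakLaplacian_smul c u.2.1, smul_neg, RingHom.id_apply] }

/-! ### Multiplication by a matrix-valued potential -/

/-- The functions `u ∈ L²(Q; ℝ²ᵐ)` with `W u ∈ L²(Q; ℝ²ᵐ)`. -/
def multiplicationDomain (W : Space n → Matrix (Fin m × Fin 2) (Fin m × Fin 2) ℝ) :
    Submodule ℝ (L2 a m) where
  carrier := {u | MemLp (fun x => Matrix.toEuclideanLin (W x) (u x)) 2 (cellMeasure a)}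
  zero_mem' := by
    refine MemLp.ae_eq ?_ (MemLp.zero (ε := Vec m))
    filter_upwards [Lp.coeFn_zero (Vec m) 2 (cellMeasure a)] with x hx
    rw [hx]; simp
  add_mem' := by
    intro u v hu hv
    refine MemLp.ae_eq ?_ (MemLp.add hu hv)
    filter_upwards [Lp.coeFn_add u v] with x hx
    rw [hx, Pi.add_apply, Pi.add_apply, map_add]
  smul_mem' := by
    intro c u hu
    refine MemLp.ae_eq ?_ (MemLp.const_smul hu c)
    filter_upwards [Lp.coeFn_smul c u] with x hx
    rw [hx, Pi.smul_apply, Pi.smul_apply, map_smul]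

lemma memLp_of_mem_multiplicationDomain
    {W : Space n → Matrix (Fin m × Fin 2) (Fin m × Fin 2) ℝ} {u : L2 a m}
    (hu : u ∈ multiplicationDomain a m W) :
    MemLp (fun x => Matrix.toEuclideanLin (W x) (u x)) 2 (cellMeasure a) := hu

/-- The operator of multiplication by a matrix-valued function `W` in `L²(Q; ℝ²ᵐ)`, with its natural
domain `{u | W u ∈ L²}` (all of `L²` if `W ∈ L^∞`). -/
def multiplication (W : Space n → Matrix (Fin m × Fin 2) (Fin m × Fin 2) ℝ) :
    L2 a m →ₗ.[ℝ] L2 a m where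
  domain := multiplicationDomain a m W
  toFun :=
    { toFun := fun u => MemLp.toLp (fun x => Matrix.toEuclideanLin (W x) ((u : L2 a m) x))
        (memLp_of_mem_multiplicationDomain a m u.2)
      map_add' := fun u v => by
        refine Lp.ext ?_
        filter_upwards [Lp.coeFn_add (u : L2 a m) v,
          MemLp.coeFn_toLp (memLp_of_mem_multiplicationDomain a m (u + v).2),
          MemLp.coeFn_toLp (memLp_of_mem_multiplicationDomain a m u.2),
          MemLp.coeFn_toLp (memLp_of_mem_multiplicationDomain a m v.2),
          Lp.coeFn_add (MemLp.toLp _ (memLp_of_mem_multiplicationDomain a m u.2))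
            (MemLp.toLp _ (memLp_of_mem_multiplicationDomain a m v.2))] with x h h1 h2 h3 h4
        rw [h1, h4, Pi.add_apply, h2, h3, Submodule.coe_add, h, Pi.add_apply, map_add]
      map_smul' := fun c u => by
        refine Lp.ext ?_
        filter_upwards [Lp.coeFn_smul c (u : L2 a m),
          MemLp.coeFn_toLp (memLp_of_mem_multiplicationDomain a m (c • u).2),
          MemLp.coeFn_toLp (memLp_of_mem_multiplicationDomain a m u.2),
          Lp.coeFn_smul c (MemLp.toLp _ (memLp_of_mem_multiplicationDomain a m u.2))]
          with x h h1 h2 h3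
        rw [h1, RingHom.id_apply, h3, Pi.smul_apply, h2, Submodule.coe_smul, h, Pi.smul_apply,
          map_smul] }

variable {m}

/-- `V_{t,ℝ}(x) = t² V(t x) ⊗ I₂`. -/
def rescaledPotential (V : Space n → Matrix (Fin m) (Fin m) ℝ) (t : ℝ) (x : Space n) :
    Matrix (Fin m × Fin 2) (Fin m × Fin 2) ℝ :=
  (t ^ 2 • V (t • x)) ⊗ₖ (1 : Matrix (Fin 2) (Fin 2) ℝ)

/-- The Schrödinger operator `-Δ_{θ,ℝ} + V_{t,ℝ}` in `L²(Q; ℝ²ᵐ)`. -/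
def schrodinger (θ : Fin n → ℝ) (V : Space n → Matrix (Fin m) (Fin m) ℝ) (t : ℝ) :
    L2 a m →ₗ.[ℝ] L2 a m :=
  negLaplacian a m θ + multiplication a m (rescaledPotential V t)

end PeriodicSchrodinger

end

/-!
Multiplication by `V(τ x)` on the cell `Q` involves only the values of `V` on `τ Q`, a small
neighbourhood of the vertex `0` in `Q`. By continuity at `0` the operator `W` of multiplication by
`V(τ x) ⊗ I₂` is therefore close in operator norm to the operator `W₀` of multiplication by the
constant matrix `V(0) ⊗ I₂`, and `-Δ + τ² W` is a small bounded perturbation of the periodic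
Laplacian `A = -Δ`.

The kernel of `A` consists of the constants, and the rest of its spectrum lies above a positive gap.
With `P` the projection onto the constants and `G` the inverse of `A` on their orthogonal
complement, the equation `(A + t W) z = y` is equivalent to
`((1 - P) + P W + t G W) z = t⁻¹ P y + G y`; for `W = W₀` and `t = 0` the operator on the left is
invertible because `V(0)` is, hence it is invertible for small `t` and `W` near `W₀`
(`HasReducedResolvent.exists_isInverse`). The quadratic form of `A + t W` is negative on the
constants with values in the negative spectral subspace of `V(0) ⊗ I₂`, and nonnegative on the
orthogonal complement of these constants, since the gap dominates `t W` there. This determines the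
Morse index (`HasReducedResolvent.morseIndex_addBounded`), through a variational characterization
in both directions (`IsSymm.morseIndex_le`, `IsSymm.le_morseIndex`); the lower bound uses that the
inverse is compact.

The facts about `A` come from its diagonalization in a real Fourier basis. The Hartley waves
`cos⟨ξ, x⟩ + sin⟨ξ, x⟩`, with `ξ` in the dual lattice, times the vectors of an orthonormal basis of
`ℝ²ᵐ` form a Hilbert basis of `L²(Q; ℝ²ᵐ)` (`waveBasis`). A function in the domain of `A` can be
integrated by parts against these waves without boundary terms, so `A` multiplies its coefficients
by `|ξ|²` (`inner_waveLp_neg_weakLaplacian`). Conversely, if the coefficients multiplied by `|ξ|²`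
are square summable, then the Fourier series converges in `H²(Q)`, and by the trace inequality the
boundary conditions pass from its partial sums to the limit (`mem_laplacianDomain_of_coeff`).
-/

noncomputable section

namespace PeriodicSchrodinger

/-! ### The Morse index of symmetric operators -/

section MorseIndex

variable {H : Type*} [NormedAddCommGroup H] [InnerProductSpace ℝ H] {T : H →ₗ.[ℝ] H}

/-- Symmetry of an operator with domain. -/
def IsSymm (T : H →ₗ.[ℝ] H) : Prop :=
  ∀ x y : T.domain, inner ℝ (T x) (y : H) = inner ℝ (x : H) (T y)

/-- Eigenvectors with different eigenvalues are orthogonal. -/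
lemma IsSymm.inner_eq_zero (hT : IsSymm T) {lam mu : ℝ} (hne : lam ≠ mu) {x y : H}
    (hx : x ∈ eigenspace T lam) (hy : y ∈ eigenspace T mu) : inner ℝ x y = 0 := by
  obtain ⟨hx, ex⟩ := hx
  obtain ⟨hy, ey⟩ := hy
  have h := hT ⟨x, hx⟩ ⟨y, hy⟩
  rw [ex, ey, real_inner_smul_left, real_inner_smul_right] at h
  have h' : (lam - mu) * inner ℝ x y = 0 := by rw [sub_mul]; exact sub_eq_zero.2 h
  exact (mul_eq_zero.1 h').resolve_left (sub_ne_zero.2 hne)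

lemma exists_apply_sum_eigenspace {ι : Type*} (s : Finset ι) (lam : ι → ℝ) (x : ι → H)
    (hx : ∀ i ∈ s, x i ∈ eigenspace T (lam i)) :
    ∃ h : ∑ i ∈ s, x i ∈ T.domain, T ⟨∑ i ∈ s, x i, h⟩ = ∑ i ∈ s, lam i • x i := by
  classical
  induction s using Finset.induction_on with
  | empty => exact ⟨by rw [Finset.sum_empty]; exact T.domain.zero_mem, T.map_zero⟩
  | insert i s hi ih =>
    obtain ⟨h, e⟩ := ih fun j hj => hx j (Finset.mem_insert_of_mem hj)
    obtain ⟨h', e'⟩ := hx i (Finset.mem_insert_self i s)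
    simp only [Finset.sum_insert hi]
    refine ⟨T.domain.add_mem h' h, ?_⟩
    rw [← e, ← e', ← T.map_add]
    rfl

lemma IsSymm.inner_sum_eigenspace (hT : IsSymm T) {ι : Type*} (s : Finset ι) {lam : ι → ℝ}
    (hlam : Function.Injective lam) {x : ι → H} (hx : ∀ i ∈ s, x i ∈ eigenspace T (lam i)) :
    inner ℝ (∑ i ∈ s, lam i • x i) (∑ i ∈ s, x i) = ∑ i ∈ s, lam i * ‖x i‖ ^ 2 := by
  rw [sum_inner]
  refine Finset.sum_congr rfl fun i hi => ?_
  rw [real_inner_smul_left, inner_sum, Finset.sum_eq_single_of_mem i hi,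
    real_inner_self_eq_norm_sq]
  exact fun j hj hji => hT.inner_eq_zero (hlam.ne hji.symm) (hx i hi) (hx j hj)

/-- A symmetric operator that is nonnegative on the kernel of a linear map into a space of
dimension `N` has Morse index at most `N`: that map is injective on sums of eigenvectors with
negative eigenvalues. -/
theorem IsSymm.morseIndex_le (hT : IsSymm T) {F : Type*} [AddCommGroup F] [Module ℝ F]
    [FiniteDimensional ℝ F] (p : H →ₗ[ℝ] F)
    (hp : ∀ x : T.domain, p x = 0 → 0 ≤ inner ℝ (T x) (x : H)) :
    morseIndex T ≤ Module.finrank ℝ F := by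
  refine iSup_le fun s => ?_
  let S : (∀ l : s, eigenspace T l.1.1) →ₗ[ℝ] H :=
    ∑ l : s, (eigenspace T l.1.1).subtype ∘ₗ LinearMap.proj l
  have hS : ∀ x, S x = ∑ l : s, (x l : H) := fun x => by simp [S]
  have hinj : Function.Injective (p ∘ₗ S) := by
    refine (injective_iff_map_eq_zero _).2 fun x hx => ?_
    obtain ⟨h, e⟩ := exists_apply_sum_eigenspace Finset.univ (fun l : s => l.1.1)
      (fun l => (x l : H)) fun l _ => (x l).2
    have h0 := hp ⟨_, h⟩ ((congrArg p (hS x)).symm.trans hx)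
    rw [e, hT.inner_sum_eigenspace Finset.univ
      (fun l l' hl => Subtype.ext (Subtype.ext hl)) fun l _ => (x l).2] at h0
    have hle : ∀ l ∈ Finset.univ, l.1.1 * ‖(x l : H)‖ ^ 2 ≤ 0 := fun l _ =>
      mul_nonpos_of_nonpos_of_nonneg l.1.2.le (sq_nonneg _)
    have h1 := (Finset.sum_eq_zero_iff_of_nonpos hle).1 (le_antisymm (Finset.sum_nonpos hle) h0)
    ext l
    have := (mul_eq_zero.1 (h1 l (Finset.mem_univ l))).resolve_left l.1.2.ne
    simpa using this
  have hfin : ∀ l : s, FiniteDimensional ℝ (eigenspace T l.1.1) := fun l => by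
    classical
    exact Module.Finite.of_injective
      ((p ∘ₗ S) ∘ₗ LinearMap.single ℝ (fun l : s => eigenspace T l.1.1) l)
      (fun x y h => Pi.single_injective l (hinj h))
  have h := LinearMap.finrank_le_finrank_of_injective hinj
  rw [Module.finrank_pi_fintype] at h
  calc ∑ l ∈ s, Cardinal.toENat (Module.rank ℝ (eigenspace T l.1))
      = ∑ l : s, Cardinal.toENat (Module.rank ℝ (eigenspace T l.1.1)) :=
        (Finset.sum_coe_sort s _).symm
    _ = ((∑ l : s, Module.finrank ℝ (eigenspace T l.1.1) : ℕ) : ℕ∞) := by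
        rw [Nat.cast_sum]
        refine Finset.sum_congr rfl fun l _ => ?_
        rw [← Module.finrank_eq_rank, Cardinal.toENat_nat]
    _ ≤ _ := by exact_mod_cast h

/-- A compact symmetric operator without negative eigenvalues is nonnegative, because its
eigenvectors span a dense subspace. -/
lemma inner_nonneg_of_eigenvalues_nonneg [CompleteSpace H] {S : H →L[ℝ] H}
    (hc : IsCompactOperator S) (hs : S.IsSymmetric)
    (h0 : ∀ (mu : ℝ) (x : H), mu < 0 → S x = mu • x → x = 0) (y : H) :
    0 ≤ inner ℝ (S y) y := by
  let E : ℝ → Submodule ℝ H := fun mu => Module.End.eigenspace (S : Module.End ℝ H) mu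
  have hd : Dense ((⨆ mu, E mu : Submodule ℝ H) : Set H) := by
    rw [Submodule.dense_iff_topologicalClosure_eq_top, Submodule.topologicalClosure_eq_top_iff]
    exact ContinuousLinearMap.orthogonalComplement_iSup_eigenspaces_eq_bot hc hs
  refine hd.induction (P := fun y => 0 ≤ inner ℝ (S y) y) (fun y hy => ?_)
    (isClosed_le continuous_const (by fun_prop)) y
  obtain ⟨f, hf, rfl⟩ := (Submodule.mem_iSup_iff_exists_finsupp E y).1 hy
  have hSf : ∀ mu, S (f mu) = mu • f mu := fun mu =>
    Module.End.mem_eigenspace_iff.1 (hf mu)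
  have hort : ∀ mu nu, mu ≠ nu → inner ℝ (f mu) (f nu) = 0 := fun mu nu hne => by
    have h := hs (f mu) (f nu)
    simp only [ContinuousLinearMap.coe_coe] at h
    rw [hSf, hSf, real_inner_smul_left, real_inner_smul_right] at h
    have h' : (mu - nu) * inner ℝ (f mu) (f nu) = 0 := by rw [sub_mul]; exact sub_eq_zero.2 h
    exact (mul_eq_zero.1 h').resolve_left (sub_ne_zero.2 hne)
  simp only [Finsupp.sum, map_sum, sum_inner]
  refine Finset.sum_nonneg fun mu hmu => ?_
  rw [hSf, real_inner_smul_left, inner_sum, Finset.sum_eq_single_of_mem mu hmu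
    fun nu _ h => hort _ _ h.symm]
  rcases lt_or_ge mu 0 with h | h
  · rw [h0 mu _ h (hSf mu)]; simp
  · exact mul_nonneg h real_inner_self_nonneg

/-- `R` is a bounded, everywhere defined, two-sided inverse of the operator with domain `T`. -/
structure IsInverse (R : H →L[ℝ] H) (T : H →ₗ.[ℝ] H) : Prop where
  right : ∀ y : H, ∃ h : R y ∈ T.domain, T ⟨R y, h⟩ = y
  left : ∀ x : T.domain, R (T x) = x

lemma IsInverse.isSymmetric {R : H →L[ℝ] H} (hR : IsInverse R T) (hT : IsSymm T) :
    R.IsSymmetric := by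
  intro x y
  obtain ⟨hx, ex⟩ := hR.right x
  obtain ⟨hy, ey⟩ := hR.right y
  have h := hT ⟨R x, hx⟩ ⟨R y, hy⟩
  rw [ex, ey] at h
  exact h.symm

/-- A symmetric operator with compact inverse that is negative definite on an `N`-dimensional
subspace has Morse index at least `N`. -/
theorem IsSymm.le_morseIndex [CompleteSpace H] (hT : IsSymm T) {R : H →L[ℝ] H}
    (hR : IsInverse R T) (hc : IsCompactOperator R) {F : Type*} [AddCommGroup F] [Module ℝ F]
    [FiniteDimensional ℝ F] (j : F →ₗ[ℝ] T.domain)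
    (hj : ∀ c, c ≠ 0 → inner ℝ (T (j c)) (j c : H) < 0) :
    (Module.finrank ℝ F : ℕ∞) ≤ morseIndex T := by
  -- If the Morse index is smaller, the sum `E` of the negative eigenspaces has dimension less than
  -- `N`, so `T (j c)` is orthogonal to `E` for some `c ≠ 0`. The inverse is nonnegative on `Eᗮ`,
  -- which contradicts `⟨R (T (j c)), T (j c)⟩ = ⟨j c, T (j c)⟩ < 0`.
  by_contra! hlt
  obtain ⟨s, hs⟩ := ENat.exists_eq_iSup_of_lt_top (lt_top_of_lt hlt)
  have hs' : ∑ lam ∈ s, Cardinal.toENat (Module.rank ℝ (eigenspace T lam)) = morseIndex T := hs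
  have hsfin : ∑ lam ∈ s, Cardinal.toENat (Module.rank ℝ (eigenspace T lam)) ≠ ⊤ := by
    rw [hs']; exact (lt_top_of_lt hlt).ne
  -- The supremum is attained on `s`, hence there are no eigenvalues outside `s`.
  have hout : ∀ lam : {lam : ℝ // lam < 0}, lam ∉ s → eigenspace T lam = ⊥ := by
    classical
    intro lam hlam
    have h1 : ∑ l ∈ insert lam s, Cardinal.toENat (Module.rank ℝ (eigenspace T l)) ≤
        morseIndex T :=
      le_iSup (fun s : Finset {lam : ℝ // lam < 0} =>
        ∑ l ∈ s, Cardinal.toENat (Module.rank ℝ (eigenspace T l))) _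
    rw [Finset.sum_insert hlam, ← hs'] at h1
    have h2 : Cardinal.toENat (Module.rank ℝ (eigenspace T lam)) ≤ 0 := by
      refine (ENat.add_le_add_iff_right hsfin).1 (by simpa using h1)
    rw [nonpos_iff_eq_zero, Cardinal.toENat_eq_zero, rank_eq_zero_iff] at h2
    refine (Submodule.eq_bot_iff _).2 fun x hx => ?_
    obtain ⟨c, hc0, hcx⟩ := h2 ⟨x, hx⟩
    have := congrArg Subtype.val hcx
    exact (smul_eq_zero.1 this).resolve_left hc0
  have hfin : ∀ l : s, FiniteDimensional ℝ (eigenspace T l.1.1) := fun l => by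
    refine Module.rank_lt_aleph0_iff.1 (Cardinal.toENat_lt_top.1 (lt_of_le_of_lt
      (Finset.single_le_sum (f := fun l : {lam : ℝ // lam < 0} =>
        Cardinal.toENat (Module.rank ℝ (eigenspace T l))) (fun _ _ => zero_le) l.2) ?_))
    exact lt_top_iff_ne_top.2 hsfin
  let E : Submodule ℝ H := ⨆ l : s, eigenspace T l.1.1
  have hEfin : FiniteDimensional ℝ E := Submodule.finiteDimensional_iSup _
  have hErank : Module.finrank ℝ E < Module.finrank ℝ F := by
    let S : (∀ l : s, eigenspace T l.1.1) →ₗ[ℝ] H :=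
      ∑ l : s, (eigenspace T l.1.1).subtype ∘ₗ LinearMap.proj l
    have hES : E ≤ LinearMap.range S := by
      classical
      refine iSup_le fun l x hx => ⟨Pi.single l ⟨x, hx⟩, ?_⟩
      simp only [S, LinearMap.sum_apply, LinearMap.comp_apply, LinearMap.proj_apply,
        Submodule.subtype_apply]
      rw [Finset.sum_eq_single l (fun b _ hb => by simp [Pi.single_eq_of_ne hb])
        (fun h => absurd (Finset.mem_univ l) h)]
      simp
    have h1 : Module.finrank ℝ E ≤ ∑ l : s, Module.finrank ℝ (eigenspace T l.1.1) :=
      (Submodule.finrank_mono hES).trans ((LinearMap.finrank_range_le S).trans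
        (Module.finrank_pi_fintype ℝ).le)
    have h2 : ((∑ l : s, Module.finrank ℝ (eigenspace T l.1.1) : ℕ) : ℕ∞) = morseIndex T := by
      rw [← hs', ← Finset.sum_coe_sort s, Nat.cast_sum]
      refine Finset.sum_congr rfl fun l _ => ?_
      rw [← Module.finrank_eq_rank, Cardinal.toENat_nat]
    rw [← h2] at hlt
    exact h1.trans_lt (by exact_mod_cast hlt)
  have hRs := hR.isSymmetric hT
  have hRE : ∀ x ∈ E, R x ∈ E := by
    have : E ≤ E.comap (R : H →ₗ[ℝ] H) := by
      refine iSup_le fun l x hx => ?_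
      obtain ⟨hx', ex⟩ := id hx
      have h := hR.left ⟨x, hx'⟩
      rw [ex, map_smul] at h
      have h' : R x = (l.1.1)⁻¹ • x := by
        have h : l.1.1 • R x = x := h
        nth_rewrite 2 [← h]
        rw [smul_smul, inv_mul_cancel₀ l.1.2.ne, one_smul]
      change R x ∈ E
      rw [h']
      exact E.smul_mem _ (Submodule.mem_iSup_of_mem l hx)
    exact this
  have hRE' : ∀ x ∈ Eᗮ, R x ∈ Eᗮ := fun x hx => by
    rw [Submodule.mem_orthogonal]
    intro u hu
    rw [show inner ℝ u (R x) = inner ℝ (R u) x from (hRs u x).symm]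
    exact (Submodule.mem_orthogonal _ _).1 hx _ (hRE u hu)
  -- An eigenvector of `R` in `Eᗮ` with eigenvalue `mu < 0` is an eigenvector of `T` with eigenvalue
  -- `mu⁻¹ < 0`, hence lies in `E` and vanishes.
  have hpos : ∀ y ∈ Eᗮ, 0 ≤ inner ℝ (R y) y := by
    intro y hy
    have hSc : IsCompactOperator (R.restrict hRE') := hc.restrict' hRE'
    have hSs : (R.restrict hRE').IsSymmetric := hRs.restrict_invariant hRE'
    refine inner_nonneg_of_eigenvalues_nonneg hSc hSs (fun mu x hmu hx => ?_) ⟨y, hy⟩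
    have hx' : R x = mu • (x : H) := congrArg Subtype.val hx
    obtain ⟨hd, he⟩ := hR.right x
    have hmem : (x : H) ∈ eigenspace T mu⁻¹ := by
      have h1 : (x : H) = mu⁻¹ • R x := by rw [hx', smul_smul, inv_mul_cancel₀ hmu.ne, one_smul]
      have h2 := T.map_smul mu⁻¹ ⟨R x, hd⟩
      rw [he] at h2
      have h3 : (x : H) ∈ T.domain := by rw [h1]; exact T.domain.smul_mem _ hd
      refine ⟨h3, ?_⟩
      rw [← h2]
      congr 1
      exact Subtype.ext h1
    have hxE : (x : H) ∈ E := by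
      by_cases hm : (⟨mu⁻¹, inv_lt_zero.2 hmu⟩ : {lam : ℝ // lam < 0}) ∈ s
      · exact Submodule.mem_iSup_of_mem (⟨_, hm⟩ : s) hmem
      · have := hout _ hm
        simp only at this
        rw [this, Submodule.mem_bot] at hmem
        rw [hmem]; exact E.zero_mem
    have := (Submodule.mem_orthogonal _ _).1 x.2 _ hxE
    exact Subtype.ext (inner_self_eq_zero.1 this)
  let q : F →ₗ[ℝ] E := (E.orthogonalProjectionOnto : H →ₗ[ℝ] E) ∘ₗ T.toFun ∘ₗ j
  have hker : LinearMap.ker q ≠ ⊥ := fun h =>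
    (LinearMap.finrank_le_finrank_of_injective (LinearMap.ker_eq_bot.1 h)).not_gt hErank
  obtain ⟨c, hcq, hc0⟩ := Submodule.exists_mem_ne_zero_of_ne_bot hker
  have hmem : T (j c) ∈ Eᗮ := by
    have : E.orthogonalProjectionOnto (T (j c)) = 0 := hcq
    exact Submodule.orthogonalProjectionOnto_eq_zero_iff.1 this
  have h1 := hpos _ hmem
  rw [hR.left, real_inner_comm] at h1
  exact (hj c hc0).not_ge h1

end MorseIndex

/-! ### Small perturbations of a nonnegative operator with compact reduced resolvent -/

section Perturbation

variable {H : Type*} [NormedAddCommGroup H] [InnerProductSpace ℝ H]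
variable {κ : Type*} [Fintype κ]

/-- The operator `x ↦ ∑ₖ cₖ ⟨eₖ, x⟩ eₖ`; for `c = 1` and an orthonormal family `e` it is the
orthogonal projection onto the span of `e`. -/
def finiteDiag (e : κ → H) (c : κ → ℝ) : H →L[ℝ] H :=
  ∑ k, c k • (innerSL ℝ (e k)).smulRight (e k)

lemma finiteDiag_apply (e : κ → H) (c : κ → ℝ) (x : H) :
    finiteDiag e c x = ∑ k, (c k * inner ℝ (e k) x) • e k := by
  simp [finiteDiag, smul_smul]

lemma isCompactOperator_finiteDiag (e : κ → H) (c : κ → ℝ) :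
    IsCompactOperator (finiteDiag e c) := by
  refine (compactOperator (RingHom.id ℝ) H H).sum_mem (t := Finset.univ)
    (f := fun k => c k • (innerSL ℝ (e k)).smulRight (e k)) fun k _ => ?_
  refine (compactOperator (RingHom.id ℝ) H H).smul_mem (c k) ?_
  exact (isCompactOperator_of_locallyCompactSpace_dom (innerSL ℝ (e k))).clm_comp
    (ContinuousLinearMap.toSpanSingleton ℝ (e k))

lemma finiteDiag_isSymmetric (e : κ → H) (c : κ → ℝ) (x y : H) :
    inner ℝ (finiteDiag e c x) y = inner ℝ x (finiteDiag e c y) := by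
  simp only [finiteDiag_apply, sum_inner, inner_sum, real_inner_smul_left, real_inner_smul_right]
  refine Finset.sum_congr rfl fun k _ => ?_
  rw [real_inner_comm x (e k)]
  ring

lemma inner_finiteDiag_self (e : κ → H) (c : κ → ℝ) (x : H) :
    inner ℝ (finiteDiag e c x) x = ∑ k, c k * inner ℝ (e k) x ^ 2 := by
  simp only [finiteDiag_apply, sum_inner, real_inner_smul_left]
  exact Finset.sum_congr rfl fun k _ => by ring

lemma inner_finiteDiag {e : κ → H} (he : Orthonormal ℝ e) (c : κ → ℝ) (k : κ) (x : H) :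
    inner ℝ (e k) (finiteDiag e c x) = c k * inner ℝ (e k) x := by
  rw [finiteDiag_apply, he.inner_right_fintype]

lemma finiteDiag_finiteDiag {e : κ → H} (he : Orthonormal ℝ e) (c d : κ → ℝ) (x : H) :
    finiteDiag e c (finiteDiag e d x) = finiteDiag e (c * d) x := by
  rw [finiteDiag_apply, finiteDiag_apply e (c * d)]
  refine Finset.sum_congr rfl fun k _ => ?_
  rw [inner_finiteDiag he, Pi.mul_apply, mul_assoc]

lemma norm_sq_finiteDiag_one {e : κ → H} (he : Orthonormal ℝ e) (x : H) :
    ‖finiteDiag e 1 x‖ ^ 2 = ∑ k, inner ℝ (e k) x ^ 2 := by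
  rw [← real_inner_self_eq_norm_sq, ← finiteDiag_isSymmetric, finiteDiag_finiteDiag he, mul_one,
    inner_finiteDiag_self]
  simp

lemma norm_sq_eq_add_finiteDiag {e : κ → H} (he : Orthonormal ℝ e) (x : H) :
    ‖x‖ ^ 2 = ‖finiteDiag e 1 x‖ ^ 2 + ‖x - finiteDiag e 1 x‖ ^ 2 := by
  have h : inner ℝ (finiteDiag e 1 x) (x - finiteDiag e 1 x) = 0 := by
    rw [finiteDiag_isSymmetric, map_sub, finiteDiag_finiteDiag he, mul_one, sub_self,
      inner_zero_right]
  have := norm_add_sq_real (finiteDiag e 1 x) (x - finiteDiag e 1 x)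
  rw [h, add_sub_cancel] at this
  linarith

/-- `A` is a nonnegative symmetric operator whose kernel is spanned by the orthonormal family `e`,
with spectral gap `gap` above zero, and `G` is the compact inverse of `A` on the orthogonal
complement of the kernel, extended by zero. -/
structure HasReducedResolvent (A : H →ₗ.[ℝ] H) (e : κ → H) (G : H →L[ℝ] H) (gap : ℝ) : Prop where
  symm : IsSymm A
  orthonormal : Orthonormal ℝ e
  ker : ∀ k, ∃ h : e k ∈ A.domain, A ⟨e k, h⟩ = 0
  apply_resolvent : ∀ x, ∃ h : G x ∈ A.domain, A ⟨G x, h⟩ = x - finiteDiag e 1 x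
  proj_resolvent : ∀ x, finiteDiag e 1 (G x) = 0
  resolvent_apply : ∀ x : A.domain, G (A x) = x - finiteDiag e 1 (x : H)
  compact : IsCompactOperator G
  gap_pos : 0 < gap
  gap_le : ∀ x : A.domain, gap * ‖(x : H) - finiteDiag e 1 (x : H)‖ ^ 2 ≤ inner ℝ (A x) (x : H)

variable {A : H →ₗ.[ℝ] H} {e : κ → H} {G : H →L[ℝ] H} {gap : ℝ}

lemma HasReducedResolvent.finiteDiag_mem (hA : HasReducedResolvent A e G gap) (c : κ → ℝ) (x : H) :
    ∃ h : finiteDiag e c x ∈ A.domain, A ⟨finiteDiag e c x, h⟩ = 0 := by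
  have h0 : ∀ k, e k ∈ eigenspace A 0 := fun k => by
    obtain ⟨h, h'⟩ := hA.ker k
    exact ⟨h, by rw [h', zero_smul]⟩
  have : finiteDiag e c x ∈ eigenspace A 0 := by
    rw [finiteDiag_apply]
    exact Submodule.sum_mem _ fun k _ => Submodule.smul_mem _ _ (h0 k)
  obtain ⟨h, h'⟩ := this
  exact ⟨h, by rw [h', zero_smul]⟩

lemma HasReducedResolvent.finiteDiag_apply_eq_zero (hA : HasReducedResolvent A e G gap)
    (c : κ → ℝ) (x : A.domain) : finiteDiag e c (A x) = 0 := by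
  rw [finiteDiag_apply]
  refine Finset.sum_eq_zero fun k _ => ?_
  obtain ⟨h, h'⟩ := hA.ker k
  have := hA.symm ⟨e k, h⟩ x
  rw [h', inner_zero_left] at this
  change 0 = inner ℝ (e k) (A x) at this
  rw [← this, mul_zero, zero_smul]

/-- The sum `A + B` of an operator with domain and a bounded operator, with the domain of `A`. -/
def addBounded (A : H →ₗ.[ℝ] H) (B : H →L[ℝ] H) : H →ₗ.[ℝ] H := (B : H →ₗ[ℝ] H) +ᵥ A

lemma addBounded_apply (A : H →ₗ.[ℝ] H) (B : H →L[ℝ] H) (x : A.domain) :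
    addBounded A B x = A x + B (x : H) := by
  rw [add_comm]
  exact LinearPMap.vadd_apply _ _ _

lemma isSymm_addBounded (hA : IsSymm A) {B : H →L[ℝ] H}
    (hB : ∀ x y, inner ℝ (B x) y = inner ℝ x (B y)) : IsSymm (addBounded A B) := by
  intro x y
  have hx : addBounded A B x = A (x : A.domain) + B (x : H) := addBounded_apply A B x
  have hy : addBounded A B y = A (y : A.domain) + B (y : H) := addBounded_apply A B y
  have h : inner ℝ (A (x : A.domain)) (y : H) = inner ℝ (x : H) (A (y : A.domain)) := hA x y
  rw [hx, hy, inner_add_left, inner_add_right, hB, h]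

/-- The equation `(A + t W) z = y` is equivalent to `L z = t⁻¹ P y + G y`, where `P` is the
projection onto the kernel of `A` and `L = (1 - P) + P W + t G W`; so `A + t W` is invertible
when `L` is. -/
lemma HasReducedResolvent.exists_isInverse (hA : HasReducedResolvent A e G gap) {W : H →L[ℝ] H}
    {t : ℝ} (ht : t ≠ 0)
    (hL : IsUnit (1 - finiteDiag e 1 + finiteDiag e 1 * W + t • (G * W))) :
    ∃ R : H →L[ℝ] H, IsInverse R (addBounded A (t • W)) ∧ IsCompactOperator R := by
  obtain ⟨⟨L, L', hLL', hL'L⟩, hLeq⟩ := hL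
  simp only at hLeq
  have hLap : ∀ z, L z = z - finiteDiag e 1 z + finiteDiag e 1 (W z) + t • G (W z) := fun z => by
    rw [hLeq]; rfl
  have hPP : ∀ z, finiteDiag e 1 (finiteDiag e 1 z) = finiteDiag e 1 z := fun z => by
    rw [finiteDiag_finiteDiag hA.orthonormal, mul_one]
  let R : H →L[ℝ] H := L' * (t⁻¹ • finiteDiag e 1 + G)
  have hLR : ∀ y, L (R y) = t⁻¹ • finiteDiag e 1 y + G y := fun y =>
    DFunLike.congr_fun hLL' (t⁻¹ • finiteDiag e 1 y + G y)
  have key1 : ∀ y, finiteDiag e 1 (W (R y)) = t⁻¹ • finiteDiag e 1 y := fun y => by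
    have h := congrArg (finiteDiag e 1) (hLR y)
    rw [hLap] at h
    simpa only [map_add, map_sub, map_smul, hPP, hA.proj_resolvent, smul_zero, add_zero, sub_self,
      zero_add] using h
  have key2 : ∀ y, R y = finiteDiag e 1 (R y) + G (y - t • W (R y)) := fun y => by
    have h := hLR y
    rw [hLap, key1] at h
    rw [map_sub, map_smul]
    have h' : R y - finiteDiag e 1 (R y) + t • G (W (R y)) = G y :=
      add_left_cancel (a := t⁻¹ • finiteDiag e 1 y) (by rw [← h]; abel)
    rw [← h']; abel
  refine ⟨R, ⟨fun y => ?_, fun x => ?_⟩, ?_⟩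
  · obtain ⟨h1, h1'⟩ := hA.finiteDiag_mem 1 (R y)
    obtain ⟨h2, h2'⟩ := hA.apply_resolvent (y - t • W (R y))
    have hmem : R y ∈ A.domain := by rw [key2]; exact A.domain.add_mem h1 h2
    refine ⟨hmem, ?_⟩
    have hAR : A ⟨R y, hmem⟩ = y - t • W (R y) := by
      have : (⟨R y, hmem⟩ : A.domain) = ⟨_, h1⟩ + ⟨_, h2⟩ := Subtype.ext (key2 y)
      rw [this, A.map_add, h1', h2', map_sub, map_smul, key1, smul_smul, mul_inv_cancel₀ ht,
        one_smul]
      abel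
    refine (addBounded_apply A (t • W) ⟨R y, hmem⟩).trans ?_
    rw [hAR]
    simp
  · have h : (t⁻¹ • finiteDiag e 1 + G) (addBounded A (t • W) x) = L x := by
      rw [show addBounded A (t • W) x = A x + (t • W) (x : H) from addBounded_apply A (t • W) x]
      simp only [_root_.add_apply, _root_.smul_apply, map_add, map_smul]
      have h3 : G (A (x : A.domain)) = _ := hA.resolvent_apply x
      rw [hA.finiteDiag_apply_eq_zero 1 x, h3, hLap, smul_zero, zero_add, smul_add,
        smul_inv_smul₀ ht, add_assoc]
    change L' ((t⁻¹ • finiteDiag e 1 + G) (addBounded A (t • W) x)) = x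
    rw [h]
    exact DFunLike.congr_fun hL'L (x : H)
  · have : (R : H → H) = finiteDiag e 1 ∘ R + G ∘ (1 - t • (W * R) : H →L[ℝ] H) := by
      funext y
      exact key2 y
    rw [this]
    exact ((isCompactOperator_finiteDiag e 1).comp_clm R).add (hA.compact.comp_clm _)

/-- If `W₀` acts on the kernel of `A` as the diagonal matrix with nonzero entries `lam`, then for
all small `t` and all `W` close to `W₀` the operator `A + t W` is invertible and its Morse index is
the number of negative entries of `lam`. -/
theorem HasReducedResolvent.morseIndex_addBounded [CompleteSpace H]
    (hA : HasReducedResolvent A e G gap) {W₀ : H →L[ℝ] H}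
    (hW₀ : ∀ x y, inner ℝ (W₀ x) y = inner ℝ x (W₀ y)) {lam : κ → ℝ} (hlam : ∀ k, lam k ≠ 0)
    (he : ∀ k, W₀ (e k) = lam k • e k) :
    ∃ ε > (0 : ℝ), ∃ t₀ > (0 : ℝ), ∀ t : ℝ, 0 < t → t < t₀ → ∀ W : H →L[ℝ] H,
      (∀ x y, inner ℝ (W x) y = inner ℝ x (W y)) → ‖W - W₀‖ ≤ ε →
      (∃ R : H →L[ℝ] H, IsInverse R (addBounded A (t • W))) ∧
        morseIndex (addBounded A (t • W)) = Fintype.card {k // lam k < 0} := by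
  obtain ⟨δ, hδ, hδle⟩ : ∃ δ > 0, ∀ k, δ ≤ |lam k| := by
    rcases isEmpty_or_nonempty κ with h | h
    · exact ⟨1, one_pos, fun k => h.elim k⟩
    · obtain ⟨k, hk⟩ := Finite.exists_min fun k => |lam k|
      exact ⟨|lam k|, abs_pos.2 (hlam k), hk⟩
  set P := finiteDiag e 1 with hPdef
  have horth := hA.orthonormal
  have hW₀P : ∀ x, W₀ (P x) = finiteDiag e lam x := fun x => by
    rw [hPdef, finiteDiag_apply, finiteDiag_apply, map_sum]
    refine Finset.sum_congr rfl fun k _ => ?_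
    rw [map_smul, he, smul_smul, Pi.one_apply, one_mul, mul_comm]
  have hPW₀ : ∀ x, P (W₀ x) = finiteDiag e lam x := fun x => by
    rw [hPdef, finiteDiag_apply, finiteDiag_apply]
    refine Finset.sum_congr rfl fun k _ => ?_
    rw [← hW₀, he, real_inner_smul_left, Pi.one_apply, one_mul]
  have hPP : ∀ x, P (P x) = P x := fun x => by
    rw [hPdef, finiteDiag_finiteDiag horth, mul_one]
  have hdP : ∀ c x, finiteDiag e c (P x) = finiteDiag e c x := fun c x => by
    rw [hPdef, finiteDiag_finiteDiag horth, mul_one]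
  have hPd : ∀ c x, P (finiteDiag e c x) = finiteDiag e c x := fun c x => by
    rw [hPdef, finiteDiag_finiteDiag horth, one_mul]
  -- The limit operator `(1 - P) + P W₀` is invertible.
  have hM : IsUnit (1 - P + P * W₀) := by
    have h1 : lam * lam⁻¹ = 1 := funext fun k => mul_inv_cancel₀ (hlam k)
    refine ⟨⟨1 - P + P * W₀, 1 - P + finiteDiag e lam⁻¹, ?_, ?_⟩, rfl⟩
    · ext x
      change (x - P x + finiteDiag e lam⁻¹ x) - P (x - P x + finiteDiag e lam⁻¹ x) +
        P (W₀ (x - P x + finiteDiag e lam⁻¹ x)) = x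
      rw [hPW₀]
      simp only [map_add, map_sub, hPP, hPd, hdP, finiteDiag_finiteDiag horth, h1]
      rw [hPdef]; abel
    · ext x
      change (x - P x + P (W₀ x)) - P (x - P x + P (W₀ x)) +
        finiteDiag e lam⁻¹ (x - P x + P (W₀ x)) = x
      rw [hPW₀]
      simp only [map_add, map_sub, hPP, hPd, hdP, finiteDiag_finiteDiag horth, mul_comm lam⁻¹, h1]
      rw [hPdef]; abel
  obtain ⟨r, hr, hball⟩ := Metric.isOpen_iff.1 Units.isOpen _ hM
  -- The bounds involving `r` keep `(1 - P) + P W + t G W` in a ball of invertible operators. The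
  -- bounds by `δ / 2` and `1` on `ε`, and by `gap / (‖W₀‖ + 1)` on `t₀`, control the quadratic
  -- form.
  let ε := min (min (δ / 2) 1) (r / 4 / (‖P‖ + 1))
  let t₀ := min (r / 4 / ((‖G‖ + 1) * (‖W₀‖ + 1))) (gap / (‖W₀‖ + 1))
  have hP1 : 0 < ‖P‖ + 1 := by positivity
  have hG1 : 0 < ‖G‖ + 1 := by positivity
  have hW1 : 0 < ‖W₀‖ + 1 := by positivity
  have hgap := hA.gap_pos
  refine ⟨ε, by positivity, t₀, by positivity, fun t ht htt W hW hWε => ?_⟩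
  have hε1 : ε ≤ δ / 2 := (min_le_left _ _).trans (min_le_left _ _)
  have hε2 : ε ≤ 1 := (min_le_left _ _).trans (min_le_right _ _)
  have hε3 : ε * (‖P‖ + 1) ≤ r / 4 := (le_div_iff₀ hP1).1 (min_le_right _ _)
  have ht1 : t * ((‖G‖ + 1) * (‖W₀‖ + 1)) ≤ r / 4 :=
    (le_div_iff₀ (by positivity)).1 (htt.le.trans (min_le_left _ _))
  have ht2 : t * (‖W₀‖ + 1) ≤ gap := (le_div_iff₀ hW1).1 (htt.le.trans (min_le_right _ _))
  have hWn : ‖W‖ ≤ ‖W₀‖ + 1 := by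
    have := norm_le_norm_add_norm_sub W₀ W
    rw [norm_sub_rev] at this
    linarith
  have hL : IsUnit (1 - P + P * W + t • (G * W)) := by
    refine hball ?_
    rw [Metric.mem_ball, dist_eq_norm]
    have : 1 - P + P * W + t • (G * W) - (1 - P + P * W₀) = P * (W - W₀) + t • (G * W) := by
      rw [mul_sub]; abel
    rw [this]
    have h1 : ‖P * (W - W₀)‖ ≤ (‖P‖ + 1) * ε := (norm_mul_le _ _).trans
      (mul_le_mul (by linarith) hWε (norm_nonneg _) hP1.le)
    have h2 : ‖t • (G * W)‖ ≤ t * ((‖G‖ + 1) * (‖W₀‖ + 1)) := by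
      rw [norm_smul, Real.norm_of_nonneg ht.le]
      refine mul_le_mul_of_nonneg_left ((norm_mul_le _ _).trans ?_) ht.le
      exact mul_le_mul (by linarith) hWn (norm_nonneg _) hG1.le
    have := norm_add_le (P * (W - W₀)) (t • (G * W))
    linarith
  obtain ⟨R, hR, hRc⟩ := hA.exists_isInverse ht.ne' hL
  have hsymm : IsSymm (addBounded A (t • W)) := isSymm_addBounded hA.symm fun x y => by
    simp only [_root_.smul_apply, real_inner_smul_left, real_inner_smul_right, hW]
  have hsplit : ∀ x, inner ℝ (W x) x = inner ℝ (W₀ x) x + inner ℝ ((W - W₀) x) x := fun x => by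
    rw [← inner_add_left, _root_.sub_apply, add_sub_cancel]
  have hdiff : ∀ x, |inner ℝ ((W - W₀) x) x| ≤ ε * ‖x‖ ^ 2 := fun x => by
    refine (abs_real_inner_le_norm _ _).trans ?_
    rw [pow_two, ← mul_assoc]
    refine mul_le_mul_of_nonneg_right ?_ (norm_nonneg _)
    exact ((W - W₀).le_opNorm x).trans (mul_le_mul_of_nonneg_right hWε (norm_nonneg _))
  have hcard : Module.finrank ℝ ({k // lam k < 0} → ℝ) = Fintype.card {k // lam k < 0} :=
    Module.finrank_fintype_fun_eq_card ℝ
  refine ⟨⟨R, hR⟩, le_antisymm ?_ ?_⟩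
  · rw [← hcard]
    -- Upper bound: the form of `A + t W` is nonnegative on the orthogonal complement of the `eₖ`
    -- with `lam k < 0`. On `(1 - P) x` the gap of `A` dominates `t W`; on `P x` the form of `W₀` is
    -- at least `δ ‖P x‖²`.
    let p : H →ₗ[ℝ] ({k // lam k < 0} → ℝ) :=
      LinearMap.pi fun k => (innerSL ℝ (e k.1) : H →ₗ[ℝ] ℝ)
    refine hsymm.morseIndex_le p fun x hx => ?_
    have hx0 : ∀ k, lam k < 0 → inner ℝ (e k) (x : H) = 0 := fun k hk => congrFun hx ⟨k, hk⟩
    have h1 : addBounded A (t • W) x = A x + (t • W) (x : H) := addBounded_apply A (t • W) x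
    rw [h1, inner_add_left, _root_.smul_apply, real_inner_smul_left, hsplit]
    set w : H := (x : H) - P (x : H) with hw
    -- There are no cross terms, since `W₀` commutes with the projection `P`.
    have h2 : inner ℝ (W₀ (x : H)) (x : H) =
        ∑ k, lam k * inner ℝ (e k) (x : H) ^ 2 + inner ℝ (W₀ w) w := by
      have h3 : inner ℝ (W₀ w) (P (x : H)) = 0 := by
        rw [hW₀, hW₀P, ← finiteDiag_isSymmetric, hw, map_sub, hdP, sub_self, inner_zero_left]
      have h4 : inner ℝ (W₀ w) (x : H) = inner ℝ (W₀ w) w := by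
        rw [hw, inner_sub_right (W₀ _), ← hw, h3, sub_zero]
      rw [← h4, ← inner_finiteDiag_self, ← hW₀P, ← inner_add_left, ← map_add, hw, add_sub_cancel]
    have h5 : δ * ‖P (x : H)‖ ^ 2 ≤ ∑ k, lam k * inner ℝ (e k) (x : H) ^ 2 := by
      rw [hPdef, norm_sq_finiteDiag_one horth, Finset.mul_sum]
      refine Finset.sum_le_sum fun k _ => ?_
      rcases lt_or_ge (lam k) 0 with h | h
      · rw [hx0 k h]; simp
      · refine mul_le_mul_of_nonneg_right ?_ (sq_nonneg _)
        simpa only [abs_of_nonneg h] using hδle k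
    have h6 : -(‖W₀‖ * ‖w‖ ^ 2) ≤ inner ℝ (W₀ w) w := by
      refine (neg_le_neg ?_).trans (neg_abs_le _)
      refine (abs_real_inner_le_norm _ _).trans ?_
      rw [pow_two, ← mul_assoc]
      exact mul_le_mul_of_nonneg_right (W₀.le_opNorm w) (norm_nonneg _)
    have h7 := (abs_le.1 (hdiff (x : H))).1
    have h8 := norm_sq_eq_add_finiteDiag horth (x : H)
    rw [← hPdef, ← hw] at h8
    have h9 := hA.gap_le x
    rw [← hPdef, ← hw] at h9
    have h10 : -((‖W₀‖ + 1) * ‖w‖ ^ 2) ≤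
        inner ℝ (W₀ (x : H)) (x : H) + inner ℝ ((W - W₀) (x : H)) (x : H) := by
      rw [h2]
      have h11 : 0 ≤ (δ - ε) * ‖P (x : H)‖ ^ 2 := mul_nonneg (by linarith) (sq_nonneg _)
      have h12 : 0 ≤ (1 - ε) * ‖w‖ ^ 2 := mul_nonneg (by linarith) (sq_nonneg _)
      rw [h8] at h7
      linarith
    have h13 := mul_le_mul_of_nonneg_left h10 ht.le
    have h14 := mul_le_mul_of_nonneg_right ht2 (sq_nonneg ‖w‖)
    linarith
  · rw [← hcard]
    -- Lower bound: on the span of the `eₖ` with `lam k < 0` the operator `A` vanishes and the form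
    -- of `W₀` is at most `-δ ‖x‖²`.
    let j : ({k // lam k < 0} → ℝ) →ₗ[ℝ] A.domain :=
      ∑ k : {k // lam k < 0}, (LinearMap.proj k).smulRight (⟨e k.1, (hA.ker k.1).1⟩ : A.domain)
    have hjap : ∀ c, (j c : H) = ∑ k, c k • e k.1 := fun c => by
      simp [j, LinearMap.sum_apply]
    refine hsymm.le_morseIndex hR hRc j fun c hc => ?_
    have horth' : Orthonormal ℝ fun k : {k // lam k < 0} => e k.1 :=
      horth.comp _ Subtype.val_injective
    have hAj : A (j c) = 0 := by
      have : j c = ∑ k, c k • (⟨e k.1, (hA.ker k.1).1⟩ : A.domain) := by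
        simp [j, LinearMap.sum_apply]
      rw [this]
      change A.toFun _ = 0
      rw [map_sum]
      refine Finset.sum_eq_zero fun k _ => ?_
      rw [map_smul]
      exact (congrArg (c k • ·) (hA.ker k.1).2).trans (smul_zero _)
    have h1 : addBounded A (t • W) (j c) = A (j c) + (t • W) (j c : H) :=
      addBounded_apply A (t • W) (j c)
    refine lt_of_eq_of_lt (congrArg (fun v => inner ℝ v (j c : H)) h1) ?_
    rw [hAj, zero_add, _root_.smul_apply, real_inner_smul_left, hsplit]
    have h2 : ‖(j c : H)‖ ^ 2 = ∑ k, c k ^ 2 := by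
      rw [hjap, ← real_inner_self_eq_norm_sq, horth'.inner_sum]
      simp [pow_two]
    have h3 : inner ℝ (W₀ (j c : H)) (j c : H) = ∑ k : {k // lam k < 0}, lam k.1 * c k ^ 2 := by
      have : W₀ (j c : H) = ∑ k : {k // lam k < 0}, (c k * lam k.1) • e k.1 := by
        rw [hjap, map_sum]
        exact Finset.sum_congr rfl fun k _ => by rw [map_smul, he, smul_smul]
      rw [this, hjap, horth'.inner_sum]
      refine Finset.sum_congr rfl fun k _ => ?_
      simp only [conj_trivial]
      ring
    have h4 : ∑ k : {k // lam k < 0}, lam k.1 * c k ^ 2 ≤ -δ * ∑ k, c k ^ 2 := by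
      rw [Finset.mul_sum]
      refine Finset.sum_le_sum fun k _ => mul_le_mul_of_nonneg_right ?_ (sq_nonneg _)
      have := hδle k.1
      rw [abs_of_neg k.2] at this
      linarith
    have h5 : 0 < ∑ k, c k ^ 2 := by
      obtain ⟨k, hk⟩ := Function.ne_iff.1 hc
      exact Finset.sum_pos' (fun k _ => sq_nonneg _) ⟨k, Finset.mem_univ _, by
        have : c k ≠ 0 := hk
        positivity⟩
    have h6 := (abs_le.1 (hdiff (j c : H))).2
    rw [h2] at h6
    have h7 : 0 ≤ (δ / 2 - ε) * ∑ k, c k ^ 2 := mul_nonneg (by linarith) h5.le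
    have h8 : 0 < δ / 2 * ∑ k, c k ^ 2 := by positivity
    refine mul_neg_of_pos_of_neg ht ?_
    rw [h3]
    linarith

end Perturbation

/-! ### The Morse index of an invertible symmetric matrix -/

section MatrixMorse

variable {m : ℕ} {M : Matrix (Fin m) (Fin m) ℝ}

lemma eigenvalues_ne_zero_of_isUnit (hM : M.IsHermitian) (hu : IsUnit M) (i : Fin m) :
    hM.eigenvalues i ≠ 0 := by
  intro h
  have hdet := hM.det_eq_prod_eigenvalues
  rw [Finset.prod_eq_zero (Finset.mem_univ i) (by simp [h])] at hdet
  exact ((Matrix.isUnit_iff_isUnit_det M).1 hu).ne_zero hdet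

lemma toEuclideanLin_eigenvectorBasis (hM : M.IsHermitian) (i : Fin m) :
    Matrix.toEuclideanLin M (hM.eigenvectorBasis i) =
      hM.eigenvalues i • hM.eigenvectorBasis i := by
  have h := hM.mulVec_eigenvectorBasis i
  ext p
  simpa [Matrix.toLpLin_apply] using congrFun h p

theorem matrixMorseIndex_eq_card (hM : M.IsHermitian) (hu : IsUnit M) :
    matrixMorseIndex M = Fintype.card {i // hM.eigenvalues i < 0} := by
  set b := hM.eigenvectorBasis with hb
  set lam := hM.eigenvalues with hlam
  set L := Matrix.toEuclideanLin M with hLdef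
  set T := L.toPMap ⊤ with hT
  have hLs : ∀ x y, inner ℝ (L x) y = inner ℝ x (L y) :=
    Matrix.isSymmetric_toEuclideanLin_iff.2 hM
  have hTx : ∀ x : T.domain, T x = L (x : EuclideanSpace ℝ (Fin m)) := fun x => rfl
  have hsymm : IsSymm T := fun x y => hLs _ _
  have hLb : ∀ i, L (b i) = lam i • b i := toEuclideanLin_eigenvectorBasis hM
  have hquad : ∀ x, inner ℝ (L x) x = ∑ i, lam i * inner ℝ (b i) x ^ 2 := fun x => by
    rw [← b.sum_inner_mul_inner]
    refine Finset.sum_congr rfl fun i _ => ?_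
    rw [hLs, hLb, real_inner_smul_right, real_inner_comm x]
    ring
  have hcard : Module.finrank ℝ ({k // lam k < 0} → ℝ) = Fintype.card {k // lam k < 0} :=
    Module.finrank_fintype_fun_eq_card ℝ
  refine le_antisymm ?_ ?_
  · rw [← hcard]
    refine hsymm.morseIndex_le (LinearMap.pi fun k : {k // lam k < 0} =>
      (innerSL ℝ (b k.1) : EuclideanSpace ℝ (Fin m) →ₗ[ℝ] ℝ)) fun x hx => ?_
    rw [hTx, hquad]
    refine Finset.sum_nonneg fun i _ => ?_
    rcases lt_or_ge (lam i) 0 with h | h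
    · have : inner ℝ (b i) (x : EuclideanSpace ℝ (Fin m)) = 0 := congrFun hx ⟨i, h⟩
      rw [this]; simp
    · exact mul_nonneg h (sq_nonneg _)
  · rw [← hcard]
    have hd : IsUnit M.det := (Matrix.isUnit_iff_isUnit_det M).1 hu
    have hcomp : ∀ A B : Matrix (Fin m) (Fin m) ℝ, A * B = 1 → ∀ x,
        Matrix.toEuclideanLin A (Matrix.toEuclideanLin B x) = x := fun A B h x => by
      simp [Matrix.toLpLin_apply, Matrix.mulVec_mulVec, h]
    have hR : IsInverse (Matrix.toEuclideanLin M⁻¹).toContinuousLinearMap T :=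
      ⟨fun y => ⟨Submodule.mem_top, hcomp _ _ (Matrix.mul_nonsing_inv M hd) y⟩,
        fun x => hcomp _ _ (Matrix.nonsing_inv_mul M hd) x⟩
    let j : ({k // lam k < 0} → ℝ) →ₗ[ℝ] T.domain :=
      ∑ k : {k // lam k < 0}, (LinearMap.proj k).smulRight (⟨b k.1, Submodule.mem_top⟩ : T.domain)
    have hj : ∀ c, (j c : EuclideanSpace ℝ (Fin m)) = ∑ k, c k • b k.1 := fun c => by
      simp [j, LinearMap.sum_apply]
    refine hsymm.le_morseIndex hR (isCompactOperator_of_locallyCompactSpace_dom _) j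
      fun c hc => ?_
    have horth : Orthonormal ℝ fun k : {k // lam k < 0} => b k.1 :=
      b.orthonormal.comp _ Subtype.val_injective
    have h1 : L (j c : EuclideanSpace ℝ (Fin m)) =
        ∑ k : {k // lam k < 0}, (c k * lam k.1) • b k.1 := by
      rw [hj, map_sum]
      exact Finset.sum_congr rfl fun k _ => by rw [map_smul, hLb, smul_smul]
    rw [hTx, h1, hj, horth.inner_sum]
    obtain ⟨k, hk⟩ := Function.ne_iff.1 hc
    have hk0 : c k ≠ 0 := hk
    refine Finset.sum_neg' (fun i _ => ?_) ⟨k, Finset.mem_univ _, ?_⟩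
    · simp only [conj_trivial]
      nlinarith [mul_nonneg (sq_nonneg (c i)) (neg_nonneg.2 i.2.le)]
    · simp only [conj_trivial]
      have : 0 < c k ^ 2 := by positivity
      nlinarith [mul_pos this (neg_pos.2 k.2)]

/-- The vector `v ⊗ δₖ` of `ℝ²ᵐ = ℝᵐ ⊗ ℝ²`. -/
def tensorSingle (v : EuclideanSpace ℝ (Fin m)) (k : Fin 2) : Vec m :=
  WithLp.toLp 2 fun p => v p.1 * if p.2 = k then 1 else 0

lemma inner_tensorSingle (v w : EuclideanSpace ℝ (Fin m)) (k l : Fin 2) :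
    inner ℝ (tensorSingle v k) (tensorSingle w l) = if k = l then inner ℝ v w else 0 := by
  simp only [tensorSingle, PiLp.inner_apply, Fintype.sum_prod_type]
  split_ifs with h
  · subst h
    simp
  · simp [h]

lemma toEuclideanLin_kronecker_one_tensorSingle (v : EuclideanSpace ℝ (Fin m)) (k : Fin 2) :
    Matrix.toEuclideanLin (M ⊗ₖ (1 : Matrix (Fin 2) (Fin 2) ℝ)) (tensorSingle v k) =
      tensorSingle (Matrix.toEuclideanLin M v) k := by
  ext p
  simp only [tensorSingle, Matrix.toLpLin_apply, Matrix.mulVec, dotProduct,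
    Fintype.sum_prod_type, Matrix.kroneckerMap_apply]
  simp [Matrix.one_apply]

/-- An orthonormal basis of eigenvectors of `M ⊗ I₂`. -/
lemma exists_orthonormalBasis_kronecker (hM : M.IsHermitian) :
    ∃ b : OrthonormalBasis (Fin m × Fin 2) ℝ (Vec m), ∀ p,
      Matrix.toEuclideanLin (M ⊗ₖ (1 : Matrix (Fin 2) (Fin 2) ℝ)) (b p) =
        hM.eigenvalues p.1 • b p := by
  have ho : Orthonormal ℝ fun p : Fin m × Fin 2 =>
      tensorSingle (hM.eigenvectorBasis p.1) p.2 := by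
    rw [orthonormal_iff_ite]
    intro p q
    rw [inner_tensorSingle, orthonormal_iff_ite.1 hM.eigenvectorBasis.orthonormal]
    by_cases h : p.1 = q.1 <;> by_cases h' : p.2 = q.2 <;> simp [h, h', Prod.ext_iff]
  have hcard : Fintype.card (Fin m × Fin 2) = Module.finrank ℝ (Vec m) := by
    rw [finrank_euclideanSpace]
  refine ⟨OrthonormalBasis.mk ho
    (ho.linearIndependent.span_eq_top_of_card_eq_finrank' hcard).ge, fun p => ?_⟩
  rw [OrthonormalBasis.coe_mk, toEuclideanLin_kronecker_one_tensorSingle,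
    toEuclideanLin_eigenvectorBasis]
  ext q
  simp [tensorSingle]

end MatrixMorse

/-! ### The dual basis and coordinates on the cell -/

section Geometry

variable {n : ℕ} {a : Fin n → Space n}

/-- The basis of `ℝⁿ` dual to `a`; `dualVec a j` is the multiple of the normal vector to the faces
`∂Qⱼˢ` that has inner product one with `aⱼ`. -/
def dualVec (a : Fin n → Space n) (j : Fin n) : Space n :=
  (‖faceHeight a j‖ ^ 2)⁻¹ • faceHeight a j

lemma faceHeight_ne_zero (ha : LinearIndependent ℝ a) (j : Fin n) : faceHeight a j ≠ 0 := by
  intro h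
  have h1 : a j ∈ (Submodule.span ℝ (a '' {i | i ≠ j}))ᗮᗮ :=
    (Submodule.starProjection_apply_eq_zero_iff _).1 h
  rw [Submodule.orthogonal_orthogonal] at h1
  exact ha.notMem_span_image (s := {i | i ≠ j}) (x := j) (by simp) h1

lemma inner_dualVec (ha : LinearIndependent ℝ a) (j i : Fin n) :
    inner ℝ (dualVec a j) (a i) = if i = j then 1 else 0 := by
  rw [dualVec, real_inner_smul_left]
  split_ifs with h
  · subst h
    have h1 : inner ℝ (faceHeight a i) (a i) = ‖faceHeight a i‖ ^ 2 := by
      have h2 := Submodule.starProjection_inner_eq_zero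
        (K := (Submodule.span ℝ (a '' {k | k ≠ i}))ᗮ) (a i) (faceHeight a i)
        (Submodule.starProjection_apply_mem _ _)
      rw [inner_sub_left, sub_eq_zero] at h2
      rw [real_inner_comm, h2, ← real_inner_self_eq_norm_sq]
      rfl
    rw [h1, inv_mul_cancel₀]
    have := norm_ne_zero_iff.2 (faceHeight_ne_zero ha i)
    positivity
  · have h1 : faceHeight a j ∈ (Submodule.span ℝ (a '' {k | k ≠ j}))ᗮ :=
      Submodule.starProjection_apply_mem _ _
    rw [real_inner_comm, (Submodule.mem_orthogonal _ _).1 h1 _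
      (Submodule.subset_span ⟨i, h, rfl⟩), mul_zero]

lemma outwardNormal_eq (j : Fin n) (s : Fin 2) :
    outwardNormal a j s = (if s = 1 then (1 : ℝ) else -1) • ‖faceHeight a j‖ • dualVec a j := by
  rw [outwardNormal, dualVec]
  rcases eq_or_ne (‖faceHeight a j‖) 0 with h | h
  · simp [h]
  · rw [smul_smul ‖faceHeight a j‖, pow_two, mul_inv, ← mul_assoc, mul_inv_cancel₀ h, one_mul]

/-- The linear isomorphism `t ↦ ∑ tᵢ aᵢ`. -/
def latticeEquiv (ha : LinearIndependent ℝ a) : (Fin n → ℝ) ≃L[ℝ] Space n :=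
  ((Module.Basis.mk ha (ha.span_eq_top_of_card_eq_finrank' (by simp)).ge).equivFun.symm)
    |>.toContinuousLinearEquiv

lemma latticeEquiv_apply (ha : LinearIndependent ℝ a) (t : Fin n → ℝ) :
    latticeEquiv ha t = ∑ i, t i • a i := by
  simp [latticeEquiv, Module.Basis.equivFun_symm_apply]

lemma sum_inner_dualVec_smul (ha : LinearIndependent ℝ a) (x : Space n) :
    ∑ j, inner ℝ (dualVec a j) x • a j = x := by
  obtain ⟨t, rfl⟩ := (latticeEquiv ha).surjective x
  rw [latticeEquiv_apply]
  refine Finset.sum_congr rfl fun j _ => ?_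
  rw [inner_sum, Finset.sum_eq_single_of_mem j (Finset.mem_univ j), real_inner_smul_right,
    inner_dualVec ha, if_pos rfl, mul_one]
  intro i _ hij
  rw [real_inner_smul_right, inner_dualVec ha, if_neg hij, mul_zero]

lemma sum_dualVec_mul (ha : LinearIndependent ℝ a) (i l : Fin n) :
    ∑ j, dualVec a j l * a j i = if i = l then 1 else 0 := by
  have h := congrArg (fun x : Space n => x i) (sum_inner_dualVec_smul ha (EuclideanSpace.single l 1))
  simpa [EuclideanSpace.inner_single_right, Pi.single_apply] using h

lemma parallelepiped_eq_image (ha : LinearIndependent ℝ a) :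
    parallelepiped a = latticeEquiv ha '' Set.Icc 0 1 := by
  rw [parallelepiped]
  exact congrArg (· '' _) (funext fun t => (latticeEquiv_apply ha t).symm)

lemma isCompact_cell (a : Fin n → Space n) : IsCompact (parallelepiped a) := by
  unfold parallelepiped
  exact isCompact_Icc.image (by fun_prop)

lemma exists_cellMeasure_eq_smul_map (ha : LinearIndependent ℝ a) :
    ∃ c : ℝ≥0∞, c ≠ 0 ∧ c ≠ ⊤ ∧ cellMeasure a =
      c • (volume.restrict (Set.Icc (0 : Fin n → ℝ) 1)).map (fun t => ∑ i, t i • a i) := by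
  let mu : Measure (Space n) := (volume : Measure (Fin n → ℝ)).map (latticeEquiv ha)
  have hc : (volume : Measure (Space n)) = Measure.addHaarScalarFactor volume mu • mu :=
    Measure.isAddLeftInvariant_eq_smul _ _
  refine ⟨Measure.addHaarScalarFactor volume mu,
    ENNReal.coe_ne_zero.2 (Measure.addHaarScalarFactor_pos_of_isAddHaarMeasure _ _).ne',
    ENNReal.coe_ne_top, ?_⟩
  have hf : (fun t : Fin n → ℝ => ∑ i, t i • a i) = latticeEquiv ha :=
    funext fun t => (latticeEquiv_apply ha t).symm
  rw [cellMeasure]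
  nth_rewrite 1 [hc]
  rw [Measure.restrict_smul, Measure.restrict_map
    (latticeEquiv ha).continuous.measurable (isCompact_cell a).measurableSet, hf,
    parallelepiped_eq_image ha, Set.preimage_image_eq _ (latticeEquiv ha).injective]
  rfl

lemma restrict_Icc_eq_pi {ι : Type*} [Fintype ι] :
    (volume.restrict (Set.Icc (0 : ι → ℝ) 1)) =
      Measure.pi fun _ => volume.restrict (Set.Icc (0 : ℝ) 1) := by
  rw [← Set.pi_univ_Icc, volume_pi, Measure.restrict_pi_pi]
  rfl

lemma measurable_smul_add (v : Space n) : Measurable fun p : ℝ × Space n => p.1 • v + p.2 := by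
  fun_prop

instance (j : Fin n) (s : Fin 2) : IsFiniteMeasure (faceMeasure a j s) := by
  rw [faceMeasure]
  have : IsFiniteMeasure (volume.restrict (Set.Icc (0 : {i : Fin n // i ≠ j} → ℝ) 1)) :=
    ⟨by rw [Measure.restrict_apply_univ]; exact isCompact_Icc.measure_lt_top⟩
  exact Measure.isFiniteMeasure_map _ _

lemma continuous_face_param (j : Fin n) (s : Fin 2) : Continuous
    fun t : {i : Fin n // i ≠ j} → ℝ =>
      ((s : ℕ) : ℝ) • a j + ∑ i : {i : Fin n // i ≠ j}, t i • a i := by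
  fun_prop

/-- The cell is swept out by translating the face `∂Qⱼ⁰` along `aⱼ`. -/
lemma exists_cellMeasure_eq_smul_prod (ha : LinearIndependent ℝ a) (j : Fin n) :
    ∃ c : ℝ≥0∞, c ≠ 0 ∧ c ≠ ⊤ ∧ cellMeasure a =
      c • ((volume.restrict (Set.Icc (0 : ℝ) 1)).prod (faceMeasure a j 0)).map
        (fun p => p.1 • a j + p.2) := by
  obtain ⟨c, h0, h1, hc⟩ := exists_cellMeasure_eq_smul_map ha
  refine ⟨c, h0, h1, ?_⟩
  rw [hc]
  congr 1
  rw [faceMeasure]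
  have hm := (continuous_face_param (a := a) j 0).measurable
  set f := fun t : {i : Fin n // i ≠ j} → ℝ =>
      (((0 : Fin 2) : ℕ) : ℝ) • a j + ∑ i : {i : Fin n // i ≠ j}, t i • a i with hf
  have e1 := measurePreserving_piEquivPiSubtypeProd
    (fun _ : Fin n => (volume.restrict (Set.Icc (0 : ℝ) 1))) (fun i => i = j)
  have e2 := measurePreserving_funUnique (volume.restrict (Set.Icc (0 : ℝ) 1)) {i : Fin n // i = j}
  have e3 := e2.prod (MeasurePreserving.id (Measure.pi fun _ : {i : Fin n // ¬ i = j} =>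
    (volume.restrict (Set.Icc (0 : ℝ) 1))))
  rw [show (Unique.fintype : Fintype {i : Fin n // i = j}) = Subtype.fintype _ from
    Subsingleton.elim _ _] at e3
  have e4 := (e3.comp e1).map_eq
  rw [restrict_Icc_eq_pi, restrict_Icc_eq_pi]
  have e5 : (volume.restrict (Set.Icc (0 : ℝ) 1)).prod
      ((Measure.pi fun _ : {i : Fin n // i ≠ j} => volume.restrict (Set.Icc (0 : ℝ) 1)).map f) =
      ((volume.restrict (Set.Icc (0 : ℝ) 1)).prod
        (Measure.pi fun _ : {i : Fin n // i ≠ j} => volume.restrict (Set.Icc (0 : ℝ) 1))).map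
        (Prod.map id f) := by
    rw [← Measure.map_prod_map _ _ measurable_id hm, Measure.map_id]
  rw [e5, Measure.map_map (measurable_smul_add _) (measurable_id.prodMap hm)]
  change _ = Measure.map _ ((volume.restrict (Set.Icc (0 : ℝ) 1)).prod
        (Measure.pi fun _ : {i : Fin n // ¬ i = j} => volume.restrict (Set.Icc (0 : ℝ) 1)))
  rw [← e4, Measure.map_map ((measurable_smul_add _).comp (measurable_id.prodMap hm))
    (e3.comp e1).measurable]
  congr 1
  funext t
  simp only [Function.comp_apply, Prod.map, hf, id_eq]
  simp only [Fin.coe_ofNat_eq_mod, Nat.zero_mod, Nat.cast_zero, zero_smul, zero_add]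
  rw [← Fintype.sum_subtype_add_sum_subtype (fun i => i = j) fun i => t i • a i]
  congr 1
  exact Finset.sum_eq_single (⟨j, rfl⟩ : {i : Fin n // i = j})
    (fun b _ hb => absurd (Subtype.ext b.2) hb)
      fun h => (h (by simp [Subsingleton.elim _ default])).elim

lemma faceMeasure_one_eq_map (j : Fin n) :
    faceMeasure a j 1 = (faceMeasure a j 0).map (fun y => a j + y) := by
  rw [faceMeasure, faceMeasure, Measure.map_map (by fun_prop)
    (continuous_face_param (a := a) j 0).measurable]
  congr 1
  funext t
  simp

lemma ae_faceMeasure_zero (ha : LinearIndependent ℝ a) (j : Fin n) :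
    ∀ᵐ y ∂(faceMeasure a j 0), inner ℝ (dualVec a j) y = 0 := by
  rw [faceMeasure, ae_map_iff (continuous_face_param (a := a) j 0).measurable.aemeasurable
    (measurableSet_eq_fun (by fun_prop) (by fun_prop))]
  refine ae_of_all _ fun t => ?_
  simp only [Fin.coe_ofNat_eq_mod, Nat.zero_mod, Nat.cast_zero, zero_smul, zero_add, inner_sum]
  refine Finset.sum_eq_zero fun i _ => ?_
  rw [real_inner_smul_right, inner_dualVec ha, if_neg i.2, mul_zero]

lemma ae_cellMeasure_mem (a : Fin n → Space n) :
    ∀ᵐ x ∂(cellMeasure a), x ∈ parallelepiped a :=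
  ae_restrict_mem (isCompact_cell a).measurableSet

lemma ae_faceMeasure_mem_compact (a : Fin n → Space n) (j : Fin n) (s : Fin 2) :
    ∃ K, IsCompact K ∧ ∀ᵐ x ∂(faceMeasure a j s), x ∈ K := by
  have hc := continuous_face_param (a := a) j s
  have hK : IsCompact (Set.Icc (0 : {i : Fin n // i ≠ j} → ℝ) 1) := isCompact_Icc
  refine ⟨_, hK.image hc, ?_⟩
  rw [faceMeasure, ae_map_iff (p := fun y => y ∈ (fun t : {i : Fin n // i ≠ j} → ℝ =>
      ((s : ℕ) : ℝ) • a j + ∑ i : {i : Fin n // i ≠ j}, t i • a i) '' Set.Icc 0 1)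
    hc.measurable.aemeasurable (hK.image hc).measurableSet]
  filter_upwards [ae_restrict_mem measurableSet_Icc] with t ht
  exact ⟨t, ht, rfl⟩

lemma inner_dualVec_mem_Icc (ha : LinearIndependent ℝ a) (j : Fin n) {x : Space n}
    (hx : x ∈ parallelepiped a) : inner ℝ (dualVec a j) x ∈ Set.Icc (0 : ℝ) 1 := by
  obtain ⟨t, ht, rfl⟩ := (mem_parallelepiped_iff a x).1 hx
  have : inner ℝ (dualVec a j) (∑ i, t i • a i) = t j := by
    rw [inner_sum, Finset.sum_eq_single_of_mem j (Finset.mem_univ j), real_inner_smul_right,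
      inner_dualVec ha, if_pos rfl, mul_one]
    intro i _ hij
    rw [real_inner_smul_right, inner_dualVec ha, if_neg hij, mul_zero]
  rw [this]
  exact ⟨ht.1 j, ht.2 j⟩

lemma memLp_of_continuous {μ : Measure (Space n)} [IsFiniteMeasure μ] {K : Set (Space n)}
    (hK : IsCompact K) (hμ : ∀ᵐ x ∂μ, x ∈ K) {E : Type*} [NormedAddCommGroup E]
    [SecondCountableTopology E] {f : Space n → E} (hf : Continuous f) (p : ℝ≥0∞) :
    MemLp f p μ := by
  obtain ⟨C, hC⟩ := hK.exists_bound_of_continuousOn hf.continuousOn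
  exact MemLp.of_bound hf.aestronglyMeasurable C (hμ.mono fun x hx => hC x hx)

lemma memLp_cell {E : Type*} [NormedAddCommGroup E] [SecondCountableTopology E]
    {f : Space n → E} (hf : Continuous f) (p : ℝ≥0∞) : MemLp f p (cellMeasure a) :=
  memLp_of_continuous (isCompact_cell a) (ae_cellMeasure_mem a) hf p

lemma memLp_face {E : Type*} [NormedAddCommGroup E] [SecondCountableTopology E]
    {f : Space n → E} (hf : Continuous f) (p : ℝ≥0∞) (j : Fin n) (s : Fin 2) :
    MemLp f p (faceMeasure a j s) := by
  obtain ⟨K, hK, hm⟩ := ae_faceMeasure_mem_compact a j s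
  exact memLp_of_continuous hK hm hf p

/-- The fundamental theorem of calculus on the cell in the direction `aⱼ`. -/
lemma exists_integral_fderiv_cell (ha : LinearIndependent ℝ a) (j : Fin n) :
    ∃ c : ℝ, 0 < c ∧ ∀ (E : Type) [NormedAddCommGroup E] [NormedSpace ℝ E] [CompleteSpace E]
      [SecondCountableTopology E] (F : Space n → E), ContDiff ℝ 1 F →
      ∫ x, fderiv ℝ F x (a j) ∂(cellMeasure a) =
        c • ∫ y, (F (a j + y) - F y) ∂(faceMeasure a j 0) := by
  obtain ⟨c, h0, h1, hc⟩ := exists_cellMeasure_eq_smul_prod ha j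
  refine ⟨c.toReal, ENNReal.toReal_pos h0 h1, fun E _ _ _ _ F hF => ?_⟩
  have hcont : Continuous fun x => fderiv ℝ F x (a j) :=
    (hF.continuous_fderiv (by simp)).clm_apply continuous_const
  have hint := (memLp_cell (a := a) hcont 1).integrable le_rfl
  have hme : Measurable fun p : ℝ × Space n => p.1 • a j + p.2 := measurable_smul_add _
  rw [hc] at hint ⊢
  rw [integrable_smul_measure h0 h1, integrable_map_measure hcont.aestronglyMeasurable
    hme.aemeasurable] at hint
  rw [integral_smul_measure, integral_map hme.aemeasurable hcont.aestronglyMeasurable]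
  congr 1
  refine (integral_prod_symm _ hint).trans ?_
  refine integral_congr_ae (ae_of_all _ fun y => ?_)
  simp only [Function.comp_apply]
  rw [integral_Icc_eq_integral_Ioc, ← intervalIntegral.integral_of_le zero_le_one]
  have hder : ∀ s : ℝ, HasDerivAt (fun s : ℝ => F (s • a j + y))
      (fderiv ℝ F (s • a j + y) (a j)) s := fun s => by
    have h2 : HasDerivAt (fun s : ℝ => s • a j + y) ((1 : ℝ) • a j) s :=
      ((hasDerivAt_id s).smul_const (a j)).add_const y
    rw [one_smul] at h2
    exact ((hF.differentiable (by simp)) _).hasFDerivAt.comp_hasDerivAt s h2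
  rw [intervalIntegral.integral_eq_sub_of_hasDerivAt fun s _ => hder s]
  · simp
  · refine Continuous.intervalIntegrable ?_ _ _
    exact hcont.comp (by fun_prop)

end Geometry

/-! ### Integration by parts and traces -/

section Traces

variable {n m : ℕ} {a : Fin n → Space n}

lemma tendsto_integral_smul {μ : Measure (Space n)} {θ : Space n → ℝ} (hθ : MemLp θ 2 μ)
    {f : ℕ → Space n → Vec m} {g : Space n → Vec m} (hf : ∀ k, MemLp (f k) 2 μ) (hg : MemLp g 2 μ)
    (h : Tendsto (fun k => eLpNorm (fun x => f k x - g x) 2 μ) atTop (𝓝 0)) :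
    Tendsto (fun k => ∫ x, θ x • f k x ∂μ) atTop (𝓝 (∫ x, θ x • g x ∂μ)) := by
  have hi : ∀ {u : Space n → Vec m}, MemLp u 2 μ → Integrable (fun x => θ x • u x) μ :=
    fun hu => memLp_one_iff_integrable.1 (hu.smul (p := 2) (q := 2) (r := 1) hθ)
  refine tendsto_integral_of_L1' _ (hi hg).aestronglyMeasurable
    (Eventually.of_forall fun k => hi (hf k)) ?_
  have h2 : Tendsto (fun k => eLpNorm θ 2 μ * eLpNorm (fun x => f k x - g x) 2 μ) atTop (𝓝 0) := by
    simpa using ENNReal.Tendsto.const_mul h (Or.inr hθ.2.ne)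
  refine tendsto_of_tendsto_of_tendsto_of_le_of_le tendsto_const_nhds h2 (fun _ => zero_le)
    fun k => ?_
  simp only
  have h3 : ((fun x => θ x • f k x) - fun x => θ x • g x) = θ • fun x => f k x - g x := by
    funext x
    simp [smul_sub]
  rw [h3]
  exact eLpNorm_smul_le_mul_eLpNorm (p := 2) (q := 2) (r := 1) ((hf k).sub hg).1 hθ.1

lemma eq_sum_smul_single (v : Space n) : v = ∑ i, v i • EuclideanSpace.single i (1 : ℝ) := by
  ext l
  simp [Finset.sum_apply, Pi.single_apply]

lemma fderiv_eq_sum {E : Type*} [NormedAddCommGroup E] [NormedSpace ℝ E] (f : Space n → E)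
    (x v : Space n) :
    fderiv ℝ f x v = ∑ i, v i • fderiv ℝ f x (EuclideanSpace.single i 1) := by
  conv_lhs => rw [eq_sum_smul_single v]
  simp

lemma continuous_fderiv_apply {E : Type*} [NormedAddCommGroup E] [NormedSpace ℝ E]
    {f : Space n → E} (hf : ContDiff ℝ ∞ f) (w : Space n) : Continuous fun x => fderiv ℝ f x w :=
  (hf.continuous_fderiv (by simp)).clm_apply continuous_const

/-- A positive constant `c` with `∫_Q ∂_{aⱼ} F = c ∫ (F(aⱼ + y) - F(y))`, where `y` runs through the
face `∂Qⱼ⁰`. -/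
def fluxConst (ha : LinearIndependent ℝ a) (j : Fin n) : ℝ :=
  (exists_integral_fderiv_cell ha j).choose

lemma fluxConst_pos (ha : LinearIndependent ℝ a) (j : Fin n) : 0 < fluxConst ha j :=
  (exists_integral_fderiv_cell ha j).choose_spec.1

lemma integral_fderiv_cell (ha : LinearIndependent ℝ a) (j : Fin n) {E : Type}
    [NormedAddCommGroup E] [NormedSpace ℝ E] [CompleteSpace E] [SecondCountableTopology E]
    {F : Space n → E} (hF : ContDiff ℝ ∞ F) :
    ∫ x, fderiv ℝ F x (a j) ∂(cellMeasure a) =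
      fluxConst ha j • ∫ y, (F (a j + y) - F y) ∂(faceMeasure a j 0) :=
  (exists_integral_fderiv_cell ha j).choose_spec.2 E F (hF.of_le (by exact_mod_cast le_top))

lemma integral_smul_fderiv_cell (ha : LinearIndependent ℝ a) (j : Fin n) {θ : Space n → ℝ}
    {φ : Space n → Vec m} (hθ : ContDiff ℝ ∞ θ) (hφ : ContDiff ℝ ∞ φ) :
    ∫ x, fderiv ℝ θ x (a j) • φ x ∂(cellMeasure a) +
        ∑ i, a j i • ∫ x, θ x • fderiv ℝ φ x (EuclideanSpace.single i 1) ∂(cellMeasure a) =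
      fluxConst ha j • (∫ y, θ (a j + y) • φ (a j + y) ∂(faceMeasure a j 0) -
        ∫ y, θ y • φ y ∂(faceMeasure a j 0)) := by
  have hi : ∀ {f : Space n → Vec m}, Continuous f → Integrable f (cellMeasure a) := fun hf =>
    (memLp_cell hf 1).integrable le_rfl
  have hi' : ∀ {f : Space n → Vec m}, Continuous f → Integrable f (faceMeasure a j 0) := fun hf =>
    (memLp_face hf 1 j 0).integrable le_rfl
  have hc1 : Continuous fun x => fderiv ℝ θ x (a j) • φ x :=
    (continuous_fderiv_apply hθ _).smul hφ.continuous
  have hc2 : ∀ i, Continuous fun x => θ x • fderiv ℝ φ x (EuclideanSpace.single i 1) := fun i =>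
    hθ.continuous.smul (continuous_fderiv_apply hφ _)
  have hc3 : Continuous fun y => θ (a j + y) • φ (a j + y) :=
    (hθ.continuous.smul hφ.continuous).comp (by fun_prop : Continuous fun y => a j + y)
  have h := integral_fderiv_cell ha j (hθ.smul hφ)
  have hc4 : Continuous fun y => θ y • φ y := hθ.continuous.smul hφ.continuous
  rw [← integral_sub (hi' hc3) (hi' hc4)]
  refine Eq.trans ?_ h
  simp_rw [← integral_smul]
  have hi2 : ∀ i ∈ Finset.univ, Integrable
      (fun x => a j i • θ x • fderiv ℝ φ x (EuclideanSpace.single i 1)) (cellMeasure a) :=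
    fun i _ => (hi (hc2 i)).smul (a j i)
  rw [← integral_finsetSum _ hi2, ← integral_add (hi hc1) (integrable_finsetSum _ hi2)]
  refine integral_congr_ae (ae_of_all _ fun x => ?_)
  have hd := fderiv_smul (hθ.differentiable (by simp) x) (hφ.differentiable (by simp) x)
  have hd' : fderiv ℝ (θ • φ) x (a j) = θ x • fderiv ℝ φ x (a j) + fderiv ℝ θ x (a j) • φ x := by
    rw [hd]; simp
  simp only
  rw [hd', fderiv_eq_sum φ x (a j), Finset.smul_sum, add_comm]
  congr 1
  exact Finset.sum_congr rfl fun i _ => smul_comm _ _ _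

/-- The limit of the left-hand side of the integration by parts formula along a sequence
approximating `v` in `H¹`. -/
lemma tendsto_integral_smul_fderiv_cell (j : Fin n) {θ : Space n → ℝ} (hθ : ContDiff ℝ ∞ θ)
    {φ : ℕ → Space n → Vec m} (hφ : ∀ k, ContDiff ℝ ∞ (φ k)) {v : L2 a m}
    (h0 : Tendsto (fun k => eLpNorm (fun x => φ k x - v x) 2 (cellMeasure a)) atTop (𝓝 0))
    (h1 : ∀ i, Tendsto (fun k => eLpNorm
      (fun x => fderiv ℝ (φ k) x (EuclideanSpace.single i 1) - weakPartial i v x) 2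
        (cellMeasure a)) atTop (𝓝 0)) :
    Tendsto (fun k => ∫ x, fderiv ℝ θ x (a j) • φ k x ∂(cellMeasure a) +
      ∑ i, a j i • ∫ x, θ x • fderiv ℝ (φ k) x (EuclideanSpace.single i 1) ∂(cellMeasure a)) atTop
      (𝓝 (∫ x, fderiv ℝ θ x (a j) • v x ∂(cellMeasure a) +
        ∑ i, a j i • ∫ x, θ x • weakPartial i v x ∂(cellMeasure a))) := by
  refine (tendsto_integral_smul (memLp_cell (continuous_fderiv_apply hθ _) 2)
    (fun k => memLp_cell (hφ k).continuous 2) (Lp.memLp v) h0).add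
    (tendsto_finsetSum _ fun i _ => Tendsto.const_smul ?_ _)
  exact tendsto_integral_smul (memLp_cell hθ.continuous 2)
    (fun k => memLp_cell (continuous_fderiv_apply (hφ k) _) 2) (Lp.memLp _) (h1 i)

lemma eLpNorm_comp_add_face {f : Space n → Vec m} (j : Fin n)
    (hf : AEStronglyMeasurable f (faceMeasure a j 1)) :
    eLpNorm (fun y => f (a j + y)) 2 (faceMeasure a j 0) = eLpNorm f 2 (faceMeasure a j 1) := by
  rw [faceMeasure_one_eq_map] at hf ⊢
  exact (eLpNorm_map_measure hf (by fun_prop)).symm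

lemma memLp_comp_add_face {f : Space n → Vec m} (j : Fin n)
    (hf : MemLp f 2 (faceMeasure a j 1)) : MemLp (fun y => f (a j + y)) 2 (faceMeasure a j 0) := by
  rw [faceMeasure_one_eq_map] at hf
  exact (memLp_map_measure_iff hf.1 (by fun_prop)).1 hf

/-- Green's formula in the direction `aⱼ` with a weight vanishing on the face `∂Qⱼ⁰`. -/
lemma IsTrace.green_one (ha : LinearIndependent ℝ a) {j : Fin n} {v : L2 a m}
    {g : Space n → Vec m} (hg : IsTrace j 1 v g) {θ : Space n → ℝ} (hθ : ContDiff ℝ ∞ θ)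
    (h0 : ∀ᵐ y ∂(faceMeasure a j 0), θ y = 0) :
    ∫ x, fderiv ℝ θ x (a j) • v x ∂(cellMeasure a) +
        ∑ i, a j i • ∫ x, θ x • weakPartial i v x ∂(cellMeasure a) =
      fluxConst ha j • ∫ y, θ (a j + y) • g (a j + y) ∂(faceMeasure a j 0) := by
  obtain ⟨hgm, φ, hφ, h1, h2, h3⟩ := hg
  refine tendsto_nhds_unique (tendsto_integral_smul_fderiv_cell j hθ hφ h1 h2) ?_
  have hadd : Continuous fun y => a j + y := by fun_prop
  have : (fun k => ∫ x, fderiv ℝ θ x (a j) • φ k x ∂(cellMeasure a) +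
      ∑ i, a j i • ∫ x, θ x • fderiv ℝ (φ k) x (EuclideanSpace.single i 1) ∂(cellMeasure a)) =
      fun k => fluxConst ha j • ∫ y, θ (a j + y) • φ k (a j + y) ∂(faceMeasure a j 0) := by
    funext k
    rw [integral_smul_fderiv_cell ha j hθ (hφ k)]
    have : ∫ y, θ y • φ k y ∂(faceMeasure a j 0) = 0 := by
      rw [integral_congr_ae (g := fun _ => 0), integral_zero]
      filter_upwards [h0] with y hy
      rw [hy, zero_smul]
    rw [this, sub_zero]
  rw [this]
  refine Tendsto.const_smul ?_ _
  refine tendsto_integral_smul (memLp_face (hθ.continuous.comp hadd) 2 j 0)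
    (fun k => memLp_face ((hφ k).continuous.comp hadd) 2 j 0) (memLp_comp_add_face j hgm) ?_
  refine h3.congr fun k => ?_
  exact (eLpNorm_comp_add_face j ((memLp_face (hφ k).continuous 2 j 1).1.sub hgm.1)).symm

/-- Green's formula in the direction `aⱼ` with a weight vanishing on the face `∂Qⱼ¹`. -/
lemma IsTrace.green_zero (ha : LinearIndependent ℝ a) {j : Fin n} {v : L2 a m}
    {g : Space n → Vec m} (hg : IsTrace j 0 v g) {θ : Space n → ℝ} (hθ : ContDiff ℝ ∞ θ)
    (h0 : ∀ᵐ y ∂(faceMeasure a j 0), θ (a j + y) = 0) :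
    ∫ x, fderiv ℝ θ x (a j) • v x ∂(cellMeasure a) +
        ∑ i, a j i • ∫ x, θ x • weakPartial i v x ∂(cellMeasure a) =
      -(fluxConst ha j • ∫ y, θ y • g y ∂(faceMeasure a j 0)) := by
  obtain ⟨hgm, φ, hφ, h1, h2, h3⟩ := hg
  refine tendsto_nhds_unique (tendsto_integral_smul_fderiv_cell j hθ hφ h1 h2) ?_
  have : (fun k => ∫ x, fderiv ℝ θ x (a j) • φ k x ∂(cellMeasure a) +
      ∑ i, a j i • ∫ x, θ x • fderiv ℝ (φ k) x (EuclideanSpace.single i 1) ∂(cellMeasure a)) =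
      fun k => -(fluxConst ha j • ∫ y, θ y • φ k y ∂(faceMeasure a j 0)) := by
    funext k
    rw [integral_smul_fderiv_cell ha j hθ (hφ k)]
    have : ∫ y, θ (a j + y) • φ k (a j + y) ∂(faceMeasure a j 0) = 0 := by
      rw [integral_congr_ae (g := fun _ => 0), integral_zero]
      filter_upwards [h0] with y hy
      rw [hy, zero_smul]
    rw [this, zero_sub, smul_neg]
  rw [this]
  refine (Tendsto.const_smul ?_ _).neg
  exact tendsto_integral_smul (memLp_face hθ.continuous 2 j 0)
    (fun k => memLp_face (hφ k).continuous 2 j 0) hgm h3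

/-- Integration by parts in the direction `aⱼ` for a function with periodic traces, tested against
a periodic function: the contributions of the two faces cancel. The traces on the two faces come
from different approximating sequences, so Green's formula is applied on each face separately, with
the weights `tⱼ` and `1 - tⱼ`. -/
lemma integral_smul_weakPartial_of_periodic (ha : LinearIndependent ℝ a) {j : Fin n} {v : L2 a m}
    {g₀ g₁ : Space n → Vec m} (h₀ : IsTrace j 0 v g₀) (h₁ : IsTrace j 1 v g₁)
    (hg : ∀ᵐ x ∂(faceMeasure a j 1), g₁ x = g₀ (x - a j)) {ψ : Space n → ℝ}
    (hψ : ContDiff ℝ ∞ ψ) (hper : ∀ x, ψ (a j + x) = ψ x) :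
    ∑ i, a j i • ∫ x, ψ x • weakPartial i v x ∂(cellMeasure a) =
      -∫ x, fderiv ℝ ψ x (a j) • v x ∂(cellMeasure a) := by
  let t : Space n → ℝ := fun x => inner ℝ (dualVec a j) x
  have ht : ContDiff ℝ ∞ t := (innerSL ℝ (dualVec a j)).contDiff
  have ht0 : ∀ᵐ y ∂(faceMeasure a j 0), t y = 0 := ae_faceMeasure_zero ha j
  have ht1 : ∀ᵐ y ∂(faceMeasure a j 0), t (a j + y) = 1 := by
    filter_upwards [ht0] with y hy
    change inner ℝ (dualVec a j) (a j + y) = 1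
    rw [inner_add_right, inner_dualVec ha, if_pos rfl, show inner ℝ (dualVec a j) y = 0 from hy,
      add_zero]
  have hθ₁ : ContDiff ℝ ∞ fun x => t x * ψ x := ht.mul hψ
  have hθ₀ : ContDiff ℝ ∞ fun x => (1 - t x) * ψ x := (contDiff_const.sub ht).mul hψ
  have e₁ := h₁.green_one ha hθ₁ (by filter_upwards [ht0] with y hy; rw [hy, zero_mul])
  have e₀ := h₀.green_zero ha hθ₀ (by filter_upwards [ht1] with y hy; rw [hy, sub_self, zero_mul])
  have hb : ∫ y, (t (a j + y) * ψ (a j + y)) • g₁ (a j + y) ∂(faceMeasure a j 0) =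
      ∫ y, ((1 - t y) * ψ y) • g₀ y ∂(faceMeasure a j 0) := by
    rw [faceMeasure_one_eq_map] at hg
    refine integral_congr_ae ?_
    filter_upwards [ht0, ht1, ae_of_ae_map (by fun_prop) hg] with y hy hy1 hgy
    rw [hy, hy1, hgy, hper, one_mul, sub_zero, one_mul, add_sub_cancel_left]
  rw [hb] at e₁
  have e := congrArg₂ (· + ·) e₁ e₀
  simp only [add_neg_cancel] at e
  have hi : ∀ {θ : Space n → ℝ} (_ : Continuous θ) (u : L2 a m),
      Integrable (fun x => θ x • u x) (cellMeasure a) := fun hθ u =>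
    memLp_one_iff_integrable.1 ((Lp.memLp u).smul (p := 2) (q := 2) (r := 1) (memLp_cell hθ 2))
  rw [add_add_add_comm, ← Finset.sum_add_distrib,
    ← integral_add (hi (continuous_fderiv_apply hθ₁ _) _)
      (hi (continuous_fderiv_apply hθ₀ _) _)] at e
  simp_rw [← smul_add] at e
  simp_rw [← integral_add (hi hθ₁.continuous _) (hi hθ₀.continuous _)] at e
  rw [eq_neg_iff_add_eq_zero, ← e, add_comm]
  congr 1
  · refine integral_congr_ae (ae_of_all _ fun x => ?_)
    simp only
    rw [← add_smul, ← _root_.add_apply, ← fderiv_fun_add (hθ₁.differentiable (by simp) x)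
      (hθ₀.differentiable (by simp) x)]
    congr 4
    funext x
    ring
  · refine Finset.sum_congr rfl fun i _ => ?_
    congr 1
    refine integral_congr_ae (ae_of_all _ fun x => ?_)
    simp only
    rw [← add_smul]
    congr 1
    ring

lemma hasWeakPartial_toLp (i : Fin n) {φ : Space n → Vec m} (hφ : ContDiff ℝ ∞ φ) :
    HasWeakPartial a i ((memLp_cell (a := a) hφ.continuous 2).toLp φ)
      ((memLp_cell (a := a) (continuous_fderiv_apply hφ (EuclideanSpace.single i 1)) 2).toLp _) := by
  intro η h1 h2 h3
  have hc : ∀ {f : Space n → ℝ}, (∀ x, x ∉ tsupport η → f x = 0) → ∀ u : Space n → Vec m,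
      ∫ x, f x • u x ∂(cellMeasure a) = ∫ x, f x • u x := by
    intro f hf u
    refine setIntegral_eq_integral_of_forall_compl_eq_zero fun x hx => ?_
    rw [hf x fun h => hx (interior_subset (h3 h)), zero_smul]
  have hη0 : ∀ x, x ∉ tsupport η → η x = 0 := fun x => image_eq_zero_of_notMem_tsupport
  have hη1 : ∀ x, x ∉ tsupport η → fderiv ℝ η x (EuclideanSpace.single i 1) = 0 := fun x hx => by
    rw [image_eq_zero_of_notMem_tsupport fun h => hx (tsupport_fderiv_subset ℝ h)]
    simp
  have hs := hasCompactSupport_partial h2 (EuclideanSpace.single i 1)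
  have key := integral_smul_fderiv_eq_neg_fderiv_smul_of_integrable (μ := volume) (f := η) (g := φ)
    (v := EuclideanSpace.single i (1 : ℝ))
    ((continuous_partial h1 _).smul hφ.continuous |>.integrable_of_hasCompactSupport hs.smul_right)
    (h1.continuous.smul (continuous_fderiv_apply hφ _) |>.integrable_of_hasCompactSupport
      h2.smul_right)
    (h1.continuous.smul hφ.continuous |>.integrable_of_hasCompactSupport h2.smul_right)
    (fun x _ => h1.differentiable (by simp) x) (fun x _ => hφ.differentiable (by simp) x)
  have e1 : ∫ x, fderiv ℝ η x (EuclideanSpace.single i 1) •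
      ((memLp_cell (a := a) hφ.continuous 2).toLp φ) x ∂(cellMeasure a) =
      ∫ x, fderiv ℝ η x (EuclideanSpace.single i 1) • φ x := by
    rw [← hc hη1]
    refine integral_congr_ae ?_
    filter_upwards [(memLp_cell (a := a) hφ.continuous 2).coeFn_toLp] with x hx
    rw [hx]
  have e2 : ∫ x, η x • ((memLp_cell (a := a) (continuous_fderiv_apply hφ
      (EuclideanSpace.single i 1)) 2).toLp _) x ∂(cellMeasure a) =
      ∫ x, η x • fderiv ℝ φ x (EuclideanSpace.single i 1) := by
    rw [← hc hη0]
    refine integral_congr_ae ?_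
    filter_upwards [(memLp_cell (a := a) (continuous_fderiv_apply hφ
      (EuclideanSpace.single i 1)) 2).coeFn_toLp] with x hx
    rw [hx]
  rw [e1, e2, key, neg_neg]

lemma tendsto_eLpNorm_sub_of_tendsto_toLp {μ : Measure (Space n)} {f : ℕ → Space n → Vec m}
    (hf : ∀ k, MemLp (f k) 2 μ) {v : Lp (Vec m) 2 μ}
    (h : Tendsto (fun k => (hf k).toLp (f k)) atTop (𝓝 v)) :
    Tendsto (fun k => eLpNorm (fun x => f k x - v x) 2 μ) atTop (𝓝 0) := by
  refine ((Lp.tendsto_Lp_iff_tendsto_eLpNorm' _ _).1 h).congr fun k => ?_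
  refine eLpNorm_congr_ae ?_
  filter_upwards [(hf k).coeFn_toLp] with x hx
  rw [Pi.sub_apply, hx]

lemma HasWeakPartial.of_tendsto {i : Fin n} {u v : ℕ → L2 a m} {u' v' : L2 a m}
    (h : ∀ k, HasWeakPartial a i (u k) (v k)) (hu : Tendsto u atTop (𝓝 u'))
    (hv : Tendsto v atTop (𝓝 v')) : HasWeakPartial a i u' v' := by
  intro η h1 h2 h3
  have ht : ∀ {w : ℕ → L2 a m} {w' : L2 a m}, Tendsto w atTop (𝓝 w') → ∀ {θ : Space n → ℝ},
      Continuous θ → Tendsto (fun k => ∫ x, θ x • w k x ∂(cellMeasure a)) atTop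
        (𝓝 (∫ x, θ x • w' x ∂(cellMeasure a))) := fun hw θ hθ =>
    tendsto_integral_smul (memLp_cell hθ 2) (fun k => Lp.memLp _) (Lp.memLp _)
      ((Lp.tendsto_Lp_iff_tendsto_eLpNorm' _ _).1 hw)
  refine tendsto_nhds_unique (ht hu (continuous_partial h1 _)) ?_
  exact (ht hv h1.continuous).neg.congr fun k => (h k η h1 h2 h3).symm

lemma norm_sq_toLp {μ : Measure (Space n)} {f : Space n → Vec m} (hf : MemLp f 2 μ) :
    ‖hf.toLp f‖ ^ 2 = ∫ x, ‖f x‖ ^ 2 ∂μ := by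
  rw [← real_inner_self_eq_norm_sq, L2.inner_def]
  refine integral_congr_ae ?_
  filter_upwards [hf.coeFn_toLp] with x hx
  rw [hx, real_inner_self_eq_norm_sq]

/-- The trace inequality on the face `∂Qⱼ⁰`, obtained by integrating the derivative of
`(1 - tⱼ) |φ|²` in the direction `aⱼ`. -/
lemma fluxConst_mul_integral_face_le (ha : LinearIndependent ℝ a) (j : Fin n)
    {φ : Space n → Vec m} (hφ : ContDiff ℝ ∞ φ) :
    fluxConst ha j * ∫ y, ‖φ y‖ ^ 2 ∂(faceMeasure a j 0) ≤
      2 * ∫ x, ‖φ x‖ ^ 2 ∂(cellMeasure a) + ∫ x, ‖fderiv ℝ φ x (a j)‖ ^ 2 ∂(cellMeasure a) := by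
  let t : Space n → ℝ := fun x => inner ℝ (dualVec a j) x
  have ht : ContDiff ℝ ∞ t := (innerSL ℝ (dualVec a j)).contDiff
  have hN : ContDiff ℝ ∞ fun x => ‖φ x‖ ^ 2 := hφ.norm_sq ℝ
  let F : Space n → ℝ := fun x => (1 - t x) * ‖φ x‖ ^ 2
  have hF : ContDiff ℝ ∞ F := (contDiff_const.sub ht).mul hN
  have h := integral_fderiv_cell ha j hF
  have hface : ∫ y, (F (a j + y) - F y) ∂(faceMeasure a j 0) =
      -∫ y, ‖φ y‖ ^ 2 ∂(faceMeasure a j 0) := by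
    rw [← integral_neg]
    refine integral_congr_ae ?_
    filter_upwards [ae_faceMeasure_zero ha j] with y hy
    have hy' : t y = 0 := hy
    have hy1 : t (a j + y) = 1 := by
      change inner ℝ (dualVec a j) (a j + y) = 1
      rw [inner_add_right, inner_dualVec ha, if_pos rfl, hy, add_zero]
    simp only [F, hy', hy1]
    ring
  rw [hface, smul_eq_mul, mul_neg, eq_neg_iff_add_eq_zero] at h
  have h' : fluxConst ha j * ∫ y, ‖φ y‖ ^ 2 ∂(faceMeasure a j 0) =
      ∫ x, -fderiv ℝ F x (a j) ∂(cellMeasure a) := by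
    rw [integral_neg]
    linarith
  rw [h', ← integral_const_mul, ← integral_add]
  · refine integral_mono_ae ?_ ?_ ?_
    · exact ((memLp_cell (a := a) (continuous_fderiv_apply hF _) 1).integrable le_rfl).neg
    · exact (memLp_cell (by have := (continuous_fderiv_apply hφ (a j)); have := hφ.continuous; fun_prop)
        1).integrable le_rfl
    filter_upwards [ae_cellMeasure_mem a] with x hx
    have hd : fderiv ℝ F x (a j) =
        (1 - t x) * (2 * inner ℝ (φ x) (fderiv ℝ φ x (a j))) - ‖φ x‖ ^ 2 := by
      have e1 : HasFDerivAt t (innerSL ℝ (dualVec a j)) x :=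
        (innerSL ℝ (dualVec a j)).hasFDerivAt
      have e2 := ((hφ.differentiable (by simp) x).hasFDerivAt).norm_sq
      have e3 := (e1.const_sub 1).mul e2
      rw [show F = (fun x => 1 - t x) * fun x => ‖φ x‖ ^ 2 from rfl, e3.fderiv]
      simp [inner_dualVec ha]
      ring
    obtain ⟨h0, h1⟩ := inner_dualVec_mem_Icc ha j hx
    have hs := abs_le.1 (abs_real_inner_le_norm (φ x) (fderiv ℝ φ x (a j)))
    rw [hd]
    have h2 : |(1 - t x) * (2 * inner ℝ (φ x) (fderiv ℝ φ x (a j)))| ≤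
        2 * (‖φ x‖ * ‖fderiv ℝ φ x (a j)‖) := by
      rw [abs_mul, abs_mul, abs_two]
      have h3 : |1 - t x| ≤ 1 := abs_le.2 ⟨by simp only [t]; linarith, by simp only [t]; linarith⟩
      have h4 := abs_real_inner_le_norm (φ x) (fderiv ℝ φ x (a j))
      calc |1 - t x| * (2 * |inner ℝ (φ x) (fderiv ℝ φ x (a j))|)
          ≤ 1 * (2 * |inner ℝ (φ x) (fderiv ℝ φ x (a j))|) :=
            mul_le_mul_of_nonneg_right h3 (by positivity)
        _ ≤ _ := by linarith
    have h5 := (abs_le.1 h2).1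
    have h6 := two_mul_le_add_sq ‖φ x‖ ‖fderiv ℝ φ x (a j)‖
    linarith
  · exact ((memLp_cell (a := a) hN.continuous 1).integrable le_rfl).const_mul 2
  · exact (memLp_cell (by have := (continuous_fderiv_apply hφ (a j)); fun_prop) 1).integrable le_rfl

end Traces

section PeriodicTraces

variable {n m : ℕ} {a : Fin n → Space n}

lemma measurePreserving_sub_face (j : Fin n) :
    MeasurePreserving (fun x => x - a j) (faceMeasure a j 1) (faceMeasure a j 0) := by
  refine ⟨by fun_prop, ?_⟩
  rw [faceMeasure_one_eq_map, Measure.map_map (by fun_prop) (by fun_prop)]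
  convert! Measure.map_id
  funext y
  simp

lemma HasWeakPartial.of_tendsto_toLp {i : Fin n} {φ : ℕ → Space n → Vec m}
    (hφ : ∀ k, ContDiff ℝ ∞ (φ k)) {v w : L2 a m}
    (h0 : Tendsto (fun k => (memLp_cell (a := a) (hφ k).continuous 2).toLp (φ k)) atTop (𝓝 v))
    (h1 : Tendsto (fun k => (memLp_cell (a := a)
      (continuous_fderiv_apply (hφ k) (EuclideanSpace.single i 1)) 2).toLp _) atTop (𝓝 w)) :
    HasWeakPartial a i v w :=
  HasWeakPartial.of_tendsto (fun k => hasWeakPartial_toLp i (hφ k)) h0 h1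

/-- The restrictions to `∂Qⱼ⁰` of a sequence of smooth functions that converges in `H¹(Q)` form a
Cauchy sequence. -/
lemma cauchySeq_toLp_face (ha : LinearIndependent ℝ a) (j : Fin n) {φ : ℕ → Space n → Vec m}
    (hφ : ∀ k, ContDiff ℝ ∞ (φ k)) {v : L2 a m} {w : Fin n → L2 a m}
    (h0 : Tendsto (fun k => (memLp_cell (a := a) (hφ k).continuous 2).toLp (φ k)) atTop (𝓝 v))
    (h1 : ∀ i, Tendsto (fun k => (memLp_cell (a := a)
      (continuous_fderiv_apply (hφ k) (EuclideanSpace.single i 1)) 2).toLp _) atTop (𝓝 (w i))) :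
    CauchySeq fun k => (memLp_face (a := a) (hφ k).continuous 2 j 0).toLp (φ k) := by
  have hD : Tendsto (fun k => (memLp_cell (a := a) (continuous_fderiv_apply (hφ k) (a j)) 2).toLp _)
      atTop (𝓝 (∑ i, a j i • w i)) := by
    refine (tendsto_finsetSum Finset.univ fun i _ => (h1 i).const_smul (a j i)).congr fun k => ?_
    refine Lp.ext ?_
    have e1 : ∀ i, (((memLp_cell (a := a) (continuous_fderiv_apply (hφ k)
        (EuclideanSpace.single i 1)) 2).toLp _ : L2 a m) : Space n → Vec m) =ᵐ[cellMeasure a]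
        fun x => fderiv ℝ (φ k) x (EuclideanSpace.single i 1) := fun i => MemLp.coeFn_toLp _
    have e2 : ∀ i, ((a j i • (memLp_cell (a := a) (continuous_fderiv_apply (hφ k)
        (EuclideanSpace.single i 1)) 2).toLp _ : L2 a m) : Space n → Vec m) =ᵐ[cellMeasure a]
        fun x => a j i • fderiv ℝ (φ k) x (EuclideanSpace.single i 1) := fun i => by
      filter_upwards [e1 i, Lp.coeFn_smul (a j i) ((memLp_cell (a := a) (continuous_fderiv_apply
        (hφ k) (EuclideanSpace.single i 1)) 2).toLp _ : L2 a m)] with x hx hx'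
      rw [hx', Pi.smul_apply, hx]
    filter_upwards [ae_all_iff.2 e2, Lp.coeFn_finsetSum Finset.univ fun i => (a j i •
      (memLp_cell (a := a) (continuous_fderiv_apply (hφ k)
        (EuclideanSpace.single i 1)) 2).toLp _ : L2 a m),
      (memLp_cell (a := a) (continuous_fderiv_apply (hφ k) (a j)) 2).coeFn_toLp] with x hx hx' hx''
    rw [hx', hx'', fderiv_eq_sum, Finset.sum_apply]
    exact Finset.sum_congr rfl fun i _ => hx i
  have hX := (h0.prodMk_nhds hD).cauchySeq
  have hc := fluxConst_pos ha j
  rw [Metric.cauchySeq_iff'] at hX ⊢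
  intro ε hε
  obtain ⟨N, hN⟩ := hX (ε * √(fluxConst ha j / 3)) (by positivity)
  refine ⟨N, fun k hk => ?_⟩
  have h := hN k hk
  rw [Prod.dist_eq, max_lt_iff, dist_eq_norm, dist_eq_norm, ← MemLp.toLp_sub, ← MemLp.toLp_sub] at h
  rw [dist_eq_norm, ← MemLp.toLp_sub]
  have hs := fluxConst_mul_integral_face_le ha j ((hφ k).sub (hφ N))
  have hfd : ∀ x, fderiv ℝ (fun x => φ k x - φ N x) x (a j) =
      fderiv ℝ (φ k) x (a j) - fderiv ℝ (φ N) x (a j) := fun x => by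
    rw [fderiv_fun_sub ((hφ k).differentiable (by simp) x) ((hφ N).differentiable (by simp) x)]
    rfl
  simp only [hfd] at hs
  have e1 := norm_sq_toLp ((memLp_face (a := a) (hφ k).continuous 2 j 0).sub
    (memLp_face (a := a) (hφ N).continuous 2 j 0))
  have e2 := norm_sq_toLp ((memLp_cell (a := a) (hφ k).continuous 2).sub
    (memLp_cell (a := a) (hφ N).continuous 2))
  have e3 := norm_sq_toLp ((memLp_cell (a := a) (continuous_fderiv_apply (hφ k) (a j)) 2).sub
    (memLp_cell (a := a) (continuous_fderiv_apply (hφ N) (a j)) 2))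
  simp only [Pi.sub_apply] at e1 e2 e3
  rw [← e1, ← e2, ← e3] at hs
  have h4 : ∀ {r : ℝ}, 0 ≤ r → r < ε * √(fluxConst ha j / 3) →
      r ^ 2 < ε ^ 2 * (fluxConst ha j / 3) := fun hr0 hr => by
    have := pow_lt_pow_left₀ hr hr0 two_ne_zero
    rwa [mul_pow, Real.sq_sqrt (by positivity)] at this
  have h5 := h4 (norm_nonneg _) h.1
  have h6 := h4 (norm_nonneg _) h.2
  refine lt_of_pow_lt_pow_left₀ 2 hε.le ?_
  refine lt_of_mul_lt_mul_left (lt_of_le_of_lt hs ?_) hc.le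
  linarith

/-- Periodic smooth functions that converge in `H¹(Q)` have a limit with periodic traces. -/
lemma exists_periodic_isTrace (ha : LinearIndependent ℝ a) (j : Fin n) {φ : ℕ → Space n → Vec m}
    (hφ : ∀ k, ContDiff ℝ ∞ (φ k)) (hper : ∀ k x, φ k (x - a j) = φ k x) {v : L2 a m}
    {w : Fin n → L2 a m}
    (h0 : Tendsto (fun k => (memLp_cell (a := a) (hφ k).continuous 2).toLp (φ k)) atTop (𝓝 v))
    (h1 : ∀ i, Tendsto (fun k => (memLp_cell (a := a)
      (continuous_fderiv_apply (hφ k) (EuclideanSpace.single i 1)) 2).toLp _) atTop (𝓝 (w i))) :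
    ∃ g, IsTrace j 0 v g ∧ IsTrace j 1 v fun x => g (x - a j) := by
  obtain ⟨g, hg⟩ := cauchySeq_tendsto_of_complete (cauchySeq_toLp_face ha j hφ h0 h1)
  have ht := tendsto_eLpNorm_sub_of_tendsto_toLp
    (fun k => memLp_face (a := a) (hφ k).continuous 2 j 0) hg
  have ht0 := tendsto_eLpNorm_sub_of_tendsto_toLp
    (fun k => memLp_cell (a := a) (hφ k).continuous 2) h0
  have ht1 : ∀ i, Tendsto (fun k => eLpNorm (fun x => fderiv ℝ (φ k) x (EuclideanSpace.single i 1) -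
      weakPartial i v x) 2 (cellMeasure a)) atTop (𝓝 0) := fun i => by
    rw [weakPartial_eq (HasWeakPartial.of_tendsto_toLp hφ h0 (h1 i))]
    exact tendsto_eLpNorm_sub_of_tendsto_toLp
      (fun k => memLp_cell (a := a) (continuous_fderiv_apply (hφ k) _) 2) (h1 i)
  refine ⟨g, ⟨Lp.memLp g, φ, hφ, ht0, ht1, ht⟩,
    (Lp.memLp g).comp_measurePreserving (measurePreserving_sub_face j), φ, hφ, ht0, ht1, ?_⟩
  refine ht.congr fun k => ?_
  have := eLpNorm_comp_measurePreserving (p := 2) (g := fun x => φ k x - g x)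
    ((memLp_face (a := a) (hφ k).continuous 2 j 0).1.sub (Lp.memLp g).1)
    (measurePreserving_sub_face (a := a) j)
  rw [← this]
  refine eLpNorm_congr_ae (ae_of_all _ fun x => ?_)
  simp only [Function.comp_apply, hper]

end PeriodicTraces

/-! ### The real Fourier basis of the cell -/

section Fourier

variable {n m : ℕ} {a : Fin n → Space n}

/-- The point `2π ∑ kⱼ bⱼ` of the lattice dual to the one spanned by `a`. -/
def waveVec (a : Fin n → Space n) (k : Fin n → ℤ) : Space n :=
  (2 * Real.pi) • ∑ j, (k j : ℝ) • dualVec a j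

lemma waveVec_neg (k : Fin n → ℤ) : waveVec a (-k) = -waveVec a k := by
  simp [waveVec]

lemma waveVec_add (k l : Fin n → ℤ) : waveVec a (k + l) = waveVec a k + waveVec a l := by
  simp [waveVec, add_smul, Finset.sum_add_distrib]

lemma waveVec_zero : waveVec a 0 = 0 := by simp [waveVec]

lemma inner_waveVec (ha : LinearIndependent ℝ a) (k : Fin n → ℤ) (j : Fin n) :
    inner ℝ (waveVec a k) (a j) = k j * (2 * Real.pi) := by
  rw [waveVec, real_inner_smul_left, sum_inner, Finset.sum_eq_single_of_mem j (Finset.mem_univ j),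
    real_inner_smul_left, inner_dualVec ha, if_pos rfl]
  · ring
  · intro i _ hij
    rw [real_inner_smul_left, inner_dualVec ha, if_neg hij.symm, mul_zero]

lemma waveVec_apply (k : Fin n → ℤ) (i : Fin n) :
    waveVec a k i = ∑ j, k j * (2 * Real.pi) * dualVec a j i := by
  simp only [waveVec, PiLp.smul_apply, smul_eq_mul, WithLp.ofLp_sum, Finset.sum_apply,
    WithLp.ofLp_smul, Pi.smul_apply]
  rw [Finset.mul_sum]
  exact Finset.sum_congr rfl fun j _ => by ring

lemma waveVec_ne_zero (ha : LinearIndependent ℝ a) {k : Fin n → ℤ} (hk : k ≠ 0) :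
    waveVec a k ≠ 0 := by
  intro h
  obtain ⟨j, hj⟩ := Function.ne_iff.1 hk
  have h1 := inner_waveVec ha k j
  rw [h, inner_zero_left, eq_comm, mul_eq_zero] at h1
  rcases h1 with h1 | h1
  · exact hj (by exact_mod_cast h1)
  · exact (by positivity : (2 * Real.pi) ≠ 0) h1

/-- The Hartley wave `cos⟨ξ, x⟩ + sin⟨ξ, x⟩` with `ξ = waveVec a k`. These functions, indexed by all
`k ∈ ℤⁿ`, form a real orthogonal system on the cell, and partial derivatives map the wave with index
`k` to multiples of the wave with index `-k`. -/
def cas (a : Fin n → Space n) (k : Fin n → ℤ) (x : Space n) : ℝ :=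
  Real.cos (inner ℝ (waveVec a k) x) + Real.sin (inner ℝ (waveVec a k) x)

lemma contDiff_cas (k : Fin n → ℤ) : ContDiff ℝ ∞ (cas a k) := by
  have h : ContDiff ℝ ∞ fun x : Space n => inner ℝ (waveVec a k) x :=
    (innerSL ℝ (waveVec a k)).contDiff
  exact (Real.contDiff_cos.comp h).add (Real.contDiff_sin.comp h)

lemma hasFDerivAt_inner (v x : Space n) :
    HasFDerivAt (fun x : Space n => inner ℝ v x) (innerSL ℝ v) x :=
  (innerSL ℝ v).hasFDerivAt

lemma fderiv_cas (k : Fin n → ℤ) (x w : Space n) :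
    fderiv ℝ (cas a k) x w = inner ℝ (waveVec a k) w * cas a (-k) x := by
  have h := hasFDerivAt_inner (waveVec a k) x
  have h2 := (h.cos).add (h.sin)
  rw [show cas a k = (fun x => Real.cos (inner ℝ (waveVec a k) x)) +
    fun x => Real.sin (inner ℝ (waveVec a k) x) from rfl, h2.fderiv]
  simp [cas, waveVec_neg]
  ring

lemma inner_waveVec_add (ha : LinearIndependent ℝ a) (k : Fin n → ℤ) (j : Fin n) (x : Space n) :
    inner ℝ (waveVec a k) (a j + x) = inner ℝ (waveVec a k) x + k j * (2 * Real.pi) := by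
  rw [inner_add_right, inner_waveVec ha, add_comm]

/-- The integrand is a multiple of the derivative, along some `aⱼ` with `kⱼ ≠ 0`, of a periodic
function. -/
lemma integral_cos_waveVec (ha : LinearIndependent ℝ a) {k : Fin n → ℤ} (hk : k ≠ 0) :
    ∫ x, Real.cos (inner ℝ (waveVec a k) x) ∂(cellMeasure a) = 0 := by
  obtain ⟨j, hj⟩ := Function.ne_iff.1 hk
  have hs : ContDiff ℝ ∞ fun x : Space n => Real.sin (inner ℝ (waveVec a k) x) :=
    Real.contDiff_sin.comp (innerSL ℝ (waveVec a k)).contDiff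
  have h := integral_fderiv_cell ha j hs
  have h1 : ∀ x, fderiv ℝ (fun x : Space n => Real.sin (inner ℝ (waveVec a k) x)) x (a j) =
      (k j * (2 * Real.pi)) * Real.cos (inner ℝ (waveVec a k) x) := fun x => by
    rw [(hasFDerivAt_inner (waveVec a k) x).sin.fderiv]
    simp [inner_waveVec ha, mul_comm]
  simp only [h1, inner_waveVec_add ha, Real.sin_add_int_mul_two_pi, sub_self, integral_zero,
    smul_zero, integral_const_mul] at h
  refine (mul_eq_zero.1 h).resolve_left (mul_ne_zero ?_ (by positivity))
  exact_mod_cast hj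

lemma integral_sin_waveVec (ha : LinearIndependent ℝ a) (k : Fin n → ℤ) :
    ∫ x, Real.sin (inner ℝ (waveVec a k) x) ∂(cellMeasure a) = 0 := by
  rcases eq_or_ne k 0 with rfl | hk
  · simp [waveVec_zero]
  obtain ⟨j, hj⟩ := Function.ne_iff.1 hk
  have hs : ContDiff ℝ ∞ fun x : Space n => Real.cos (inner ℝ (waveVec a k) x) :=
    Real.contDiff_cos.comp (innerSL ℝ (waveVec a k)).contDiff
  have h := integral_fderiv_cell ha j hs
  have h1 : ∀ x, fderiv ℝ (fun x : Space n => Real.cos (inner ℝ (waveVec a k) x)) x (a j) =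
      -(k j * (2 * Real.pi)) * Real.sin (inner ℝ (waveVec a k) x) := fun x => by
    rw [(hasFDerivAt_inner (waveVec a k) x).cos.fderiv]
    simp [inner_waveVec ha, mul_comm]
  simp only [h1, inner_waveVec_add ha, Real.cos_add_int_mul_two_pi, sub_self, integral_zero,
    smul_zero, integral_const_mul] at h
  refine (mul_eq_zero.1 h).resolve_left (neg_ne_zero.2 (mul_ne_zero ?_ (by positivity)))
  exact_mod_cast hj

/-- Orthogonality of the Hartley waves, from `cas k * cas l = cos (k - l) + sin (k + l)`. -/
lemma integral_cas_mul_cas (ha : LinearIndependent ℝ a) (k l : Fin n → ℤ) :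
    ∫ x, cas a k x * cas a l x ∂(cellMeasure a) =
      if k = l then (cellMeasure a).real Set.univ else 0 := by
  have h : ∀ x, cas a k x * cas a l x = Real.cos (inner ℝ (waveVec a (k - l)) x) +
      Real.sin (inner ℝ (waveVec a (k + l)) x) := fun x => by
    rw [sub_eq_add_neg, waveVec_add, waveVec_add, waveVec_neg, inner_add_left, inner_add_left,
      inner_neg_left, ← sub_eq_add_neg, Real.cos_sub, Real.sin_add, cas, cas]
    ring
  have hi : ∀ {f : Space n → ℝ}, Continuous f → Integrable f (cellMeasure a) := fun hf =>
    (memLp_cell hf 1).integrable le_rfl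
  simp_rw [h]
  rw [integral_add (hi (by fun_prop)) (hi (by fun_prop)), integral_sin_waveVec ha, add_zero]
  split_ifs with hkl
  · simp [hkl, waveVec_zero]
  · exact integral_cos_waveVec ha (sub_ne_zero.2 hkl)

lemma cellMeasure_real_univ_pos (ha : LinearIndependent ℝ a) :
    0 < (cellMeasure a).real Set.univ := by
  refine ENNReal.toReal_pos ?_ (measure_ne_top _ _)
  obtain ⟨c, h0, -, hc⟩ := exists_cellMeasure_eq_smul_map ha
  rw [hc, Measure.smul_apply, smul_eq_mul, Measure.map_apply (by fun_prop) MeasurableSet.univ,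
    Set.preimage_univ, Measure.restrict_apply_univ, Real.volume_Icc_pi]
  simp [h0]

/-- The torus `ℝⁿ/ℤⁿ` with its Haar measure is mapped to the cell by a measurable map that
preserves the measure up to a factor and turns characters of the torus into plane waves. -/
lemma exists_torus_param (ha : LinearIndependent ℝ a) :
    ∃ (c : ℝ≥0∞) (τ : UnitAddTorus (Fin n) → Space n), c ≠ 0 ∧ c ≠ ⊤ ∧ Measurable τ ∧
      cellMeasure a =
        c • (Measure.pi fun _ : Fin n => (AddCircle.haarAddCircle : Measure UnitAddCircle)).map τ ∧
      ∀ k z, UnitAddTorus.mFourier (-k) z =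
        Complex.exp (-(inner ℝ (waveVec a k) (τ z) : ℝ) * Complex.I) := by
  obtain ⟨c, h0, h1, hc⟩ := exists_cellMeasure_eq_smul_map ha
  let e := UnitAddTorus.measurableEquivPiIoc (0 : Fin n → ℝ)
  have he : MeasurePreserving e
      (Measure.pi fun _ : Fin n => (AddCircle.haarAddCircle : Measure UnitAddCircle)) _ :=
    UnitAddTorus.measurePreserving_equivPiIoc (0 : Fin n → ℝ)
  have hms : MeasurableSet {x : Fin n → ℝ | ∀ i, x i ∈ Set.Ioc ((0 : Fin n → ℝ) i)
      ((0 : Fin n → ℝ) i + 1)} := MeasurableSet.univ_pi' fun i => measurableSet_Ioc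
  have hlm : Measurable fun t : Fin n → ℝ => ∑ i, t i • a i := by fun_prop
  refine ⟨c, fun z => ∑ i, (e z).1 i • a i, h0, h1, ?_, ?_, fun k z => ?_⟩
  · exact hlm.comp (measurable_subtype_coe.comp e.measurable)
  · rw [hc]
    congr 1
    have h2 : (fun z => ∑ i, (e z).1 i • a i) =
        (fun t : Fin n → ℝ => ∑ i, t i • a i) ∘ Subtype.val ∘ e := rfl
    rw [h2, ← Measure.map_map hlm (measurable_subtype_coe.comp e.measurable),
      ← Measure.map_map measurable_subtype_coe e.measurable, he.map_eq]
    refine Eq.trans ?_ (congrArg (Measure.map _) (map_comap_subtype_coe hms volume).symm)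
    congr 1
    refine Measure.restrict_congr_set ?_
    have h3 := Measure.univ_pi_Ioc_ae_eq_Icc (μ := fun _ : Fin n => (volume : Measure ℝ))
      (f := 0) (g := 1)
    refine (h3.symm.trans (Eventually.of_forall fun x => ?_))
    simp [Set.pi]
  · have h4 : ∀ i, z i = (((e z).1 i : ℝ) : UnitAddCircle) := fun i => by
      have := congrFun (e.symm_apply_apply z) i
      exact this.symm
    have h5 : ∀ i, fourier (-k i) (z i) =
        Complex.exp (-(k i * (2 * Real.pi) * (e z).1 i : ℝ) * Complex.I) := fun i => by
      rw [h4 i, fourier_coe_apply]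
      congr 1
      push_cast
      ring
    change ∏ i, fourier ((-k) i) (z i) = _
    simp only [Pi.neg_apply, h5]
    rw [← Complex.exp_sum]
    congr 1
    rw [inner_sum, ← Finset.sum_mul, Complex.ofReal_sum, ← Finset.sum_neg_distrib]
    congr 1
    refine Finset.sum_congr rfl fun i _ => ?_
    rw [real_inner_smul_right, inner_waveVec ha]
    push_cast
    ring

/-- Completeness of the trigonometric system on the cell, transported from the torus. -/
lemma ae_eq_zero_of_integral_trig (ha : LinearIndependent ℝ a) {f : Space n → ℝ}
    (hf : MemLp f 2 (cellMeasure a))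
    (hcos : ∀ k, ∫ x, Real.cos (inner ℝ (waveVec a k) x) * f x ∂(cellMeasure a) = 0)
    (hsin : ∀ k, ∫ x, Real.sin (inner ℝ (waveVec a k) x) * f x ∂(cellMeasure a) = 0) :
    f =ᵐ[cellMeasure a] 0 := by
  obtain ⟨c, τ, h0, h1, hτ, hc, hexp⟩ := exists_torus_param ha
  set μ : Measure (UnitAddTorus (Fin n)) :=
    Measure.pi fun _ : Fin n => (AddCircle.haarAddCircle : Measure UnitAddCircle) with hμ
  have hf' : MemLp f 2 (μ.map τ) := by
    rw [hc] at hf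
    exact (hf.smul_measure (c := c⁻¹) (ENNReal.inv_ne_top.2 h0)).mono_measure (by
      rw [smul_smul, ENNReal.inv_mul_cancel h0 h1, one_smul])
  have hF : MemLp (fun z => (f (τ z) : ℂ)) 2 μ :=
    ((memLp_map_measure_iff hf'.1 hτ.aemeasurable).1 hf').ofReal
  let F : Lp ℂ 2 μ := hF.toLp _
  have hcoef : ∀ k, UnitAddTorus.mFourierBasis.repr F k = 0 := fun k => by
    obtain ⟨k, rfl⟩ : ∃ l, k = l := ⟨k, rfl⟩
    rw [UnitAddTorus.mFourierBasis_repr]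
    have e1 : UnitAddTorus.mFourierCoeff F k =
        ∫ z, Complex.exp (-(inner ℝ (waveVec a k) (τ z) : ℝ) * Complex.I) * f (τ z) ∂μ := by
      refine integral_congr_ae ?_
      filter_upwards [hF.coeFn_toLp] with z hz
      rw [hz, hexp, smul_eq_mul]
    have hcont : Continuous fun x : Space n =>
      Complex.exp (-(inner ℝ (waveVec a k) x : ℝ) * Complex.I) := by fun_prop
    have e2 : ∫ z, Complex.exp (-(inner ℝ (waveVec a k) (τ z) : ℝ) * Complex.I) * f (τ z) ∂μ =
        ∫ x, Complex.exp (-(inner ℝ (waveVec a k) x : ℝ) * Complex.I) * f x ∂(μ.map τ) := by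
      rw [integral_map hτ.aemeasurable]
      exact hcont.aestronglyMeasurable.mul hf'.ofReal.1
    have e3 : ∫ x, Complex.exp (-(inner ℝ (waveVec a k) x : ℝ) * Complex.I) * f x
        ∂(cellMeasure a) = 0 := by
      have hi : ∀ {g : Space n → ℝ}, Continuous g →
          Integrable (fun x => g x * f x) (cellMeasure a) := fun hg =>
        memLp_one_iff_integrable.1 (hf.mul (p := 2) (q := 2) (r := 1) (memLp_cell hg 2))
      have e4 : ∀ x, Complex.exp (-(inner ℝ (waveVec a k) x : ℝ) * Complex.I) * f x =
          ((Real.cos (inner ℝ (waveVec a k) x) * f x : ℝ) : ℂ) -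
            ((Real.sin (inner ℝ (waveVec a k) x) * f x : ℝ) : ℂ) * Complex.I := fun x => by
        rw [← Complex.ofReal_neg, Complex.exp_ofReal_mul_I]
        simp
        ring
      simp_rw [e4]
      rw [integral_sub (hi (by fun_prop)).ofReal ((hi (by fun_prop)).ofReal.mul_const _),
        integral_mul_const, integral_complex_ofReal, integral_complex_ofReal, hcos, hsin]
      simp
    rw [e1, e2]
    rw [hc, integral_smul_measure] at e3
    exact (smul_eq_zero.1 e3).resolve_left (ENNReal.toReal_pos h0 h1).ne'
  have hF0 : F = 0 := by
    have : UnitAddTorus.mFourierBasis.repr F = 0 := by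
      ext k
      exact hcoef k
    simpa using this
  have h2 : ∀ᵐ z ∂μ, f (τ z) = 0 := by
    have h3 := hF.coeFn_toLp
    have h4 : (F : UnitAddTorus (Fin n) → ℂ) =ᵐ[μ] 0 := by rw [hF0]; exact Lp.coeFn_zero _ _ _
    filter_upwards [h3, h4] with z hz hz'
    have : (f (τ z) : ℂ) = 0 := hz.symm.trans hz'
    exact_mod_cast this
  have h5 : f =ᵐ[μ.map τ] 0 := by
    obtain ⟨g, hg, hfg⟩ := hf'.1
    have h6 : ∀ᵐ z ∂μ, g (τ z) = 0 := by
      filter_upwards [h2, ae_of_ae_map hτ.aemeasurable hfg] with z hz hz'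
      rw [← hz', hz]
    refine hfg.trans ?_
    exact (ae_map_iff hτ.aemeasurable (measurableSet_eq_fun hg.measurable measurable_const)).2 h6
  rw [hc]
  exact Measure.ae_smul_measure h5 c

end Fourier

/-! ### The Fourier basis of `L²(Q; ℝ²ᵐ)` -/

section WaveBasis

variable {n m : ℕ} {a : Fin n → Space n}

/-- The index set of the Fourier basis of `L²(Q; ℝ²ᵐ)`: a frequency in `ℤⁿ` and a direction in
`ℝ²ᵐ`. -/
abbrev WaveIndex (n m : ℕ) : Type := (Fin n → ℤ) × (Fin m × Fin 2)

/-- The Hartley wave with index `q.1` in the direction of the `q.2`-th vector of `b`, normalized in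
`L²(Q)`. -/
def wave (a : Fin n → Space n) (b : OrthonormalBasis (Fin m × Fin 2) ℝ (Vec m))
    (q : WaveIndex n m) (x : Space n) : Vec m :=
  ((√((cellMeasure a).real Set.univ))⁻¹ * cas a q.1 x) • b q.2

variable (b : OrthonormalBasis (Fin m × Fin 2) ℝ (Vec m))

lemma contDiff_wave (q : WaveIndex n m) : ContDiff ℝ ∞ (wave a b q) :=
  (contDiff_const.mul (contDiff_cas q.1)).smul contDiff_const

/-- Derivatives exchange the waves with indices `k` and `-k`. -/
lemma fderiv_wave (q : WaveIndex n m) (x w : Space n) :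
    fderiv ℝ (wave a b q) x w = (inner ℝ (waveVec a q.1) w) • wave a b (-q.1, q.2) x := by
  have h : DifferentiableAt ℝ (cas a q.1) x := (contDiff_cas q.1).differentiable (by simp) x
  have h1 := ((h.hasFDerivAt.const_mul (√((cellMeasure a).real Set.univ))⁻¹).smul_const
    (b q.2)).fderiv
  unfold wave
  rw [h1]
  simp only [ContinuousLinearMap.smulRight_apply, _root_.smul_apply, fderiv_cas, smul_smul,
    smul_eq_mul]
  congr 1
  ring

lemma cas_sub_period (ha : LinearIndependent ℝ a) (k : Fin n → ℤ) (j : Fin n) (x : Space n) :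
    cas a k (x - a j) = cas a k x := by
  rw [cas, cas, inner_sub_right, inner_waveVec ha, Real.cos_sub_int_mul_two_pi,
    Real.sin_sub_int_mul_two_pi]

lemma wave_sub_period (ha : LinearIndependent ℝ a) (q : WaveIndex n m) (j : Fin n) (x : Space n) :
    wave a b q (x - a j) = wave a b q x := by
  rw [wave, wave, cas_sub_period ha]

/-- The element of `L²(Q; ℝ²ᵐ)` given by `wave a b q`. -/
def waveLp (a : Fin n → Space n) (b : OrthonormalBasis (Fin m × Fin 2) ℝ (Vec m))
    (q : WaveIndex n m) : L2 a m :=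
  (memLp_cell (a := a) (contDiff_wave b q).continuous 2).toLp (wave a b q)

lemma coeFn_waveLp (q : WaveIndex n m) : waveLp a b q =ᵐ[cellMeasure a] wave a b q :=
  MemLp.coeFn_toLp _

lemma inner_waveLp_waveLp (ha : LinearIndependent ℝ a) (q r : WaveIndex n m) :
    inner ℝ (waveLp a b q) (waveLp a b r) = if q = r then 1 else 0 := by
  have hQ := cellMeasure_real_univ_pos ha
  have e : inner ℝ (waveLp a b q) (waveLp a b r) =
      ∫ x, (((cellMeasure a).real Set.univ)⁻¹ * inner ℝ (b q.2) (b r.2)) *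
        (cas a q.1 x * cas a r.1 x) ∂(cellMeasure a) := by
    rw [L2.inner_def]
    refine integral_congr_ae ?_
    filter_upwards [coeFn_waveLp b q, coeFn_waveLp b r] with x h1 h2
    rw [h1, h2, wave, wave, real_inner_smul_left, real_inner_smul_right]
    have hs : (√((cellMeasure a).real Set.univ))⁻¹ * (√((cellMeasure a).real Set.univ))⁻¹ =
        ((cellMeasure a).real Set.univ)⁻¹ := by
      rw [← mul_inv, Real.mul_self_sqrt hQ.le]
    rw [← hs]
    ring
  rw [e, integral_const_mul, integral_cas_mul_cas ha, orthonormal_iff_ite.1 b.orthonormal]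
  by_cases h1 : q.1 = r.1 <;> by_cases h2 : q.2 = r.2 <;>
    simp [h1, h2, Prod.ext_iff, hQ.ne']

lemma inner_waveLp (q : WaveIndex n m) (u : L2 a m) :
    inner ℝ (waveLp a b q) u =
      (√((cellMeasure a).real Set.univ))⁻¹ *
        inner ℝ (b q.2) (∫ x, cas a q.1 x • u x ∂(cellMeasure a)) := by
  have hi : Integrable (fun x => cas a q.1 x • u x) (cellMeasure a) :=
    memLp_one_iff_integrable.1 ((Lp.memLp u).smul (p := 2) (q := 2) (r := 1)
      (memLp_cell (contDiff_cas q.1).continuous 2))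
  rw [L2.inner_def, ← integral_inner hi, ← integral_const_mul]
  refine integral_congr_ae ?_
  filter_upwards [coeFn_waveLp b q] with x h1
  rw [h1, wave, real_inner_smul_left, real_inner_smul_right]
  ring

/-- Completeness of the waves: the cosines and sines are the even and odd parts of the Hartley
waves. -/
lemma eq_zero_of_inner_waveLp (ha : LinearIndependent ℝ a) {u : L2 a m}
    (h : ∀ q, inner ℝ (waveLp a b q) u = 0) : u = 0 := by
  have hQ := cellMeasure_real_univ_pos ha
  have hcasi : ∀ k, Integrable (fun x => cas a k x • u x) (cellMeasure a) := fun k =>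
    memLp_one_iff_integrable.1 ((Lp.memLp u).smul (p := 2) (q := 2) (r := 1)
      (memLp_cell (contDiff_cas k).continuous 2))
  have hcas : ∀ k p, ∫ x, cas a k x * inner ℝ (b p) (u x) ∂(cellMeasure a) = 0 := fun k p => by
    have h1 := h (k, p)
    rw [inner_waveLp] at h1
    have h2 := (mul_eq_zero.1 h1).resolve_left (by positivity)
    rw [← integral_inner (hcasi k)] at h2
    simpa only [real_inner_smul_right] using h2
  have hcas' : ∀ k p, Integrable (fun x => cas a k x * inner ℝ (b p) (u x)) (cellMeasure a) :=
    fun k p => by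
      simpa only [real_inner_smul_right] using (hcasi k).const_inner (𝕜 := ℝ) (b p)
  have key : ∀ p, (fun x => inner ℝ (b p) (u x)) =ᵐ[cellMeasure a] 0 := fun p => by
    refine ae_eq_zero_of_integral_trig ha ((Lp.memLp u).const_inner (b p)) (fun k => ?_) fun k => ?_
    · have e : ∀ x, Real.cos (inner ℝ (waveVec a k) x) * inner ℝ (b p) (u x) =
          2⁻¹ * (cas a k x * inner ℝ (b p) (u x) + cas a (-k) x * inner ℝ (b p) (u x)) :=
            fun x => by
        simp only [cas, waveVec_neg, inner_neg_left, Real.cos_neg, Real.sin_neg]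
        ring
      simp_rw [e]
      rw [integral_const_mul, integral_add (hcas' _ _) (hcas' _ _), hcas, hcas]
      simp
    · have e : ∀ x, Real.sin (inner ℝ (waveVec a k) x) * inner ℝ (b p) (u x) =
          2⁻¹ * (cas a k x * inner ℝ (b p) (u x) - cas a (-k) x * inner ℝ (b p) (u x)) :=
            fun x => by
        simp only [cas, waveVec_neg, inner_neg_left, Real.cos_neg, Real.sin_neg]
        ring
      simp_rw [e]
      rw [integral_const_mul, integral_sub (hcas' _ _) (hcas' _ _), hcas, hcas]
      simp
  refine Lp.ext ?_
  filter_upwards [ae_all_iff.2 key, Lp.coeFn_zero (Vec m) 2 (cellMeasure a)] with x hx h0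
  rw [h0, ← b.sum_repr' (u x)]
  refine Finset.sum_eq_zero fun p _ => ?_
  have := hx p
  simp only [Pi.zero_apply] at this
  rw [this, zero_smul]

/-- The waves form a Hilbert basis of `L²(Q; ℝ²ᵐ)`. -/
def waveBasis (ha : LinearIndependent ℝ a) (b : OrthonormalBasis (Fin m × Fin 2) ℝ (Vec m)) :
    HilbertBasis (WaveIndex n m) ℝ (L2 a m) :=
  HilbertBasis.mkOfOrthogonalEqBot (v := waveLp a b)
    (orthonormal_iff_ite.2 (inner_waveLp_waveLp b ha)) (by
      rw [Submodule.eq_bot_iff]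
      intro u hu
      refine eq_zero_of_inner_waveLp b ha fun q => ?_
      exact (Submodule.mem_orthogonal _ _).1 hu _ (Submodule.subset_span ⟨q, rfl⟩))

@[simp]
lemma waveBasis_apply (ha : LinearIndependent ℝ a) (q : WaveIndex n m) :
    waveBasis ha b q = waveLp a b q := by
  simp [waveBasis]

end WaveBasis

/-! ### The domain of the periodic Laplacian in terms of Fourier coefficients -/

section Domain

variable {n m : ℕ} {a : Fin n → Space n} (b : OrthonormalBasis (Fin m × Fin 2) ℝ (Vec m))

/-- The involution `(k, p) ↦ (-k, p)` of the index set of the waves. -/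
def negIndex (n m : ℕ) : WaveIndex n m ≃ WaveIndex n m :=
  (Equiv.neg _).prodCongr (Equiv.refl _)

@[simp] lemma negIndex_fst (q : WaveIndex n m) : (negIndex n m q).1 = -q.1 := rfl

@[simp] lemma negIndex_snd (q : WaveIndex n m) : (negIndex n m q).2 = q.2 := rfl

@[simp] lemma negIndex_negIndex (q : WaveIndex n m) : negIndex n m (negIndex n m q) = q := by
  simp [Prod.ext_iff]

/-- Fourier coefficients of a directional derivative along `aⱼ`, for a function with equal traces on
the two faces with index `j`. -/
lemma sum_inner_waveLp_weakPartial (ha : LinearIndependent ℝ a) {j : Fin n} {v : L2 a m}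
    {g₀ g₁ : Space n → Vec m} (h₀ : IsTrace j 0 v g₀) (h₁ : IsTrace j 1 v g₁)
    (hg : ∀ᵐ x ∂(faceMeasure a j 1), g₁ x = g₀ (x - a j)) (q : WaveIndex n m) :
    ∑ i, a j i * inner ℝ (waveLp a b q) (weakPartial i v) =
      -(q.1 j * (2 * Real.pi) * inner ℝ (waveLp a b (negIndex n m q)) v) := by
  have hper : ∀ x, cas a q.1 (a j + x) = cas a q.1 x := fun x => by
    rw [← cas_sub_period ha q.1 j (a j + x), add_sub_cancel_left]
  have h := integral_smul_weakPartial_of_periodic ha h₀ h₁ hg (contDiff_cas q.1) hper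
  simp_rw [fderiv_cas, inner_waveVec ha, mul_smul, integral_smul] at h
  have h2 := congrArg (fun y => (√((cellMeasure a).real Set.univ))⁻¹ * inner ℝ (b q.2) y) h
  simp only [inner_sum, inner_neg_right, real_inner_smul_right] at h2
  simp only [inner_waveLp, negIndex_fst, negIndex_snd]
  rw [Finset.mul_sum] at h2
  rw [Finset.sum_congr rfl fun i _ => mul_left_comm _ _ _, h2]
  ring

lemma memH1_sum {ι : Type*} (s : Finset ι) (c : ι → ℝ) {v : ι → L2 a m} (hv : ∀ i, MemH1 (v i)) :
    MemH1 (∑ i ∈ s, c i • v i) := by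
  classical
  induction s using Finset.induction_on with
  | empty => simpa using memH1_zero
  | insert i s hi ih => rw [Finset.sum_insert hi]; exact ((hv i).smul _).add ih

lemma weakPartial_sum {ι : Type*} (s : Finset ι) (c : ι → ℝ) {v : ι → L2 a m}
    (hv : ∀ i, MemH1 (v i)) (l : Fin n) :
    weakPartial l (∑ i ∈ s, c i • v i) = ∑ i ∈ s, c i • weakPartial l (v i) := by
  classical
  induction s using Finset.induction_on with
  | empty => simpa using weakPartial_zero l
  | insert i s hi ih =>
    rw [Finset.sum_insert hi, Finset.sum_insert hi,
      weakPartial_add ((hv i).smul _) (memH1_sum s c hv), weakPartial_smul _ (hv i), ih]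

lemma IsTrace.sum {ι : Type*} (t : Finset ι) (c : ι → ℝ) {v : ι → L2 a m}
    (hv : ∀ i, MemH1 (v i)) {j : Fin n} {s : Fin 2} {g : ι → Space n → Vec m}
    (hg : ∀ i, IsTrace j s (v i) (g i)) :
    IsTrace j s (∑ i ∈ t, c i • v i) (∑ i ∈ t, c i • g i) := by
  classical
  induction t using Finset.induction_on with
  | empty => simpa using IsTrace.zero j s
  | insert i t hi ih =>
    rw [Finset.sum_insert hi, Finset.sum_insert hi]
    exact ((hg i).smul _ (hv i)).add ((hv i).smul _) (memH1_sum t c hv) ih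

lemma toEuclideanLin_rotationMatrix_zero (y : Vec m) :
    Matrix.toEuclideanLin (rotationMatrix m 0) y = y := by
  have h : rotationMatrix m 0 = 1 := by
    rw [rotationMatrix]
    simp only [mul_zero, Real.cos_zero, Real.sin_zero, neg_zero]
    rw [← Matrix.one_fin_two, Matrix.one_kronecker_one]
  rw [h]
  simp

/-- On its domain the periodic Laplacian multiplies the Fourier coefficients by `|ξ|²`. The
Dirichlet conditions allow integrating by parts once and the Neumann conditions a second time. -/
lemma inner_waveLp_neg_weakLaplacian (ha : LinearIndependent ℝ a) {u : L2 a m}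
    (hu : u ∈ laplacianDomain a m 0) (q : WaveIndex n m) :
    inner ℝ (waveLp a b q) (-weakLaplacian u) =
      ‖waveVec a q.1‖ ^ 2 * inner ℝ (waveLp a b q) u := by
  obtain ⟨⟨hu1, hu2⟩, hbc⟩ := hu
  -- The Dirichlet conditions give the derivatives along all `aⱼ`; the dual basis recovers `∂ₗ`.
  have hd : ∀ j r, ∑ i, a j i * inner ℝ (waveLp a b r) (weakPartial i u) =
      -(r.1 j * (2 * Real.pi) * inner ℝ (waveLp a b (negIndex n m r)) u) := fun j r => by
    obtain ⟨⟨g₀, g₁, t₀, t₁, e⟩, -⟩ := hbc j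
    refine sum_inner_waveLp_weakPartial b ha t₀ t₁ ?_ r
    filter_upwards [e] with x hx
    rw [hx, Pi.zero_apply, toEuclideanLin_rotationMatrix_zero]
  have hw : ∀ l r, inner ℝ (waveLp a b r) (weakPartial l u) =
      -(waveVec a r.1 l * inner ℝ (waveLp a b (negIndex n m r)) u) := fun l r => by
    have h1 : ∑ j, dualVec a j l * ∑ i, a j i * inner ℝ (waveLp a b r) (weakPartial i u) =
        inner ℝ (waveLp a b r) (weakPartial l u) := by
      simp_rw [Finset.mul_sum, ← mul_assoc]
      rw [Finset.sum_comm]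
      simp_rw [← Finset.sum_mul, sum_dualVec_mul ha]
      simp
    rw [← h1, waveVec_apply, Finset.sum_mul, ← Finset.sum_neg_distrib]
    refine Finset.sum_congr rfl fun j _ => ?_
    rw [hd]
    ring
  -- On the faces with index `j`, the derivative of `u` in the direction of `dualVec a j` is a
  -- multiple of the normal derivative, so its traces are periodic in the direction `aⱼ` (only).
  have hN : ∀ j r, ∑ l, a j l * ∑ i, dualVec a j i *
        inner ℝ (waveLp a b r) (weakPartial l (weakPartial i u)) =
      -(r.1 j * (2 * Real.pi) * ∑ i, dualVec a j i *
        inner ℝ (waveLp a b (negIndex n m r)) (weakPartial i u)) := fun j r => by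
    obtain ⟨-, h₀, h₁, ⟨k₀, t₀, e₀⟩, ⟨k₁, t₁, e₁⟩, e⟩ := hbc j
    have T₀ := IsTrace.sum Finset.univ (fun i => dualVec a j i) hu2 t₀
    have T₁ := IsTrace.sum Finset.univ (fun i => dualVec a j i) hu2 t₁
    have := sum_inner_waveLp_weakPartial b ha T₀ T₁ ?_ r
    · simpa only [weakPartial_sum _ _ hu2, inner_sum, real_inner_smul_right] using this
    · filter_upwards [e, e₁, (measurePreserving_sub_face j).quasiMeasurePreserving.ae e₀]
        with x hx hx₁ hx₀
      rw [hx₁, hx₀, Pi.zero_apply, toEuclideanLin_rotationMatrix_zero] at hx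
      simp only [outwardNormal_eq] at hx
      simp only [PiLp.smul_apply, smul_eq_mul, mul_smul, ← Finset.smul_sum] at hx
      simp only [Finset.sum_apply, Pi.smul_apply]
      have hc : ‖faceHeight a j‖ ≠ 0 := norm_ne_zero_iff.2 (faceHeight_ne_zero ha j)
      simp only [if_true, one_smul, zero_ne_one, if_false, neg_smul, neg_neg] at hx
      exact smul_right_injective _ hc hx
  -- `Δ = ∑ⱼ ∂_{aⱼ} ∂_{dualVec a j}`.
  have h2 : ∑ j, ∑ l, a j l * ∑ i, dualVec a j i *
      inner ℝ (waveLp a b q) (weakPartial l (weakPartial i u)) =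
      inner ℝ (waveLp a b q) (weakLaplacian u) := by
    have h3 : ∀ j l, a j l * ∑ i, dualVec a j i *
        inner ℝ (waveLp a b q) (weakPartial l (weakPartial i u)) =
        ∑ i, (dualVec a j i * a j l) *
          inner ℝ (waveLp a b q) (weakPartial l (weakPartial i u)) := fun j l => by
      rw [Finset.mul_sum]
      exact Finset.sum_congr rfl fun i _ => by ring
    simp_rw [h3]
    rw [Finset.sum_comm, weakLaplacian, inner_sum]
    refine Finset.sum_congr rfl fun l _ => ?_
    rw [Finset.sum_comm]
    simp_rw [← Finset.sum_mul, sum_dualVec_mul ha]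
    simp
  rw [inner_neg_right, ← h2]
  simp_rw [hN, hw]
  rw [EuclideanSpace.real_norm_sq_eq, Finset.sum_mul, ← Finset.sum_neg_distrib]
  simp_rw [Finset.mul_sum, ← Finset.sum_neg_distrib]
  rw [Finset.sum_comm]
  refine Finset.sum_congr rfl fun i _ => ?_
  rw [sq, mul_assoc]
  generalize hc : waveVec a q.1 i * inner ℝ (waveLp a b q) u = c
  rw [waveVec_apply q.1, Finset.sum_mul]
  refine Finset.sum_congr rfl fun j _ => ?_
  rw [negIndex_negIndex, negIndex_fst, waveVec_neg, PiLp.neg_apply, neg_mul, neg_neg, hc]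
  ring

/-- Fourier coefficients of the form `-ξᵢ v̂(-ξ)` are those of the weak partial derivative of a
periodic function: the partial sums of the Fourier series are smooth and periodic, and converge in
`H¹(Q)`. -/
lemma hasWeakPartial_of_coeff (ha : LinearIndependent ℝ a) {v : L2 a m} {w : Fin n → L2 a m}
    (h : ∀ i q, inner ℝ (waveLp a b q) (w i) =
      -(waveVec a q.1 i * inner ℝ (waveLp a b (negIndex n m q)) v)) :
    (∀ i, HasWeakPartial a i v (w i)) ∧
      ∀ j, ∃ g, IsTrace j 0 v g ∧ IsTrace j 1 v fun x => g (x - a j) := by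
  obtain ⟨s, hs⟩ := Filter.exists_seq_tendsto (atTop : Filter (Finset (WaveIndex n m)))
  let φ : ℕ → Space n → Vec m := fun k x =>
    ∑ q ∈ s k, (inner ℝ (waveLp a b q) v : ℝ) • wave a b q x
  have hφ : ∀ k, ContDiff ℝ ∞ (φ k) := fun k =>
    ContDiff.sum fun q _ => (contDiff_wave b q).const_smul _
  have hsum : ∀ (t : Finset (WaveIndex n m)) (c : WaveIndex n m → ℝ) (r : WaveIndex n m →
      WaveIndex n m), ∀ᵐ x ∂(cellMeasure a), (∑ q ∈ t, c q • waveLp a b (r q) : L2 a m) x =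
      ∑ q ∈ t, c q • wave a b (r q) x := fun t c r => by
    have e1 : ∀ q, ∀ᵐ x ∂(cellMeasure a), (c q • waveLp a b (r q) : L2 a m) x =
        c q • wave a b (r q) x := fun q => by
      filter_upwards [Lp.coeFn_smul (c q) (waveLp a b (r q)), coeFn_waveLp b (r q)] with x h1 h2
      rw [h1, Pi.smul_apply, h2]
    filter_upwards [Lp.coeFn_finsetSum t fun q => (c q • waveLp a b (r q) : L2 a m),
      ae_all_iff.2 e1] with x h1 h2
    rw [h1, Finset.sum_apply]
    exact Finset.sum_congr rfl fun q _ => h2 q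
  have h0 : Tendsto (fun k => (memLp_cell (a := a) (hφ k).continuous 2).toLp (φ k)) atTop
      (𝓝 v) := by
    have h1 := ((waveBasis ha b).hasSum_repr v).comp hs
    refine h1.congr fun k => Lp.ext ?_
    simp only [Function.comp_apply, HilbertBasis.repr_apply_apply, waveBasis_apply]
    filter_upwards [hsum (s k) (fun q => inner ℝ (waveLp a b q) v) id,
      (memLp_cell (a := a) (hφ k).continuous 2).coeFn_toLp] with x h1 h2
    rw [h2]
    exact h1
  have h1 : ∀ i, Tendsto (fun k => (memLp_cell (a := a)
      (continuous_fderiv_apply (hφ k) (EuclideanSpace.single i 1)) 2).toLp _) atTop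
      (𝓝 (w i)) := fun i => by
    have h1 := ((negIndex n m).hasSum_iff.2 ((waveBasis ha b).hasSum_repr (w i))).comp hs
    refine h1.congr fun k => Lp.ext ?_
    simp only [Function.comp_apply, HilbertBasis.repr_apply_apply, waveBasis_apply, h,
      negIndex_negIndex, negIndex_fst, waveVec_neg, PiLp.neg_apply, neg_mul, neg_neg]
    filter_upwards [hsum (s k) (fun q => waveVec a q.1 i * inner ℝ (waveLp a b q) v) (negIndex n m),
      (memLp_cell (a := a) (continuous_fderiv_apply (hφ k)
        (EuclideanSpace.single i 1)) 2).coeFn_toLp] with x h1 h2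
    rw [h1, h2]
    have hd : HasFDerivAt (φ k) (∑ q ∈ s k, (inner ℝ (waveLp a b q) v : ℝ) •
        fderiv ℝ (wave a b q) x) x :=
      HasFDerivAt.fun_sum fun q _ =>
        (((contDiff_wave b q).differentiable (by simp) x).hasFDerivAt).fun_const_smul _
    rw [hd.fderiv, _root_.sum_apply]
    refine Finset.sum_congr rfl fun q _ => ?_
    rw [_root_.smul_apply, fderiv_wave, smul_smul, mul_comm]
    simp [EuclideanSpace.inner_single_right]
    rfl
  exact ⟨fun i => HasWeakPartial.of_tendsto_toLp hφ h0 (h1 i), fun j =>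
    exists_periodic_isTrace ha j hφ (fun k x => by simp only [φ, wave_sub_period b ha]) h0 h1⟩

lemma exists_inner_waveLp_eq (ha : LinearIndependent ℝ a) {c : WaveIndex n m → ℝ}
    (hc : Summable fun q => c q ^ 2) : ∃ u : L2 a m, ∀ q, inner ℝ (waveLp a b q) u = c q := by
  have hm : Memℓp c 2 := memℓp_gen (by simpa using hc)
  refine ⟨(waveBasis ha b).repr.symm ⟨c, hm⟩, fun q => ?_⟩
  rw [← waveBasis_apply b ha, ← HilbertBasis.repr_apply_apply, LinearIsometryEquiv.apply_symm_apply]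

lemma summable_inner_waveLp_sq (ha : LinearIndependent ℝ a) (u : L2 a m) :
    Summable fun q => inner ℝ (waveLp a b q) u ^ 2 := by
  have := (waveBasis ha b).summable_inner_mul_inner u u
  refine this.congr fun q => ?_
  rw [waveBasis_apply, real_inner_comm, sq]

/-- Elliptic regularity: if `|ξ|² v̂(ξ)` are the Fourier coefficients of a square integrable
function, then `v` lies in the domain of the periodic Laplacian. The first and second derivatives of
`v` are constructed from their Fourier coefficients. -/
lemma mem_laplacianDomain_of_coeff (ha : LinearIndependent ℝ a) {v f : L2 a m}
    (h : ∀ q, inner ℝ (waveLp a b q) f = ‖waveVec a q.1‖ ^ 2 * inner ℝ (waveLp a b q) v) :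
    v ∈ laplacianDomain a m 0 := by
  have hV := summable_inner_waveLp_sq b ha v
  have hF := summable_inner_waveLp_sq b ha f
  have hξ : ∀ k i, |waveVec a k i| ≤ ‖waveVec a k‖ := fun k i => by
    simpa using PiLp.norm_apply_le (waveVec a k) i
  have hw : ∀ i, ∃ w : L2 a m, ∀ q, inner ℝ (waveLp a b q) w =
      -(waveVec a q.1 i * inner ℝ (waveLp a b (negIndex n m q)) v) := fun i => by
    refine exists_inner_waveLp_eq b ha ?_
    -- `ξᵢ² v̂² ≤ (|ξ|² v̂)² + v̂²`.
    refine Summable.of_nonneg_of_le (fun q => sq_nonneg _) (fun q => ?_)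
      ((negIndex n m).summable_iff.2 (hF.add hV))
    simp only [Function.comp_apply, h, negIndex_fst, waveVec_neg, norm_neg]
    set y := inner ℝ (waveLp a b (negIndex n m q)) v
    have h1 : waveVec a q.1 i ^ 2 ≤ ‖waveVec a q.1‖ ^ 2 := sq_le_sq.2 (by simpa using hξ q.1 i)
    have h2 := mul_le_mul_of_nonneg_right h1 (sq_nonneg y)
    nlinarith [sq_nonneg (‖waveVec a q.1‖ ^ 2 * y - y), sq_nonneg (‖waveVec a q.1‖ ^ 2 * y),
      sq_nonneg y]
  choose w hw using hw
  have hz : ∀ i l, ∃ z : L2 a m, ∀ q, inner ℝ (waveLp a b q) z =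
      -(waveVec a q.1 l * inner ℝ (waveLp a b (negIndex n m q)) (w i)) := fun i l => by
    refine exists_inner_waveLp_eq b ha ?_
    refine Summable.of_nonneg_of_le (fun q => sq_nonneg _) (fun q => ?_) hF
    simp only [h, hw, negIndex_negIndex, negIndex_fst, waveVec_neg, PiLp.neg_apply]
    have h1 : |waveVec a q.1 l * waveVec a q.1 i| ≤ ‖waveVec a q.1‖ ^ 2 := by
      rw [abs_mul, sq]
      exact mul_le_mul (hξ _ _) (hξ _ _) (abs_nonneg _) (norm_nonneg _)
    set y := inner ℝ (waveLp a b q) v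
    have e : -(waveVec a q.1 l * -(-waveVec a q.1 i * y)) =
      -(waveVec a q.1 l * waveVec a q.1 i * y) := by ring
    rw [e, neg_sq, mul_pow, mul_pow _ y]
    exact mul_le_mul_of_nonneg_right (sq_le_sq.2 (h1.trans (le_abs_self _))) (sq_nonneg y)
  choose z hz using hz
  obtain ⟨hv1, hv2⟩ := hasWeakPartial_of_coeff b ha (fun i q => hw i q)
  have hvw : ∀ i, weakPartial i v = w i := fun i => weakPartial_eq (hv1 i)
  have hwz := fun i => hasWeakPartial_of_coeff b ha (fun l q => hz i l q)
  refine ⟨⟨fun i => by rw [hvw]; exact hv1 i, fun i l => ?_⟩, fun j => ⟨?_, ?_⟩⟩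
  · rw [hvw, weakPartial_eq ((hwz i).1 l)]
    exact (hwz i).1 l
  · obtain ⟨g, hg0, hg1⟩ := hv2 j
    refine ⟨g, _, hg0, hg1, ae_of_all _ fun x => ?_⟩
    rw [Pi.zero_apply, toEuclideanLin_rotationMatrix_zero]
  · choose g hg0 hg1 using fun i => (hwz i).2 j
    refine ⟨_, _, ⟨g, fun i => by rw [hvw]; exact hg0 i, .rfl⟩,
      ⟨_, fun i => by rw [hvw]; exact hg1 i, .rfl⟩, ae_of_all _ fun x => ?_⟩
    rw [Pi.zero_apply, toEuclideanLin_rotationMatrix_zero, ← Finset.sum_neg_distrib]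
    -- The outward normals of opposite faces differ by a sign.
    refine Finset.sum_congr rfl fun i _ => ?_
    simp [outwardNormal]

end Domain

/-! ### Operators that are diagonal in a Hilbert basis -/

section Diagonal

variable {H : Type*} [NormedAddCommGroup H] [InnerProductSpace ℝ H] {ι κ : Type*}

lemma eq_of_inner_hilbertBasis (B : HilbertBasis ι ℝ H) {x y : H}
    (h : ∀ q, inner ℝ (B q) x = inner ℝ (B q) y) : x = y := by
  refine B.repr.injective (lp.ext (funext fun q => ?_))
  rw [HilbertBasis.repr_apply_apply, HilbertBasis.repr_apply_apply, h]

lemma hasSum_inner_sq (B : HilbertBasis ι ℝ H) (x : H) :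
    HasSum (fun q => inner ℝ (B q) x ^ 2) (‖x‖ ^ 2) := by
  have h := B.hasSum_inner_mul_inner x x
  rw [real_inner_self_eq_norm_sq] at h
  refine h.congr_fun fun q => ?_
  rw [real_inner_comm, sq]

/-- An operator that is diagonal in a Hilbert basis, with eigenvalues tending to zero, is
compact: it is the limit in norm of its finite truncations. -/
lemma exists_compact_diagonal [CompleteSpace H] (B : HilbertBasis ι ℝ H) {g : ι → ℝ}
    (hg : Tendsto g cofinite (𝓝 0)) :
    ∃ G : H →L[ℝ] H, IsCompactOperator G ∧ ∀ q x, inner ℝ (B q) (G x) = g q * inner ℝ (B q) x := by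
  classical
  let T : ι → H →L[ℝ] H := fun q => g q • (innerSL ℝ (B q)).smulRight (B q)
  have hT : ∀ q x, T q x = (g q * inner ℝ (B q) x) • B q := fun q x => by
    simp [T, smul_smul]
  have hsum : Summable T := by
    rw [summable_iff_vanishing_norm]
    intro ε hε
    have hfin : {q | ¬ |g q| < ε / 2}.Finite := by
      have := hg.eventually (Metric.ball_mem_nhds (0 : ℝ) (half_pos hε))
      simpa [Filter.eventually_cofinite] using this
    refine ⟨hfin.toFinset, fun t ht => ?_⟩
    have ht' : ∀ q ∈ t, |g q| ≤ ε / 2 := fun q hq => by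
      by_contra hc
      exact (Finset.disjoint_left.1 ht hq) (hfin.mem_toFinset.2 fun h => hc h.le)
    refine lt_of_le_of_lt (ContinuousLinearMap.opNorm_le_bound _ (half_pos hε).le fun x => ?_)
      (half_lt_self hε)
    have h1 : ‖(∑ q ∈ t, T q) x‖ ^ 2 = ∑ q ∈ t, (g q * inner ℝ (B q) x) ^ 2 := by
      rw [_root_.sum_apply, ← real_inner_self_eq_norm_sq]
      simp only [hT]
      rw [B.orthonormal.inner_sum]
      exact Finset.sum_congr rfl fun q _ => by rw [sq]; rfl
    have h2 : ∑ q ∈ t, (g q * inner ℝ (B q) x) ^ 2 ≤ (ε / 2 * ‖x‖) ^ 2 := by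
      rw [mul_pow]
      refine le_trans ?_ (mul_le_mul_of_nonneg_left
        (B.orthonormal.sum_inner_products_le x (s := t)) (sq_nonneg _))
      rw [Finset.mul_sum]
      refine Finset.sum_le_sum fun q hq => ?_
      rw [mul_pow, Real.norm_eq_abs, sq_abs]
      exact mul_le_mul_of_nonneg_right (sq_le_sq.2 ((ht' q hq).trans (le_abs_self _)))
        (sq_nonneg _)
    exact le_of_sq_le_sq (h1.le.trans h2) (by positivity)
  refine ⟨∑' q, T q, ?_, fun q x => ?_⟩
  · refine isCompactOperator_of_tendsto hsum.hasSum (Eventually.of_forall fun t => ?_)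
    refine (compactOperator (RingHom.id ℝ) H H).sum_mem fun q _ => ?_
    refine (compactOperator (RingHom.id ℝ) H H).smul_mem (g q) ?_
    exact (isCompactOperator_of_locallyCompactSpace_dom (innerSL ℝ (B q))).clm_comp
      (ContinuousLinearMap.toSpanSingleton ℝ (B q))
  · have h1 := (hsum.hasSum.mapL (ContinuousLinearMap.apply ℝ H x)).mapL (innerSL ℝ (B q))
    refine h1.unique ?_
    have h2 := hasSum_single (f := fun r => innerSL ℝ (B q)
      (ContinuousLinearMap.apply ℝ H x (T r))) q fun r hr => by
        simp only [ContinuousLinearMap.apply_apply, hT, innerSL_apply_apply, real_inner_smul_right,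
          B.orthonormal.2 hr.symm, mul_zero]
    convert! h2 using 1
    simp only [ContinuousLinearMap.apply_apply, hT, innerSL_apply_apply, real_inner_smul_right,
      real_inner_self_eq_norm_sq, B.orthonormal.1 q]
    ring

/-- An operator that is diagonal in a Hilbert basis, with its maximal domain and with nonnegative
eigenvalues tending to infinity, has a compact reduced resolvent. -/
lemma exists_hasReducedResolvent_of_diagonal [CompleteSpace H] [Fintype κ] (B : HilbertBasis ι ℝ H)
    {A : H →ₗ.[ℝ] H} {μ : ι → ℝ} (hμ : ∀ q, 0 ≤ μ q) (htop : Tendsto μ cofinite atTop)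
    {i₀ : κ → ι} (hinj : Function.Injective i₀) (hzero : ∀ q, μ q = 0 ↔ q ∈ Set.range i₀)
    (hcoeff : ∀ (u : A.domain) q, inner ℝ (B q) (A u) = μ q * inner ℝ (B q) (u : H))
    (hdom : ∀ v f : H, (∀ q, inner ℝ (B q) f = μ q * inner ℝ (B q) v) → v ∈ A.domain) :
    ∃ (G : H →L[ℝ] H) (gap : ℝ), HasReducedResolvent A (fun k => B (i₀ k)) G gap := by
  classical
  have hg : Tendsto (fun q => (μ q)⁻¹) cofinite (𝓝 0) := tendsto_inv_atTop_zero.comp htop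
  obtain ⟨G, hGc, hG⟩ := exists_compact_diagonal B hg
  obtain ⟨C, hC⟩ := hg.bddAbove_range_of_cofinite
  have ho : Orthonormal ℝ fun k => B (i₀ k) := B.orthonormal.comp i₀ hinj
  have hP : ∀ q x, inner ℝ (B q) (finiteDiag (fun k => B (i₀ k)) 1 x) =
      if μ q = 0 then inner ℝ (B q) x else 0 := fun q x => by
    split_ifs with h
    · obtain ⟨k, rfl⟩ := (hzero q).1 h
      have := inner_finiteDiag ho 1 k x
      simpa using this
    · rw [finiteDiag_apply, inner_sum]
      refine Finset.sum_eq_zero fun k _ => ?_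
      rw [real_inner_smul_right, B.orthonormal.2, mul_zero]
      rintro rfl
      exact h ((hzero _).2 ⟨k, rfl⟩)
  -- The inverses of the eigenvalues are bounded by `C`, which yields the gap.
  have hgap : ∀ q, μ q ≠ 0 → (max C 1)⁻¹ ≤ μ q := fun q hq => by
    rw [inv_le_comm₀ (by positivity) (lt_of_le_of_ne (hμ q) hq.symm)]
    exact (hC ⟨q, rfl⟩).trans (le_max_left _ _)
  refine ⟨G, (max C 1)⁻¹, ?_⟩
  constructor
  · intro x y
    refine (B.hasSum_inner_mul_inner (A x) (y : H)).unique ?_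
    convert! B.hasSum_inner_mul_inner (x : H) (A y) using 2 with q
    rw [real_inner_comm, hcoeff, hcoeff, real_inner_comm (B q) (x : H)]
    ring
  · exact ho
  · intro k
    have h0 : ∀ q, μ q * inner ℝ (B q) (B (i₀ k)) = 0 := fun q => by
      by_cases hq : q = i₀ k
      · rw [(hzero q).2 ⟨k, hq.symm⟩, zero_mul]
      · rw [B.orthonormal.2 hq, mul_zero]
    refine ⟨hdom _ 0 fun q => by rw [h0, inner_zero_right], ?_⟩
    refine eq_of_inner_hilbertBasis B fun q => ?_
    rw [hcoeff, h0, inner_zero_right]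
  · intro x
    have h1 : ∀ q, inner ℝ (B q) (x - finiteDiag (fun k => B (i₀ k)) 1 x) =
        μ q * inner ℝ (B q) (G x) := fun q => by
      rw [inner_sub_right, hP, hG]
      split_ifs with h
      · simp [h]
      · field_simp; ring
    refine ⟨hdom _ _ h1, eq_of_inner_hilbertBasis B fun q => ?_⟩
    rw [hcoeff, h1]
  · intro x
    refine eq_of_inner_hilbertBasis B fun q => ?_
    rw [hP, hG, inner_zero_right]
    split_ifs with h
    · simp [h]
    · rfl
  · intro x
    refine eq_of_inner_hilbertBasis B fun q => ?_
    rw [hG, hcoeff, inner_sub_right, hP]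
    split_ifs with h
    · simp [h]
    · rw [inv_mul_cancel_left₀ h, sub_zero]
  · exact hGc
  · positivity
  · intro x
    have h1 := (hasSum_inner_sq B ((x : H) - finiteDiag (fun k => B (i₀ k)) 1 (x : H))).mul_left
      (max C 1)⁻¹
    have h2 := B.hasSum_inner_mul_inner (A x) (x : H)
    refine hasSum_le (fun q => ?_) h1 h2
    rw [real_inner_comm (B q) (A x), hcoeff, inner_sub_right, hP]
    split_ifs with h
    · simp [h]
    · rw [sub_zero, sq, mul_assoc]
      exact mul_le_mul_of_nonneg_right (hgap q h) (mul_self_nonneg _)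

end Diagonal

/-! ### The reduced resolvent of the periodic Laplacian -/

section Laplacian

variable {n m : ℕ} {a : Fin n → Space n} (b : OrthonormalBasis (Fin m × Fin 2) ℝ (Vec m))

lemma abs_le_norm_waveVec_mul (ha : LinearIndependent ℝ a) (k : Fin n → ℤ) (j : Fin n) :
    |(k j : ℝ)| ≤ ‖waveVec a k‖ * ‖a j‖ := by
  have h1 := abs_real_inner_le_norm (waveVec a k) (a j)
  rw [inner_waveVec ha, abs_mul, abs_of_pos Real.two_pi_pos] at h1
  refine le_trans ?_ h1
  exact le_mul_of_one_le_right (abs_nonneg _) (by linarith [Real.pi_gt_three])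

/-- Only finitely many points of the dual lattice lie in a given ball. -/
lemma tendsto_norm_waveVec_sq (ha : LinearIndependent ℝ a) :
    Tendsto (fun q : WaveIndex n m => ‖waveVec a q.1‖ ^ 2) cofinite atTop := by
  refine (tendsto_pow_atTop two_ne_zero).comp ?_
  rw [tendsto_atTop]
  intro c
  rw [eventually_cofinite]
  have hfin : (Set.Icc (fun j => -⌈c * ‖a j‖⌉) (fun j => ⌈c * ‖a j‖⌉) : Set (Fin n → ℤ)).Finite :=
    Set.finite_Icc _ _
  refine (hfin.prod (Set.finite_univ (α := Fin m × Fin 2))).subset fun q hq => ⟨?_, trivial⟩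
  have h : ∀ j, |q.1 j| ≤ ⌈c * ‖a j‖⌉ := fun j => by
    have h1 := abs_le_norm_waveVec_mul ha q.1 j
    have h2 : ‖waveVec a q.1‖ * ‖a j‖ ≤ c * ‖a j‖ :=
      mul_le_mul_of_nonneg_right (not_le.1 hq).le (norm_nonneg _)
    have h3 := (h1.trans h2).trans (Int.le_ceil _)
    exact_mod_cast h3
  exact ⟨fun j => (abs_le.1 (h j)).1, fun j => (abs_le.1 (h j)).2⟩

/-- The periodic Laplacian is diagonal in the basis of waves, and its kernel consists of the
constant functions. -/
lemma exists_hasReducedResolvent_negLaplacian (ha : LinearIndependent ℝ a) :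
    ∃ (G : L2 a m →L[ℝ] L2 a m) (gap : ℝ),
      HasReducedResolvent (negLaplacian a m 0) (fun p => waveLp a b (0, p)) G gap := by
  have h := exists_hasReducedResolvent_of_diagonal (waveBasis ha b) (A := negLaplacian a m 0)
    (μ := fun q => ‖waveVec a q.1‖ ^ 2) (i₀ := fun p => (0, p)) (fun q => sq_nonneg _)
    (tendsto_norm_waveVec_sq ha) (fun p r hpr => (Prod.ext_iff.1 hpr).2) ?_ ?_ ?_
  · simpa only [waveBasis_apply] using h
  · intro q
    rw [sq_eq_zero_iff, norm_eq_zero]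
    refine ⟨fun h => ⟨q.2, Prod.ext ?_ rfl⟩, ?_⟩
    · by_contra hq
      exact waveVec_ne_zero ha (Ne.symm hq) h
    · rintro ⟨p, rfl⟩
      exact waveVec_zero
  · intro u q
    rw [waveBasis_apply]
    exact inner_waveLp_neg_weakLaplacian b ha u.2 q
  · intro v f h
    simp only [waveBasis_apply] at h
    exact mem_laplacianDomain_of_coeff b ha h

end Laplacian

/-! ### Multiplication by bounded matrix-valued functions -/

section Multiplication

variable {n m : ℕ} {a : Fin n → Space n}

/-- The operator `M ⊗ I₂` on `ℝ²ᵐ`, as a linear function of `M`. -/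
def kroneckerCLM (m : ℕ) : Matrix (Fin m) (Fin m) ℝ →ₗ[ℝ] Vec m →L[ℝ] Vec m where
  toFun M := Matrix.toEuclideanCLM (𝕜 := ℝ) (M ⊗ₖ (1 : Matrix (Fin 2) (Fin 2) ℝ))
  map_add' M N := by rw [Matrix.add_kronecker, map_add]
  map_smul' c M := by rw [Matrix.smul_kronecker, map_smul, RingHom.id_apply]

lemma kroneckerCLM_apply (M : Matrix (Fin m) (Fin m) ℝ) (y : Vec m) :
    kroneckerCLM m M y = Matrix.toEuclideanLin (M ⊗ₖ (1 : Matrix (Fin 2) (Fin 2) ℝ)) y := by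
  rw [← Matrix.coe_toEuclideanCLM_eq_toEuclideanLin]
  rfl

lemma continuous_kroneckerCLM : Continuous (kroneckerCLM m) :=
  LinearMap.continuous_of_finiteDimensional _

lemma inner_kroneckerCLM {M : Matrix (Fin m) (Fin m) ℝ} (hM : Mᵀ = M) (x y : Vec m) :
    inner ℝ (kroneckerCLM m M x) y = inner ℝ x (kroneckerCLM m M y) := by
  have h : (M ⊗ₖ (1 : Matrix (Fin 2) (Fin 2) ℝ)).IsHermitian := by
    rw [Matrix.IsHermitian, Matrix.conjTranspose_eq_transpose_of_trivial,
      ← Matrix.kroneckerMap_transpose, hM, Matrix.transpose_one]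
  rw [kroneckerCLM_apply, kroneckerCLM_apply]
  exact (Matrix.isSymmetric_toEuclideanLin_iff.2 h) x y

lemma aestronglyMeasurable_kroneckerCLM {μ : Measure (Space n)}
    {V : Space n → Matrix (Fin m) (Fin m) ℝ}
    (hV : ∀ i j, AEStronglyMeasurable (fun x => V x i j) μ) :
    AEStronglyMeasurable (fun x => kroneckerCLM m (V x)) μ := by
  have h : ∀ x, kroneckerCLM m (V x) =
      ∑ i, ∑ j, V x i j • kroneckerCLM m (Matrix.single i j 1) := fun x => by
    conv_lhs => rw [Matrix.matrix_eq_sum_single (V x)]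
    simp only [map_sum, ← map_smul, Matrix.smul_single, smul_eq_mul, mul_one]
  simp_rw [h]
  exact Finset.aestronglyMeasurable_fun_sum _ fun i _ =>
    Finset.aestronglyMeasurable_fun_sum _ fun j _ => (hV i j).smul_const _

/-- Multiplication by a bounded operator-valued function is a bounded operator on `L²`. -/
lemma exists_multiplication {F : Space n → Vec m →L[ℝ] Vec m} {C : ℝ}
    (hF : AEStronglyMeasurable F (cellMeasure a)) (hC : ∀ᵐ x ∂(cellMeasure a), ‖F x‖ ≤ C) :
    ∃ T : L2 a m →L[ℝ] L2 a m, ∀ u : L2 a m, T u =ᵐ[cellMeasure a] fun x => F x (u x) := by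
  have hb : ∀ u : L2 a m, ∀ᵐ x ∂(cellMeasure a), ‖F x (u x)‖ ≤ C * ‖u x‖ := fun u => by
    filter_upwards [hC] with x hx
    exact (F x).le_of_opNorm_le hx _
  have hm : ∀ u : L2 a m, MemLp (fun x => F x (u x)) 2 (cellMeasure a) := fun u =>
    (Lp.memLp u).of_le_mul (isBoundedBilinearMap_apply.continuous.comp_aestronglyMeasurable
      (hF.prodMk (Lp.aestronglyMeasurable u))) (hb u)
  let T : L2 a m →ₗ[ℝ] L2 a m :=
    { toFun := fun u => (hm u).toLp _
      map_add' := fun u v => by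
        refine Lp.ext ?_
        filter_upwards [(hm u).coeFn_toLp, (hm v).coeFn_toLp, (hm (u + v)).coeFn_toLp,
          Lp.coeFn_add u v, Lp.coeFn_add ((hm u).toLp _) ((hm v).toLp _)] with x h1 h2 h3 h4 h5
        rw [h3, h5, Pi.add_apply, h1, h2, h4, Pi.add_apply, map_add]
      map_smul' := fun c u => by
        refine Lp.ext ?_
        filter_upwards [(hm u).coeFn_toLp, (hm (c • u)).coeFn_toLp, Lp.coeFn_smul c u,
          Lp.coeFn_smul c ((hm u).toLp _)] with x h1 h2 h3 h4
        rw [h2, RingHom.id_apply, h4, Pi.smul_apply, h1, h3, Pi.smul_apply, map_smul] }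
  refine ⟨T.mkContinuous C fun u => Lp.norm_le_mul_norm_of_ae_le_mul ?_, fun u =>
    (hm u).coeFn_toLp⟩
  filter_upwards [(hm u).coeFn_toLp, hb u] with x h1 h2
  exact (congrArg norm h1).le.trans h2

lemma norm_sub_le_of_multiplication {F G : Space n → Vec m →L[ℝ] Vec m} {S T : L2 a m →L[ℝ] L2 a m}
    (hS : ∀ u : L2 a m, S u =ᵐ[cellMeasure a] fun x => F x (u x))
    (hT : ∀ u : L2 a m, T u =ᵐ[cellMeasure a] fun x => G x (u x)) {ε : ℝ} (hε : 0 ≤ ε)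
    (h : ∀ᵐ x ∂(cellMeasure a), ‖F x - G x‖ ≤ ε) : ‖S - T‖ ≤ ε := by
  refine ContinuousLinearMap.opNorm_le_bound _ hε fun u => Lp.norm_le_mul_norm_of_ae_le_mul ?_
  filter_upwards [h, hS u, hT u, Lp.coeFn_sub (S u) (T u)] with x h1 h2 h3 h4
  rw [_root_.sub_apply, h4, Pi.sub_apply, h2, h3, ← _root_.sub_apply]
  exact (F x - G x).le_of_opNorm_le h1 _

lemma inner_multiplication {F : Space n → Vec m →L[ℝ] Vec m} {T : L2 a m →L[ℝ] L2 a m}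
    (hT : ∀ u : L2 a m, T u =ᵐ[cellMeasure a] fun x => F x (u x))
    (hF : ∀ᵐ x ∂(cellMeasure a), ∀ y z, inner ℝ (F x y) z = inner ℝ y (F x z)) (u v : L2 a m) :
    inner ℝ (T u) v = inner ℝ u (T v) := by
  rw [L2.inner_def, L2.inner_def]
  refine integral_congr_ae ?_
  filter_upwards [hT u, hT v, hF] with x h1 h2 h3
  rw [h1, h2, h3]

/-! ### The rescaled potential -/

lemma smul_mem_cell {x : Space n} (hx : x ∈ parallelepiped a) {t : ℝ} (h0 : 0 ≤ t) (h1 : t ≤ 1) :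
    t • x ∈ parallelepiped a := by
  have hc : Convex ℝ (parallelepiped a) := by
    rw [parallelepiped_eq_convexHull]; exact convex_convexHull ℝ _
  have h0' : (0 : Space n) ∈ parallelepiped a := ⟨0, by simp, by simp⟩
  exact hc.smul_mem_of_zero_mem h0' hx ⟨h0, h1⟩

lemma quasiMeasurePreserving_smul_cell {t : ℝ} (h0 : 0 < t) (h1 : t ≤ 1) :
    Measure.QuasiMeasurePreserving (fun x : Space n => t • x) (cellMeasure a) (cellMeasure a) := by
  refine Measure.QuasiMeasurePreserving.restrict ⟨by fun_prop, ?_⟩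
    fun x hx => smul_mem_cell hx h0.le h1
  rw [Measure.map_addHaar_smul volume h0.ne']
  exact Measure.smul_absolutelyContinuous

/-- Properties that hold near the vertex `0` of the cell hold on the whole cell after scaling. -/
lemma exists_forall_smul_mem {P : Space n → Prop} (h : ∀ᶠ y in 𝓝[parallelepiped a] 0, P y) :
    ∃ δ : ℝ, 0 < δ ∧ δ ≤ 1 ∧ ∀ t, 0 < t → t < δ → ∀ x ∈ parallelepiped a, P (t • x) := by
  obtain ⟨r, hr, hP⟩ := Metric.mem_nhdsWithin_iff.1 h
  obtain ⟨R, hR, hb⟩ := (isCompact_cell a).isBounded.exists_pos_norm_le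
  refine ⟨min 1 (r / R), by positivity, min_le_left _ _, fun t h0 ht x hx => hP ⟨?_, ?_⟩⟩
  · rw [mem_ball_zero_iff, norm_smul, Real.norm_of_nonneg h0.le]
    calc t * ‖x‖ ≤ t * R := by gcongr; exact hb x hx
      _ < r := (lt_div_iff₀ hR).1 (ht.trans_le (min_le_right _ _))
  · exact smul_mem_cell hx h0.le (ht.le.trans (min_le_left _ _))

/-- The cell has positive measure near `0`, so the symmetry of `V` almost everywhere passes to the
limit `V 0`. -/
lemma transpose_eq_of_continuousWithinAt (ha : LinearIndependent ℝ a)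
    {V : Space n → Matrix (Fin m) (Fin m) ℝ} (hsymm : ∀ᵐ x ∂(cellMeasure a), (V x)ᵀ = V x)
    (hcont : ContinuousWithinAt V (parallelepiped a) 0) : (V 0)ᵀ = V 0 := by
  have hcl : IsClosed {M : Matrix (Fin m) (Fin m) ℝ | Mᵀ = M} :=
    isClosed_eq (by fun_prop) continuous_id
  refine hcl.mem_of_frequently_of_tendsto (fun h => ?_) hcont
  obtain ⟨δ, h0, h1, hδ⟩ := exists_forall_smul_mem h
  have hfalse : ∀ᵐ x ∂(cellMeasure a), False := by
    filter_upwards [(quasiMeasurePreserving_smul_cell (a := a) (half_pos h0)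
      (by linarith)).ae hsymm, ae_cellMeasure_mem a] with x hx hxQ
    exact hδ _ (half_pos h0) (half_lt_self h0) x hxQ hx
  have hpos := cellMeasure_real_univ_pos ha
  have hz : cellMeasure a Set.univ = 0 := by simpa [ae_iff] using hfalse
  rw [Measure.real, hz] at hpos
  exact lt_irrefl _ hpos

/-- The Schrödinger operator is the Laplacian plus `t²` times the bounded operator of multiplication
by `V(t x) ⊗ I₂`. -/
lemma schrodinger_eq_addBounded {V : Space n → Matrix (Fin m) (Fin m) ℝ} {t : ℝ}
    {W : L2 a m →L[ℝ] L2 a m}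
    (hW : ∀ u : L2 a m, W u =ᵐ[cellMeasure a] fun x => kroneckerCLM m (V (t • x)) (u x)) :
    schrodinger a 0 V t = addBounded (negLaplacian a m 0) (t ^ 2 • W) := by
  have hpt : ∀ u : L2 a m, (t ^ 2 • W) u =ᵐ[cellMeasure a]
      fun x => Matrix.toEuclideanLin (rescaledPotential V t x) (u x) := fun u => by
    filter_upwards [hW u, Lp.coeFn_smul (t ^ 2) (W u)] with x h1 h2
    rw [_root_.smul_apply, h2, Pi.smul_apply, h1, kroneckerCLM_apply, rescaledPotential,
      Matrix.smul_kronecker, map_smul]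
    rfl
  have hdom : ∀ u : L2 a m, u ∈ multiplicationDomain a m (rescaledPotential V t) := fun u =>
    (Lp.memLp ((t ^ 2 • W) u)).ae_eq (hpt u)
  refine LinearPMap.ext ?_ fun x hf hg => ?_
  · exact inf_eq_left.2 fun u _ => hdom u
  · refine Eq.trans ?_ (addBounded_apply (negLaplacian a m 0) (t ^ 2 • W) ⟨x, hg⟩).symm
    refine (LinearPMap.add_apply (negLaplacian a m 0)
      (multiplication a m (rescaledPotential V t)) ⟨x, hf⟩).trans ?_
    congr 1
    refine Lp.ext ?_
    exact (MemLp.coeFn_toLp (memLp_of_mem_multiplicationDomain a m (hdom x))).trans (hpt x).symm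

lemma IsInverse.zero_notMem_spec {H : Type*} [NormedAddCommGroup H] [InnerProductSpace ℝ H]
    {T : H →ₗ.[ℝ] H} {R : H →L[ℝ] H} (hR : IsInverse R T) : 0 ∉ Spec T := by
  refine fun h => h ⟨R, fun y => ?_, fun x => ?_⟩
  · obtain ⟨h, e⟩ := hR.right y
    exact ⟨h, by rw [e, zero_smul, sub_zero]⟩
  · rw [zero_smul, sub_zero, hR.left]

/-- A wave in the direction of an eigenvector of a constant matrix is an eigenvector of the operator
of multiplication by that matrix. -/
lemma multiplication_waveLp {b : OrthonormalBasis (Fin m × Fin 2) ℝ (Vec m)}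
    {L : Vec m →L[ℝ] Vec m} {T : L2 a m →L[ℝ] L2 a m}
    (hT : ∀ u : L2 a m, T u =ᵐ[cellMeasure a] fun x => L (u x)) {q : WaveIndex n m} {c : ℝ}
    (hc : L (b q.2) = c • b q.2) : T (waveLp a b q) = c • waveLp a b q := by
  refine Lp.ext ?_
  filter_upwards [hT (waveLp a b q), coeFn_waveLp b q, Lp.coeFn_smul c (waveLp a b q)]
    with x h1 h2 h3
  rw [h1, h3, Pi.smul_apply, h2, wave, map_smul, hc, smul_comm]

lemma card_prod_fin_two {ι : Type*} [Fintype ι] (P : ι → Prop) [DecidablePred P] :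
    Fintype.card {p : ι × Fin 2 // P p.1} = 2 * Fintype.card {i // P i} := by
  let e : {p : ι × Fin 2 // P p.1} ≃ {i // P i} × Fin 2 :=
    { toFun := fun p => (⟨p.1.1, p.2⟩, p.1.2)
      invFun := fun p => ⟨(p.1.1, p.2), p.1.2⟩
      left_inv := fun _ => rfl
      right_inv := fun _ => rfl }
  rw [Fintype.card_congr e, Fintype.card_prod, Fintype.card_fin, mul_comm]

end Multiplication

end PeriodicSchrodinger

end

theorem proposition3p14 {n m : ℕ}
    (a : Fin n → EuclideanSpace ℝ (Fin n)) (ha : LinearIndependent ℝ a)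
    (V : EuclideanSpace ℝ (Fin n) → Matrix (Fin m) (Fin m) ℝ)
    (hsymm : ∀ᵐ x ∂(volume.restrict (parallelepiped a)), (V x)ᵀ = V x)
    (hbdd : ∀ i j, MemLp (fun x => V x i j) ∞ (volume.restrict (parallelepiped a)))
    (hcont : ContinuousWithinAt V (parallelepiped a) 0)
    (hinv : IsUnit (V 0)) :
    ∃ τ₀ : ℝ, 0 < τ₀ ∧ τ₀ ≤ 1 ∧ ∀ τ : ℝ, 0 < τ → τ < τ₀ →
      0 ∉ PeriodicSchrodinger.Spec (PeriodicSchrodinger.schrodinger a 0 V τ) ∧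
      PeriodicSchrodinger.morseIndex (PeriodicSchrodinger.schrodinger a 0 V τ) =
        2 * PeriodicSchrodinger.matrixMorseIndex (V 0) := by
  open PeriodicSchrodinger in
  have hV0 : (V 0)ᵀ = V 0 := transpose_eq_of_continuousWithinAt ha hsymm hcont
  have hM : (V 0).IsHermitian := by
    rw [Matrix.IsHermitian, Matrix.conjTranspose_eq_transpose_of_trivial, hV0]
  obtain ⟨b, hb⟩ := exists_orthonormalBasis_kronecker hM
  obtain ⟨G, gap, hG⟩ := exists_hasReducedResolvent_negLaplacian b ha
  obtain ⟨W₀, hW₀⟩ := exists_multiplication (a := a) (F := fun _ => kroneckerCLM m (V 0))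
    aestronglyMeasurable_const (ae_of_all _ fun _ => le_rfl)
  obtain ⟨ε, hε, t₀, ht₀, key⟩ := hG.morseIndex_addBounded
    (inner_multiplication hW₀ (ae_of_all _ fun _ => inner_kroneckerCLM hV0))
    (lam := fun p => hM.eigenvalues p.1) (fun p => eigenvalues_ne_zero_of_isUnit hM hinv p.1)
    (fun p => multiplication_waveLp hW₀ (q := (0, p)) (by rw [kroneckerCLM_apply]; exact hb p))
  -- Since `τ Q` shrinks to the vertex `0`, continuity of `V` at `0` makes `V(τ x)` uniformly close
  -- to `V 0` on `Q`; this also bounds the multiplication operator.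
  have hnear : ∀ᶠ y in 𝓝[parallelepiped a] 0,
      ‖kroneckerCLM m (V y) - kroneckerCLM m (V 0)‖ ≤ ε := by
    have h := (continuous_kroneckerCLM (m := m)).continuousAt.tendsto.comp hcont.tendsto
    filter_upwards [h.eventually (Metric.closedBall_mem_nhds _ hε)] with y hy
    rwa [← dist_eq_norm]
  obtain ⟨δ, hδ0, hδ1, hδ⟩ := exists_forall_smul_mem hnear
  refine ⟨min δ √t₀, lt_min hδ0 (Real.sqrt_pos.2 ht₀), (min_le_left _ _).trans hδ1,
    fun τ h0 hτ => ?_⟩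
  have hτδ := hτ.trans_le (min_le_left _ _)
  have hqmp := quasiMeasurePreserving_smul_cell (a := a) h0 (hτδ.le.trans hδ1)
  have hclose : ∀ᵐ x ∂(cellMeasure a),
      ‖kroneckerCLM m (V (τ • x)) - kroneckerCLM m (V 0)‖ ≤ ε := by
    filter_upwards [ae_cellMeasure_mem a] with x hx using hδ τ h0 hτδ x hx
  obtain ⟨W, hW⟩ := exists_multiplication (a := a) (F := fun x => kroneckerCLM m (V (τ • x)))
    (C := ‖kroneckerCLM m (V 0)‖ + ε)
    (aestronglyMeasurable_kroneckerCLM fun i j =>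
      (hbdd i j).1.comp_quasiMeasurePreserving hqmp)
    (hclose.mono fun x hx => norm_le_norm_add_const_of_dist_le (by rwa [dist_eq_norm]))
  have hWsymm := inner_multiplication hW ((hqmp.ae hsymm).mono fun x hx => inner_kroneckerCLM hx)
  obtain ⟨⟨R, hR⟩, hmor⟩ := key (τ ^ 2) (by positivity)
    ((Real.lt_sqrt h0.le).1 (hτ.trans_le (min_le_right _ _))) W hWsymm
    (norm_sub_le_of_multiplication hW hW₀ hε.le hclose)
  rw [schrodinger_eq_addBounded hW]
  refine ⟨hR.zero_notMem_spec, ?_⟩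
  rw [hmor, matrixMorseIndex_eq_card hM hinv,
    card_prod_fin_two (fun i : Fin m => hM.eigenvalues i < 0)]
  push_cast
  rfl
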